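/- Let $d\ge 1$, let $H=(H_0,\dots,H_d)\in(0,1)^{d+1}$ and let $T\ge 0$. Let $B_0\equiv 0$ and, for $n\ge 1$, let $$B_n(t,x)=c_H\int_{|\xi|\le 2^{2n}}\int_{|\eta|\le 2^n}\frac{e^{i t\xi}-1}{|\xi|^{H_0+\frac12}}\prod_{j=1}^d\frac{e^{i x_j\eta_j}-1}{|\eta_j|^{H_j+\frac12}}\,\widehat W(d\xi,d\eta)$$ be the frequency truncation of the harmonizable representation of the fractional sheet of Hurst index $H$, where $\widehat W$ is the Fourier transform of a space-time white noise on $\mathbb R^{d+1}$ and $c_H>0$ is the normalising constant, $c_H^{-2}=\prod_{j=0}^d\int_{\mathbb R}|e^{iu}-1|^2|u|^{-2H_j-1}\,du$. Let $(\Psi_n)_{n\ge 0}$ be the solutions of $$i\partial_t\Psi_n-\Delta\Psi_n=\partial_t\partial_{x_1}\cdots\partial_{x_d}B_n,\qquad \Psi_n(0,\cdot)=0 ,$$ in the following sense: $\{\Psi_n(t,x)\}_{n\ge 0,\,t\ge 0,\,x\in\mathbb R^d}$ is a centered complex Gaussian process on a probability space, the map $(t,x)\mapsto\Psi_n(t,x)$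 is almost surely continuous on $[0,T]\times\mathbb R^d$ for every $n$, and, for all $n,m\ge 0$, $s,t\ge 0$, $x,y\in\mathbb R^d$, $$\mathbb E\big[\Psi_n(s,x)\overline{\Psi_m(t,y)}\big]=c_H^2\int_{D_n\cap D_m}\frac{1}{|\xi|^{2H_0-1}}\prod_{j=1}^d\frac1{|\eta_j|^{2H_j-1}}\,\gamma_s(\xi,|\eta|)\overline{\gamma_t(\xi,|\eta|)}\,e^{i\langle\eta,x-y\rangle}\,d\xi\,d\eta,$$ $$\mathbb E\big[\Psi_n(s,x)\Psi_m(t,y)\big]=-c_H^2\int_{D_n\cap D_m}\frac{1}{|\xi|^{2H_0-1}}\prod_{j=1}^d\frac1{|\eta_j|^{2H_j-1}}\,\gamma_s(\xi,|\eta|)\gamma_t(-\xi,|\eta|)\,e^{i\langle\eta,x-y\rangle}\,d\xi\,d\eta,$$ where $\gamma_t(\xi,r)=e^{i\xi t}\int_0^t e^{is(r^2-\xi)}\,ds$, $D_n=\{(\xi,\eta)\in\mathbb R\times\mathbb R^d:|\xi|\le 2^{2n},\ |\eta|\le 2^n\}$ for $n\ge 1$, and $D_0=\emptyset$ (so that $\Psi_0=0$).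 For $s\in\mathbb R$ and $1\le p\le\infty$ let $\mathcal W^{s,p}(\mathbb R^d)$ be the space of tempered distributions $f$ with $\|f\|_{\mathcal W^{s,p}}=\|\mathcal F^{-1}(\{1+|\cdot|^2\}^{s/2}\mathcal Ff)\|_{L^p(\mathbb R^d)}<\infty$, where $\mathcal F f(\lambda)=\int f(y)e^{-i\langle\lambda,y\rangle}dy$. Then for every smooth compactly supported $\chi:\mathbb R^d\to\mathbb R$ there is a random family $\chi\Psi=(\chi\Psi(t))_{t\in[0,T]}$ of tempered distributions such that, for all $2\le p\le\infty$ and all real $$\alpha>d+1-\Big(2H_0+\sum_{i=1}^dH_i\Big),$$ almost surely, all the functions $\chi\Psi_n$ and $\chi\Psi$ belong to $\mathcal C([0,T];\mathcal W^{-\alpha,p}(\mathbb R^d))$ and $\chi\Psi_n\to\chi\Psi$ in this space as $n\to\infty$. -/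

import Mathlib

open MeasureTheory ProbabilityTheory Filter Topology
open scoped NNReal ENNReal SchwartzMap ComplexConjugate

noncomputable section

/-- The Euclidean space `ℝ^d`. -/
abbrev Eucl (d : ℕ) : Type := EuclideanSpace ℝ (Fin d)

/-! ### Sobolev (Bessel potential) spaces -/

/-- The symbol `{1 + |λ|²}^{s/2}` at the angular frequency `λ = 2πx`. Mathlib's Fourier transform
is `∫ f(y) e^{-2πi⟨x,y⟩} dy`, whereas here frequencies are normalised by `∫ f(y) e^{-i⟨λ,y⟩} dy`. -/
def besselSymbol (d : ℕ) (s : ℝ) (x : Eucl d) : ℂ :=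
  (((1 + ‖(2 * Real.pi) • x‖ ^ 2) ^ (s / 2) : ℝ) : ℂ)

theorem besselSymbol_hasTemperateGrowth (d : ℕ) (s : ℝ) :
    (besselSymbol d s).HasTemperateGrowth := by
  have h1 : (fun x : Eucl d => ((1 + ‖x‖ ^ 2) ^ (s / 2) : ℝ)).HasTemperateGrowth :=
    Function.hasTemperateGrowth_one_add_norm_sq_rpow _ _
  have h2 : (fun x : Eucl d => (2 * Real.pi) • x).HasTemperateGrowth :=
    ((2 * Real.pi) • ContinuousLinearMap.id ℝ (Eucl d)).hasTemperateGrowth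
  have h3 := h1.comp h2
  have h4 : (fun y : ℝ => (y : ℂ)).HasTemperateGrowth :=
    Complex.ofRealCLM.hasTemperateGrowth
  exact h4.comp h3

/-- The operator `(Id - Δ)^{s/2}`, that is `f ↦ 𝓕⁻¹({1 + |·|²}^{s/2} 𝓕 f)`, on tempered
distributions. -/
def besselOp (d : ℕ) (s : ℝ) : 𝓢'(Eucl d, ℂ) →L[ℂ] 𝓢'(Eucl d, ℂ) :=
  TemperedDistribution.fourierMultiplierCLM ℂ (besselSymbol d s)

theorem besselOp_neg_besselOp (d : ℕ) (s : ℝ) (f : 𝓢'(Eucl d, ℂ)) :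
    besselOp d (-s) (besselOp d s f) = f := by
  unfold besselOp
  rw [TemperedDistribution.fourierMultiplierCLM_fourierMultiplierCLM_apply
    (besselSymbol_hasTemperateGrowth d _) (besselSymbol_hasTemperateGrowth d _)]
  have : besselSymbol d s * besselSymbol d (-s) = fun _ => 1 := by
    ext x
    have hx : 0 < 1 + ‖(2 * Real.pi) • x‖ ^ 2 := by positivity
    simp only [Pi.mul_apply, besselSymbol]
    rw [← Complex.ofReal_mul, ← Real.rpow_add hx]
    ring_nf
    simp
  rw [this]
  simp

/-- The tempered distributions `f` for which `(Id - Δ)^{s/2} f` is a function in `L^p(ℝ^d)`. -/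
def sobolevSubmodule (d : ℕ) (s : ℝ) (p : ℝ≥0∞) [Fact (1 ≤ p)] : Submodule ℂ 𝓢'(Eucl d, ℂ) :=
  (LinearMap.range
    (Lp.toTemperedDistributionCLM ℂ (volume : Measure (Eucl d)) p).toLinearMap).comap
    (besselOp d s).toLinearMap

/-- The space `W^{s,p}(ℝ^d)`. This is a type of its own, since it carries the topology of its norm
and not the one induced by `𝓢'`. -/
def SobolevSpace (d : ℕ) (s : ℝ) (p : ℝ≥0∞) [Fact (1 ≤ p)] : Type := ↥(sobolevSubmodule d s p)

namespace SobolevSpace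

variable {d : ℕ} {s : ℝ} {p : ℝ≥0∞} [Fact (1 ≤ p)]

instance : AddCommGroup (SobolevSpace d s p) :=
  inferInstanceAs (AddCommGroup ↥(sobolevSubmodule d s p))

instance : Module ℂ (SobolevSpace d s p) :=
  inferInstanceAs (Module ℂ ↥(sobolevSubmodule d s p))

/-- The tempered distribution underlying an element of `W^{s,p}`. -/
def toDistribution (f : SobolevSpace d s p) : 𝓢'(Eucl d, ℂ) := Subtype.val f

theorem exists_toLp (f : SobolevSpace d s p) :
    ∃ g : Lp ℂ p (volume : Measure (Eucl d)),
      Lp.toTemperedDistributionCLM ℂ volume p g = besselOp d s f.toDistribution :=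
  Subtype.property f

theorem toTemperedDistributionCLM_injective :
    Function.Injective (Lp.toTemperedDistributionCLM ℂ (volume : Measure (Eucl d)) p) := by
  have h := Lp.ker_toTemperedDistributionCLM_eq_bot (F := ℂ) (μ := (volume : Measure (Eucl d)))
    (p := p)
  exact LinearMap.ker_eq_bot.mp h

/-- The (unique) `L^p` function `(Id - Δ)^{s/2} f`. -/
def toLp : SobolevSpace d s p →+ Lp ℂ p (volume : Measure (Eucl d)) where
  toFun f := (exists_toLp f).choose
  map_zero' := by
    apply toTemperedDistributionCLM_injective
    rw [(exists_toLp _).choose_spec, map_zero]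
    exact map_zero (besselOp d s)
  map_add' f g := by
    apply toTemperedDistributionCLM_injective
    rw [map_add, (exists_toLp _).choose_spec, (exists_toLp _).choose_spec,
      (exists_toLp _).choose_spec]
    exact map_add (besselOp d s) f.toDistribution g.toDistribution

theorem toLp_spec (f : SobolevSpace d s p) :
    Lp.toTemperedDistributionCLM ℂ volume p (toLp f) = besselOp d s f.toDistribution :=
  (exists_toLp f).choose_spec

theorem toLp_injective : Function.Injective (toLp : SobolevSpace d s p →+ _) := by
  intro f g h
  have h1 : besselOp d s f.toDistribution = besselOp d s g.toDistribution := by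
    rw [← toLp_spec, ← toLp_spec, h]
  have h2 : f.toDistribution = g.toDistribution := by
    rw [← besselOp_neg_besselOp d s f.toDistribution, h1, besselOp_neg_besselOp]
  exact Subtype.ext h2

/-- `W^{s,p}` is normed by `‖f‖ = ‖(Id - Δ)^{s/2} f‖_{L^p}`. -/
instance : NormedAddCommGroup (SobolevSpace d s p) :=
  NormedAddCommGroup.induced (SobolevSpace d s p) (Lp ℂ p (volume : Measure (Eucl d))) toLp
    toLp_injective

theorem norm_eq (f : SobolevSpace d s p) : ‖f‖ = ‖toLp f‖ := rfl

end SobolevSpace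

/-- The tempered distribution `f` is given by integration against the function `g`. -/
def IsGivenBy {d : ℕ} (f : 𝓢'(Eucl d, ℂ)) (g : Eucl d → ℂ) : Prop :=
  ∀ φ : 𝓢(Eucl d, ℂ), f φ = ∫ x, φ x * g x

/-! ### The linear solutions

The Hurst index is `H = (H 0, …, H d)`; the time index is `H 0` and the index of the `i`-th space
coordinate (`i : Fin d`) is `H i.succ`. -/

/-- The normalising constant `c_H > 0` of the harmonizable representation: with it the field
`c_H ∫∫ (e^{itξ} - 1) / |ξ|^{H_0 + 1/2} ∏ᵢ (e^{i xᵢ ηᵢ} - 1) / |ηᵢ|^{H_i + 1/2} Ŵ(dξ, dη)`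
is a fractional sheet of Hurst index `H`; in particular it has variance `1` at `(1, …, 1)`, which
reads `c_H² ∏ᵢ ∫ |e^{iu} - 1|² / |u|^{2 H_i + 1} du = 1`. -/
def harmonizableConst {d : ℕ} (H : Fin (d + 1) → ℝ) : ℝ :=
  (Real.sqrt (∏ i, ∫ u : ℝ, ‖Complex.exp (Complex.I * u) - 1‖ ^ 2 / |u| ^ (2 * H i + 1)))⁻¹

/-- The frequencies `(ξ, η)` that are kept in the `n`-th approximation `B_n` of the sheet:
`|ξ| ≤ 2^{2n}` and `|η| ≤ 2^n` if `n ≥ 1`, and none if `n = 0` (as `B_0 = 0`). -/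
def freqDomain (d : ℕ) (n : ℕ) : Set (ℝ × Eucl d) :=
  {q | 1 ≤ n ∧ |q.1| ≤ 2 ^ (2 * n) ∧ ‖q.2‖ ≤ 2 ^ n}

/-- `γ_t(ξ, r) = e^{iξt} ∫_0^t e^{is(r² - ξ)} ds`. -/
def gammaKernel (t ξ r : ℝ) : ℂ :=
  Complex.exp (Complex.I * ξ * t) * ∫ s in (0 : ℝ)..t, Complex.exp (Complex.I * s * (r ^ 2 - ξ))

/-- The spectral weight `|ξ|^{-(2H_0 - 1)} ∏ᵢ |ηᵢ|^{-(2H_i - 1)}`. -/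
def spectralWeight {d : ℕ} (H : Fin (d + 1) → ℝ) (q : ℝ × Eucl d) : ℝ :=
  1 / |q.1| ^ (2 * H 0 - 1) * ∏ i : Fin d, 1 / |q.2 i| ^ (2 * H i.succ - 1)

/-- `Ψ = (Ψ_n(t, x))` is the family of solutions of `i ∂_t Ψ_n - Δ Ψ_n = ∂_t ∂_{x_1} ⋯ ∂_{x_d} B_n`,
`Ψ_n(0, ·) = 0`, driven by the truncated fractional sheets `B_n` of index `H`: a centered complex
Gaussian process, jointly in `(n, t, x)`, with the covariances prescribed below. -/
structure IsLinearSolution {d : ℕ} (H : Fin (d + 1) → ℝ) {Ω : Type*} [MeasurableSpace Ω]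
    (P : Measure Ω) (Ψ : ℕ → ℝ≥0 → Eucl d → Ω → ℂ) : Prop where
  gaussian : IsGaussianProcess (fun k : ℕ × ℝ≥0 × Eucl d => Ψ k.1 k.2.1 k.2.2) P
  centered : ∀ n t x, ∫ ω, Ψ n t x ω ∂P = 0
  covariance : ∀ (n m : ℕ) (s t : ℝ≥0) (x y : Eucl d),
    ∫ ω, Ψ n s x ω * conj (Ψ m t y ω) ∂P =
      (harmonizableConst H : ℂ) ^ 2 *
        ∫ q in freqDomain d n ∩ freqDomain d m, (spectralWeight H q : ℂ) *
          gammaKernel s q.1 ‖q.2‖ * conj (gammaKernel t q.1 ‖q.2‖) *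
          Complex.exp (Complex.I * (inner ℝ q.2 (x - y) : ℝ))
  pseudoCovariance : ∀ (n m : ℕ) (s t : ℝ≥0) (x y : Eucl d),
    ∫ ω, Ψ n s x ω * Ψ m t y ω ∂P =
      -(harmonizableConst H : ℂ) ^ 2 *
        ∫ q in freqDomain d n ∩ freqDomain d m, (spectralWeight H q : ℂ) *
          gammaKernel s q.1 ‖q.2‖ * gammaKernel t (-q.1) ‖q.2‖ *
          Complex.exp (Complex.I * (inner ℝ q.2 (x - y) : ℝ))

end

noncomputable section

/-! ### Random variables with Gaussian moment bounds -/

/-! The argument runs through the spectral measure. By the prescribed covariance, a finite linear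
combination of the variables Ψ_n(t, x) has the same L² norm as the same combination of the kernels
1_{D_n} γ_t(ξ, |η|) e^{i⟨η, x⟩} in L² of `spectralMeasure`. Such a combination is centered Gaussian,
so this norm controls all its moments (`momentBound_of_mem_solSpan`). Moment bounds survive almost
sure limits (`momentBound_of_mem_limClosure`), hence they also hold for (Id - Δ)^{-α/2}(χΨ_n)(t, x).
Its kernel is 1_{D_n} γ_t(ξ, |η|) times the value at x of (Id - Δ)^{-α/2} applied to χ e^{i⟨η, ·⟩}
(`mem_solSpace_besselApply`). Since the Fourier transform of χ is Schwartz, that value is O((1 +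
|η|²)^{-α/2}) and decays in x faster than any power, uniformly in η.

Size. On [0, T] one has |γ_t|² ≲ 1 / (1 + (ξ - |η|²)²). Integrating this against |ξ|^{1-2H_0} in ξ
gives at most a constant times (1 + |η|²)^{1-2H_0}, the resonance being at ξ = |η|². What remains is
the integral of ∏|η_i|^{1-2H_i} (1 + |η|²)^{1-2H_0-α}, which converges under the hypothesis on α
(`lintegral_resonanceWeight_lt_top`). The inequality is strict, so a small power κ of 1 + |ξ| and 1
+ |η|² can still be inserted. On D_n \ D_{n-1} this power is at least 2^{2κ(n-1)}, so the n-th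
increment of the Bessel potentials has geometrically small variance
(`exists_setLIntegral_freqShell_le`).

Uniformity. In (t, x) these increments are also Lipschitz in every moment, with a constant that
grows at most exponentially in n. Geometric interpolation of the two bounds gives a small Hölder
exponent together with geometric decay. Dyadic chaining with one high moment, run over all n and all
dyadic boxes in space at once, yields an almost sure bound C θ^n, uniform in t and with a polynomial
weight in x (`ae_exists_weighted_bound`, `ae_exists_besselIncrement_bound`).

Conclusion. For a fixed path, the Bessel potentials of χΨ_n are then a Cauchy sequence in C([0, T];
L^p), and the isometry between L^p and W^{-α,p} transports the limit (`exists_tendsto_sobolev`). The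
limit family is defined as a weak limit against Schwartz functions, so it depends neither on p nor
on α; only the exceptional null set may. -/

/-- The `L^p` norm of a standard normal variable. -/
def gaussNorm (p : ℕ) : ℝ≥0∞ := eLpNorm id p (gaussianReal 0 1)

theorem gaussNorm_lt_top (p : ℕ) : gaussNorm p < ⊤ :=
  (memLp_id_gaussianReal' (p : ℝ≥0∞) (ENNReal.natCast_ne_top p)).2

/-- All moments of `V` are bounded as if `V` were a complex Gaussian variable of standard
deviation `σ`. -/
def MomentBound {Ω : Type*} [MeasurableSpace Ω] (P : Measure Ω) (V : Ω → ℂ) (σ : ℝ≥0∞) : Prop :=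
  AEStronglyMeasurable V P ∧ ∀ p : ℕ, 1 ≤ p → eLpNorm V p P ≤ 2 * gaussNorm p * σ

namespace MomentBound

variable {Ω : Type*} [MeasurableSpace Ω] {P : Measure Ω} {V W : Ω → ℂ} {σ τ : ℝ≥0∞}

theorem mono (h : MomentBound P V σ) (hσ : σ ≤ τ) : MomentBound P V τ :=
  ⟨h.1, fun p hp => (h.2 p hp).trans (by gcongr)⟩

theorem congr (h : MomentBound P V σ) (hV : V =ᵐ[P] W) : MomentBound P W σ :=
  ⟨h.1.congr hV, fun p hp => (eLpNorm_congr_ae hV) ▸ h.2 p hp⟩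

theorem add (h : MomentBound P V σ) (h' : MomentBound P W τ) :
    MomentBound P (fun ω => V ω + W ω) (σ + τ) := by
  refine ⟨h.1.add h'.1, fun p hp => ?_⟩
  refine (eLpNorm_add_le h.1 h'.1 (by exact_mod_cast hp)).trans ?_
  rw [mul_add]
  exact add_le_add (h.2 p hp) (h'.2 p hp)

theorem sub (h : MomentBound P V σ) (h' : MomentBound P W τ) :
    MomentBound P (fun ω => V ω - W ω) (σ + τ) := by
  refine ⟨h.1.sub h'.1, fun p hp => ?_⟩
  refine (eLpNorm_sub_le h.1 h'.1 (by exact_mod_cast hp)).trans ?_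
  rw [mul_add]
  exact add_le_add (h.2 p hp) (h'.2 p hp)

theorem const_mul (h : MomentBound P V σ) (c : ℂ) :
    MomentBound P (fun ω => c * V ω) (‖c‖ₑ * σ) := by
  refine ⟨h.1.const_mul c, fun p hp => ?_⟩
  have : (fun ω => c * V ω) = c • V := rfl
  rw [this, eLpNorm_const_smul]
  calc ‖c‖ₑ * eLpNorm V p P ≤ ‖c‖ₑ * (2 * gaussNorm p * σ) := by gcongr; exact h.2 p hp
    _ = _ := by ring

theorem lintegral_pow_le (h : MomentBound P V σ) {p : ℕ} (hp : 1 ≤ p) :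
    ∫⁻ ω, ‖V ω‖ₑ ^ p ∂P ≤ (2 * gaussNorm p) ^ p * σ ^ p := by
  have h1 := h.2 p hp
  have hp0 : (p : ℝ≥0∞) ≠ 0 := by exact_mod_cast (by omega : p ≠ 0)
  rw [eLpNorm_eq_lintegral_rpow_enorm_toReal hp0 (ENNReal.natCast_ne_top p)] at h1
  simp only [ENNReal.toReal_natCast, ENNReal.rpow_natCast] at h1
  have h2 := pow_le_pow_left' h1 p
  rwa [← ENNReal.rpow_natCast, ← ENNReal.rpow_mul, one_div, inv_mul_cancel₀
    (by exact_mod_cast (by omega : p ≠ 0)), ENNReal.rpow_one, mul_pow] at h2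

end MomentBound

/-- The expectation of the sum of all p-th powers is finite, so the sum itself is almost surely
finite, and it dominates each of its terms. -/
theorem ae_exists_bound_of_momentBound {Ω ι : Type*} [MeasurableSpace Ω] [Countable ι]
    {P : Measure Ω} {Y : ι → Ω → ℂ} {σ : ι → ℝ≥0∞} (hY : ∀ j, MomentBound P (Y j) (σ j))
    {p : ℕ} (hp : 1 ≤ p) (hσ : ∑' j, σ j ^ p < ⊤) :
    ∀ᵐ ω ∂P, ∃ C : ℝ, 0 ≤ C ∧ ∀ j, ‖Y j ω‖ ≤ C := by
  have hm : ∀ j, AEMeasurable (fun ω => ‖Y j ω‖ₑ ^ p) P := fun j => (hY j).1.enorm.pow_const p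
  have h1 : ∫⁻ ω, ∑' j, ‖Y j ω‖ₑ ^ p ∂P < ⊤ := by
    rw [lintegral_tsum hm]
    refine (ENNReal.tsum_le_tsum fun j => (hY j).lintegral_pow_le hp).trans_lt ?_
    rw [ENNReal.tsum_mul_left]
    exact ENNReal.mul_lt_top (ENNReal.pow_lt_top
      (ENNReal.mul_lt_top (by simp) (gaussNorm_lt_top p))) hσ
  filter_upwards [ae_lt_top' (AEMeasurable.tsum hm) h1.ne] with ω hω
  set S := ∑' j, ‖Y j ω‖ₑ ^ p with hS
  refine ⟨max 1 S.toReal, by positivity, fun j => ?_⟩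
  have h2 : ‖Y j ω‖ₑ ^ p ≤ S := ENNReal.le_tsum j
  have h3 : ‖Y j ω‖ ^ p ≤ S.toReal := by
    have := ENNReal.toReal_mono hω.ne h2
    simpa using this
  rcases le_or_gt ‖Y j ω‖ 1 with h | h
  · exact h.trans (le_max_left _ _)
  · exact ((le_self_pow₀ h.le (by omega)).trans h3).trans (le_max_right _ _)

/-! ### Dyadic chaining on the unit cube -/

/-- The point `2^{-k} J` of the cube. -/
def dyadicPoint {D : ℕ} (k : ℕ) (J : Fin D → ℕ) : Fin D → ℝ := fun i => (J i : ℝ) / 2 ^ k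

theorem dyadicPoint_mem {D : ℕ} {k : ℕ} {J : Fin D → ℕ} (h : ∀ i, J i ≤ 2 ^ k) :
    dyadicPoint k J ∈ Set.Icc (0 : Fin D → ℝ) 1 := by
  constructor
  · intro i
    simp only [dyadicPoint, Pi.zero_apply]
    positivity
  · intro i
    simp only [dyadicPoint, Pi.one_apply]
    rw [div_le_one (by positivity)]
    exact_mod_cast h i

theorem half_le {D : ℕ} {k : ℕ} {J : Fin D → ℕ} (h : ∀ i, J i ≤ 2 ^ (k + 1)) :
    ∀ i, J i / 2 ≤ 2 ^ k := fun i => by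
  have := h i
  rw [pow_succ] at this
  omega

theorem norm_dyadicPoint_sub_le {D : ℕ} (k : ℕ) (J : Fin D → ℕ) :
    ‖dyadicPoint (k + 1) J - dyadicPoint k (fun i => J i / 2)‖ ≤ (1 / 2) ^ k := by
  rw [pi_norm_le_iff_of_nonneg (by positivity)]
  intro i
  simp only [Pi.sub_apply, dyadicPoint]
  have h1 : (J i : ℝ) / 2 ^ (k + 1) - ((J i / 2 : ℕ) : ℝ) / 2 ^ k
      = ((J i : ℝ) - 2 * ((J i / 2 : ℕ) : ℝ)) / 2 * (1 / 2) ^ k := by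
    rw [one_div, inv_pow, pow_succ]
    field_simp
  have h2 : (J i : ℝ) = 2 * ((J i / 2 : ℕ) : ℝ) + ((J i % 2 : ℕ) : ℝ) := by
    exact_mod_cast (Nat.div_add_mod (J i) 2).symm
  have h3 : ((J i % 2 : ℕ) : ℝ) ≤ 1 := by
    exact_mod_cast Nat.lt_succ_iff.mp (Nat.mod_lt _ two_pos)
  rw [h1, Real.norm_eq_abs, abs_of_nonneg (by
    have : (0 : ℝ) ≤ ((J i % 2 : ℕ) : ℝ) := by positivity
    apply mul_nonneg _ (by positivity); linarith)]
  have : ((J i : ℝ) - 2 * ((J i / 2 : ℕ) : ℝ)) / 2 ≤ 1 := by linarith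
  exact mul_le_of_le_one_left (by positivity) this

/-- Telescoping along the chain of ancestors of a dyadic point, the ancestor being obtained by
halving the integer index, sums a geometric series. Continuity extends the bound from dyadic points
to the whole cube. -/
theorem norm_le_of_dyadic {D : ℕ} {f : (Fin D → ℝ) → ℂ} (hf : ContinuousOn f (Set.Icc 0 1))
    {A B r : ℝ} (hB : 0 ≤ B) (hr0 : 0 ≤ r) (hr1 : r < 1)
    (h0 : ∀ J : Fin D → ℕ, (∀ i, J i ≤ 1) → ‖f (dyadicPoint 0 J)‖ ≤ A)
    (h1 : ∀ (k : ℕ) (J : Fin D → ℕ), (∀ i, J i ≤ 2 ^ (k + 1)) →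
      ‖f (dyadicPoint (k + 1) J) - f (dyadicPoint k (fun i => J i / 2))‖ ≤ B * r ^ k)
    {z : Fin D → ℝ} (hz : z ∈ Set.Icc (0 : Fin D → ℝ) 1) : ‖f z‖ ≤ A + B * (1 - r)⁻¹ := by
  have key : ∀ (k : ℕ) (J : Fin D → ℕ), (∀ i, J i ≤ 2 ^ k) →
      ‖f (dyadicPoint k J)‖ ≤ A + B * ∑ i ∈ Finset.range k, r ^ i := by
    intro k
    induction k with
    | zero => intro J hJ; simpa using h0 J (by simpa using hJ)
    | succ k ih =>
      intro J hJ
      have h2 := ih _ (half_le hJ)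
      have h3 := h1 k J hJ
      rw [Finset.sum_range_succ, mul_add]
      have h4 := norm_le_insert' (f (dyadicPoint (k + 1) J)) (f (dyadicPoint k (fun i => J i / 2)))
      linarith
  have hgeo : ∀ k, ∑ i ∈ Finset.range k, r ^ i ≤ (1 - r)⁻¹ := fun k => by
    rw [← tsum_geometric_of_lt_one hr0 hr1]
    exact (summable_geometric_of_lt_one hr0 hr1).sum_le_tsum _ (fun i _ => by positivity)
  -- Binary truncations of the coordinates of z; these dyadic points converge to z.
  set J : ℕ → Fin D → ℕ := fun k i => ⌊2 ^ k * z i⌋₊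
  have hJ : ∀ k i, J k i ≤ 2 ^ k := fun k i => by
    have : 2 ^ k * z i ≤ ((2 ^ k : ℕ) : ℝ) := by
      push_cast
      exact mul_le_of_le_one_right (by positivity) (hz.2 i)
    exact Nat.floor_le_of_le this
  have hlim : Tendsto (fun k => dyadicPoint k (J k)) atTop (𝓝 z) := by
    rw [tendsto_pi_nhds]
    intro i
    have h5 := (tendsto_nat_floor_mul_div_atTop (hz.1 i)).comp
      (tendsto_pow_atTop_atTop_of_one_lt (one_lt_two (α := ℝ)))
    refine h5.congr fun k => ?_
    simp only [Function.comp, dyadicPoint, J]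
    rw [mul_comm]
  have hlim2 : Tendsto (fun k => ‖f (dyadicPoint k (J k))‖) atTop (𝓝 ‖f z‖) := by
    refine ((hf z hz).tendsto.comp (tendsto_nhdsWithin_iff.mpr ⟨hlim, ?_⟩)).norm
    exact Eventually.of_forall fun k => dyadicPoint_mem (hJ k)
  refine le_of_tendsto hlim2 (Eventually.of_forall fun k => (key k _ (hJ k)).trans ?_)
  gcongr
  exact hgeo k

/-- A Kolmogorov type criterion: a countable family of continuous fields on the unit cube, small
in size and with Lipschitz moments, is almost surely bounded. -/
theorem ae_exists_bound_of_fields {Ω ι : Type*} [MeasurableSpace Ω] [Countable ι]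
    {P : Measure Ω} {D : ℕ} {X : ι → (Fin D → ℝ) → Ω → ℂ}
    (hc : ∀ i, ∀ᵐ ω ∂P, ContinuousOn (fun z => X i z ω) (Set.Icc 0 1))
    {ρ : ι → ℝ} (hρ1 : ∀ i, 1 ≤ ρ i) {Q : ℕ} (hρ : ∑' i, ENNReal.ofReal (ρ i ^ (-(Q : ℝ))) < ⊤)
    {C κ K : ℝ} (hC : 0 ≤ C) (hκ : 0 < κ) (hK : 0 ≤ K)
    (h1 : ∀ i, ∀ z ∈ Set.Icc (0 : Fin D → ℝ) 1,
      MomentBound P (X i z) (ENNReal.ofReal (C * ρ i ^ (-κ))))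
    (h2 : ∀ i, ∀ z ∈ Set.Icc (0 : Fin D → ℝ) 1, ∀ z' ∈ Set.Icc (0 : Fin D → ℝ) 1,
      MomentBound P (fun ω => X i z ω - X i z' ω) (ENNReal.ofReal (C * ρ i ^ K * ‖z - z'‖))) :
    ∀ᵐ ω ∂P, ∃ C' : ℝ, 0 ≤ C' ∧ ∀ i, ∀ z ∈ Set.Icc (0 : Fin D → ℝ) 1, ‖X i z ω‖ ≤ C' := by
  -- The interpolation exponent for which -κ(1 - θ) + Kθ = -κ/2: half of the decay in ρ survives.
  set θ : ℝ := κ / (2 * (κ + K)) with hθ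
  have hθ0 : 0 < θ := by positivity
  have hθ1 : θ ≤ 1 := by
    rw [hθ, div_le_one (by positivity)]; linarith
  -- The Hölder gain at level k is 2^{-kθ} = s^k · s^k. One factor s^k normalises the increments and
  -- makes the chaining series converge; the other pays for the number of dyadic points.
  set s : ℝ := (2 : ℝ) ^ (-(θ / 2)) with hs
  have hs0 : 0 < s := by positivity
  have hs1 : s < 1 := Real.rpow_lt_one_of_one_lt_of_neg one_lt_two (by linarith)
  -- The moment p satisfies pκ/2 ≥ Q, to sum over the family, and pθ/2 ≥ D + 1, so that s^{kp} ≤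
  -- 2^{-k(D+1)} beats the at most (4 · 2^k)^D points of level k + 1.
  obtain ⟨p, hp⟩ := exists_nat_gt (max 1 (max (2 * Q / κ) (2 * (D + 1) / θ)))
  have hp1 : 1 ≤ p := by
    have := (le_max_left _ _).trans hp.le
    exact_mod_cast this
  have hpQ : Q ≤ κ / 2 * p := by
    have := (le_max_left _ _).trans ((le_max_right _ _).trans hp.le)
    rw [div_le_iff₀ hκ] at this
    linarith
  have hpD : (D + 1 : ℝ) ≤ θ / 2 * p := by
    have := (le_max_right _ _).trans ((le_max_right _ _).trans hp.le)
    rw [div_le_iff₀ hθ0] at this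
    linarith
  have hρ0 : ∀ i, 0 < ρ i := fun i => lt_of_lt_of_le one_pos (hρ1 i)
  have hpow : ∀ i, ENNReal.ofReal (2 * C * ρ i ^ (-(κ / 2))) ^ p ≤
      ENNReal.ofReal (2 * C) ^ p * ENNReal.ofReal (ρ i ^ (-(Q : ℝ))) := fun i => by
    rw [ENNReal.ofReal_mul (by positivity), mul_pow,
      ← ENNReal.ofReal_pow (Real.rpow_nonneg (hρ0 i).le _)]
    gcongr
    rw [← Real.rpow_mul_natCast (hρ0 i).le]
    exact Real.rpow_le_rpow_of_exponent_le (hρ1 i) (by linarith)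
  -- vertices
  have hV := ae_exists_bound_of_momentBound (P := P) (ι := ι × (Fin D → Fin 2))
    (Y := fun j => X j.1 (dyadicPoint 0 (fun i => (j.2 i : ℕ))))
    (σ := fun j => ENNReal.ofReal (2 * C * ρ j.1 ^ (-(κ / 2))))
    (fun j => (h1 j.1 _ (dyadicPoint_mem fun i => by
      have := (j.2 i).2
      simp only [pow_zero]; omega)).mono (by
        apply ENNReal.ofReal_le_ofReal
        have : ρ j.1 ^ (-κ) ≤ ρ j.1 ^ (-(κ / 2)) :=
          Real.rpow_le_rpow_of_exponent_le (hρ1 _) (by linarith)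
        have h0 := Real.rpow_nonneg (hρ0 j.1).le (-(κ / 2))
        nlinarith [mul_nonneg hC h0, mul_le_mul_of_nonneg_left this hC])) hp1 (by
    rw [ENNReal.tsum_prod']
    simp only [tsum_fintype, Finset.sum_const, nsmul_eq_mul]
    rw [ENNReal.tsum_mul_left]
    refine ENNReal.mul_lt_top (by simp) ?_
    refine (ENNReal.tsum_le_tsum hpow).trans_lt ?_
    rw [ENNReal.tsum_mul_left]
    exact ENNReal.mul_lt_top (ENNReal.pow_lt_top ENNReal.ofReal_lt_top) hρ)
  -- increments
  have hI := ae_exists_bound_of_momentBound (P := P)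
    (ι := ι × Σ k : ℕ, (Fin D → Fin (2 ^ (k + 1) + 1)))
    (Y := fun j ω => (((s ^ j.2.1)⁻¹ : ℝ) : ℂ) *
      (X j.1 (dyadicPoint (j.2.1 + 1) (fun i => (j.2.2 i : ℕ))) ω -
        X j.1 (dyadicPoint j.2.1 (fun i => (j.2.2 i : ℕ) / 2)) ω))
    (σ := fun j => ENNReal.ofReal (2 * C * ρ j.1 ^ (-(κ / 2))) * ENNReal.ofReal (s ^ j.2.1))
    (fun j => by
      obtain ⟨i, k, J⟩ := j
      have hJ : ∀ i, (J i : ℕ) ≤ 2 ^ (k + 1) := fun i => Nat.lt_succ_iff.mp (J i).2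
      have hz := dyadicPoint_mem hJ
      have hz' := dyadicPoint_mem (half_le hJ)
      set a : ℝ := 2 * C * ρ i ^ (-κ) with ha
      set b : ℝ := 2 * C * ρ i ^ K * (1 / 2) ^ k with hb
      have hρκ := Real.rpow_nonneg (hρ0 i).le (-κ)
      have hρK := Real.rpow_nonneg (hρ0 i).le K
      have ha0 : 0 ≤ a := by positivity
      have hb0 : 0 ≤ b := by positivity
      have m1 : MomentBound P (fun ω => X i (dyadicPoint (k + 1) (fun i => (J i : ℕ))) ω -
          X i (dyadicPoint k (fun i => (J i : ℕ) / 2)) ω) (ENNReal.ofReal a) :=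
        ((h1 i _ hz).sub (h1 i _ hz')).mono (by
          rw [← ENNReal.ofReal_add (by positivity) (by positivity)]
          apply ENNReal.ofReal_le_ofReal
          rw [ha]; linarith)
      have m2 : MomentBound P (fun ω => X i (dyadicPoint (k + 1) (fun i => (J i : ℕ))) ω -
          X i (dyadicPoint k (fun i => (J i : ℕ) / 2)) ω) (ENNReal.ofReal b) :=
        (h2 i _ hz _ hz').mono (by
          apply ENNReal.ofReal_le_ofReal
          have := norm_dyadicPoint_sub_le k (fun i => (J i : ℕ))
          rw [hb]
          have h3 := mul_le_mul_of_nonneg_left this (mul_nonneg hC hρK)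
          have h4 : 0 ≤ C * ρ i ^ K * (1 / 2) ^ k := by positivity
          linarith)
      -- min(a, b) ≤ a^{1-θ} b^θ, with a the size bound and b the Lipschitz bound.
      have m3 : MomentBound P (fun ω => X i (dyadicPoint (k + 1) (fun i => (J i : ℕ))) ω -
          X i (dyadicPoint k (fun i => (J i : ℕ) / 2)) ω)
          (ENNReal.ofReal (a ^ (1 - θ) * b ^ θ)) := by
        rcases le_total a b with hab | hab
        · refine m1.mono (ENNReal.ofReal_le_ofReal ?_)
          calc a = a ^ (1 - θ) * a ^ θ := by
                rw [← Real.rpow_add_of_nonneg ha0 (by linarith) hθ0.le]; simp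
            _ ≤ _ := by gcongr
        · refine m2.mono (ENNReal.ofReal_le_ofReal ?_)
          calc b = b ^ (1 - θ) * b ^ θ := by
                rw [← Real.rpow_add_of_nonneg hb0 (by linarith) hθ0.le]; simp
            _ ≤ _ := by
              have : 0 ≤ 1 - θ := by linarith
              gcongr
      refine (m3.const_mul _).mono ?_
      rw [← ENNReal.ofReal_mul (mul_nonneg (by positivity) (Real.rpow_nonneg (hρ0 i).le _)),
        ← ofReal_norm, ← ENNReal.ofReal_mul (norm_nonneg _)]
      apply ENNReal.ofReal_le_ofReal
      rw [Complex.norm_real, Real.norm_of_nonneg (by positivity),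
        inv_mul_le_iff₀ (by positivity)]
      have e1 : a ^ (1 - θ) * b ^ θ =
          (2 * C) * (ρ i ^ (-κ * (1 - θ) + K * θ)) * (s ^ k * s ^ k) := by
        rw [ha, hb, Real.mul_rpow (x := 2 * C) (by positivity) hρκ,
          Real.mul_rpow (x := 2 * C * ρ i ^ K) (by positivity) (by positivity),
          Real.mul_rpow (x := 2 * C) (by positivity) hρK, ← Real.rpow_mul (hρ0 i).le,
          ← Real.rpow_mul (hρ0 i).le, Real.rpow_add (hρ0 i)]
        have e2 : (2 * C) ^ (1 - θ) * (2 * C) ^ θ = 2 * C := by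
          rw [← Real.rpow_add_of_nonneg (by positivity) (by linarith) hθ0.le]; simp
        have e3 : ((1 / 2 : ℝ) ^ k) ^ θ = s ^ k * s ^ k := by
          rw [← mul_pow, hs, ← Real.rpow_add two_pos, ← Real.rpow_natCast, ← Real.rpow_natCast,
            ← Real.rpow_mul (by norm_num), ← Real.rpow_mul (by norm_num), one_div,
            Real.inv_rpow (by norm_num), ← Real.rpow_neg (by norm_num)]
          congr 1; ring
        rw [e3]
        linear_combination (ρ i ^ (-κ * (1 - θ)) * ρ i ^ (K * θ) * (s ^ k * s ^ k)) * e2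
      rw [e1]
      have e4 : -κ * (1 - θ) + K * θ = -(κ / 2) := by
        rw [hθ]; field_simp; ring
      rw [e4]
      exact le_of_eq (by ring)) hp1 (by
    rw [ENNReal.tsum_prod']
    simp only [mul_pow]
    have h3 : ∀ i : ι, ∑' j : Σ k : ℕ, (Fin D → Fin (2 ^ (k + 1) + 1)),
        ENNReal.ofReal (2 * C * ρ i ^ (-(κ / 2))) ^ p * ENNReal.ofReal (s ^ j.1) ^ p ≤
        (ENNReal.ofReal (2 * C) ^ p * ENNReal.ofReal (ρ i ^ (-(Q : ℝ)))) *
          (4 ^ D * ∑' k : ℕ, (2⁻¹ : ℝ≥0∞) ^ k) := fun i => by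
      rw [ENNReal.tsum_mul_left]
      refine mul_le_mul' (hpow i) ?_
      rw [ENNReal.tsum_sigma', ← ENNReal.tsum_mul_left]
      refine ENNReal.tsum_le_tsum fun k => ?_
      simp only [tsum_fintype, Finset.sum_const, nsmul_eq_mul, Finset.card_univ, Fintype.card_fun,
        Fintype.card_fin]
      rw [← ENNReal.ofReal_pow (by positivity)]
      have e1 : ((2 ^ (k + 1) + 1 : ℕ) ^ D : ℝ) * (s ^ k) ^ p ≤ 4 ^ D * (1 / 2) ^ k := by
        have e2 : ((2 ^ (k + 1) + 1 : ℕ) : ℝ) ≤ 4 * 2 ^ k := by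
          push_cast
          have : (1 : ℝ) ≤ 2 ^ k := one_le_pow₀ one_le_two
          rw [pow_succ]; linarith
        have e3 : (s ^ k) ^ p ≤ ((2 : ℝ) ^ k) ^ (-(D + 1 : ℝ)) := by
          rw [hs, ← Real.rpow_natCast, ← Real.rpow_natCast, ← Real.rpow_natCast,
            ← Real.rpow_mul two_pos.le, ← Real.rpow_mul two_pos.le, ← Real.rpow_mul two_pos.le]
          apply Real.rpow_le_rpow_of_exponent_le one_le_two
          nlinarith [mul_le_mul_of_nonneg_left hpD (Nat.cast_nonneg (α := ℝ) k)]
        calc ((2 ^ (k + 1) + 1 : ℕ) ^ D : ℝ) * (s ^ k) ^ p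
            ≤ (4 * 2 ^ k) ^ D * ((2 : ℝ) ^ k) ^ (-(D + 1 : ℝ)) := by gcongr
          _ = 4 ^ D * (1 / 2) ^ k := by
            rw [mul_pow, Real.rpow_neg (by positivity)]
            have : ((2 : ℝ) ^ k) ^ (D + 1 : ℝ) = (2 ^ k) ^ D * 2 ^ k := by
              rw [Real.rpow_add (by positivity)]; simp
            rw [this, one_div, inv_pow]
            field_simp
      have e5 := ENNReal.ofReal_le_ofReal e1
      rw [ENNReal.ofReal_mul (by positivity), ENNReal.ofReal_mul (by positivity)] at e5
      convert e5 using 2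
      · rw [← ENNReal.ofReal_natCast]; push_cast; rfl
      · rw [ENNReal.ofReal_pow (by norm_num)]; simp
      · rw [ENNReal.ofReal_pow (by norm_num), one_div, ENNReal.ofReal_inv_of_pos two_pos]; simp
    refine (ENNReal.tsum_le_tsum h3).trans_lt ?_
    rw [ENNReal.tsum_mul_right, ENNReal.tsum_mul_left]
    refine ENNReal.mul_lt_top (ENNReal.mul_lt_top
      (ENNReal.pow_lt_top ENNReal.ofReal_lt_top) hρ) ?_
    rw [ENNReal.tsum_geometric]
    refine ENNReal.mul_lt_top (by simp) ?_
    rw [ENNReal.one_sub_inv_two]; simp)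
  filter_upwards [hV, hI, ae_all_iff.mpr hc] with ω ⟨A, hA0, hA⟩ ⟨B, hB0, hB⟩ hcω
  refine ⟨A + B * (1 - s)⁻¹, ?_, fun i z hz => norm_le_of_dyadic (hcω i) hB0 hs0.le hs1 ?_ ?_ hz⟩
  · have : 0 ≤ 1 - s := by linarith
    positivity
  · intro J hJ
    exact hA (i, fun l => ⟨J l, Nat.lt_succ_of_le (hJ l)⟩)
  · intro k J hJ
    have h3 := hB (i, ⟨k, fun l => ⟨J l, Nat.lt_succ_of_le (hJ l)⟩⟩)
    simp only [norm_mul, Complex.norm_real] at h3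
    rw [Real.norm_of_nonneg (by positivity), inv_mul_le_iff₀ (by positivity)] at h3
    rw [mul_comm B]
    exact h3

/-! ### Weighted bounds for continuous fields on `[0, T] × ℝ^d` -/

/-- The time `T s`, clamped to `[0, T]`. -/
def cubeTime (T : ℝ≥0) (s : ℝ) : Set.Icc (0 : ℝ≥0) T :=
  Set.projIcc 0 T bot_le (T * s.toNNReal)

theorem dist_cubeTime_le (T : ℝ≥0) (s s' : ℝ) :
    dist (cubeTime T s) (cubeTime T s') ≤ T * |s - s'| := by
  have h1 : dist (cubeTime T s) (cubeTime T s') ≤ |(T : ℝ) * max s 0 - T * max s' 0| := by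
    rw [Subtype.dist_eq, NNReal.dist_eq]
    simp only [cubeTime, Set.coe_projIcc, NNReal.coe_max, NNReal.coe_min, NNReal.coe_mul,
      Real.coe_toNNReal', NNReal.coe_zero]
    refine (abs_max_sub_max_le_max _ _ _ _).trans (max_le (by simp) ?_)
    exact (abs_min_sub_min_le_max _ _ _ _).trans (max_le (by simp) le_rfl)
  refine h1.trans ?_
  rw [← mul_sub, abs_mul, abs_of_nonneg T.coe_nonneg]
  exact mul_le_mul_of_nonneg_left (abs_max_sub_max_le_abs _ _ _) T.coe_nonneg

theorem exists_cubeTime_eq (T : ℝ≥0) (t : Set.Icc (0 : ℝ≥0) T) :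
    ∃ s ∈ Set.Icc (0 : ℝ) 1, cubeTime T s = t := by
  have ht := t.2.2
  refine ⟨(t : ℝ≥0) / (T : ℝ), ⟨by positivity, ?_⟩, ?_⟩
  · exact div_le_one_of_le₀ (by exact_mod_cast ht) (by positivity)
  · have : T * ((t : ℝ≥0) / (T : ℝ) : ℝ).toNNReal = t := by
      rw [← NNReal.coe_div, Real.toNNReal_coe]
      -- For T = 0 the quotient t / T is 0 by convention, which is the right value since then t = 0.
      rcases eq_or_ne T 0 with h | h
      · have : (t : ℝ≥0) = 0 := le_antisymm (h ▸ ht) bot_le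
        simp [h, this]
      · field_simp
    rw [cubeTime, this, Set.projIcc_val]

/-- The affine map of the unit cube onto `[-2^R, 2^R]^d`; the coordinate `0` is for the time. -/
def cubeSpace (d R : ℕ) (z : Fin (d + 1) → ℝ) : Eucl d :=
  WithLp.toLp 2 (fun i : Fin d => 2 ^ R * (2 * z i.succ - 1))

theorem norm_le_of_abs_le {d : ℕ} {x : Eucl d} {b : ℝ} (h : ∀ i, |x i| ≤ b) :
    ‖x‖ ^ 2 ≤ d * b ^ 2 := by
  rw [EuclideanSpace.norm_sq_eq]
  calc ∑ i, ‖x i‖ ^ 2 ≤ ∑ _i : Fin d, b ^ 2 := by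
        gcongr with i; exact h i
    _ = d * b ^ 2 := by simp

theorem norm_sq_cubeSpace_le (d R : ℕ) {z : Fin (d + 1) → ℝ} (hz : z ∈ Set.Icc 0 1) :
    1 + ‖cubeSpace d R z‖ ^ 2 ≤ (1 + d) * 4 ^ R := by
  have h : ‖cubeSpace d R z‖ ^ 2 ≤ d * (2 ^ R) ^ 2 := by
    apply norm_le_of_abs_le
    intro i
    simp only [cubeSpace, abs_mul]
    rw [abs_of_nonneg (by positivity : (0 : ℝ) ≤ 2 ^ R)]
    apply mul_le_of_le_one_right (by positivity)
    have h0 := hz.1 i.succ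
    have h1 := hz.2 i.succ
    simp only [Pi.zero_apply, Pi.one_apply] at h0 h1
    rw [abs_le]; constructor <;> linarith
  have h4 : ((2 : ℝ) ^ R) ^ 2 = 4 ^ R := by rw [← pow_mul, mul_comm, pow_mul]; norm_num
  have h1 : (1 : ℝ) ≤ 4 ^ R := one_le_pow₀ (by norm_num)
  rw [h4] at h
  linarith

theorem norm_cubeSpace_sub_le (d R : ℕ) (z z' : Fin (d + 1) → ℝ) :
    ‖cubeSpace d R z - cubeSpace d R z'‖ ≤ 2 * d * 2 ^ R * ‖z - z'‖ := by
  have h : ‖cubeSpace d R z - cubeSpace d R z'‖ ^ 2 ≤ d * (2 * 2 ^ R * ‖z - z'‖) ^ 2 := by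
    apply norm_le_of_abs_le
    intro i
    have h1 : (cubeSpace d R z - cubeSpace d R z') i = 2 * 2 ^ R * (z - z') i.succ := by
      simp only [cubeSpace, PiLp.sub_apply, Pi.sub_apply]; ring
    rw [h1, abs_mul, abs_of_nonneg (by positivity : (0 : ℝ) ≤ 2 * 2 ^ R)]
    gcongr
    exact norm_le_pi_norm (z - z') i.succ
  have hd : (d : ℝ) ≤ d ^ 2 := by exact_mod_cast Nat.le_self_pow two_ne_zero d
  refine le_of_sq_le_sq ?_ (by positivity)
  refine h.trans ?_
  calc (d : ℝ) * (2 * 2 ^ R * ‖z - z'‖) ^ 2 ≤ d ^ 2 * (2 * 2 ^ R * ‖z - z'‖) ^ 2 := by gcongr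
    _ = _ := by ring

theorem continuous_cubeSpace (d R : ℕ) : Continuous (cubeSpace d R) := by
  unfold cubeSpace
  fun_prop

theorem exists_cubeSpace_eq {d : ℕ} (R : ℕ) (x : Eucl d) (hx : ‖x‖ ≤ 2 ^ R) (s : ℝ)
    (hs : s ∈ Set.Icc (0 : ℝ) 1) :
    ∃ z ∈ Set.Icc (0 : Fin (d + 1) → ℝ) 1, z 0 = s ∧ cubeSpace d R z = x := by
  have h2 : (0 : ℝ) < 2 ^ R := by positivity
  have hxi : ∀ i, |x i / 2 ^ R| ≤ 1 := fun i => by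
    rw [abs_div, abs_of_pos h2, div_le_one h2]
    exact (PiLp.norm_apply_le x i).trans hx
  refine ⟨Fin.cons s (fun i => (x i / 2 ^ R + 1) / 2), ⟨fun i => ?_, fun i => ?_⟩, rfl, ?_⟩
  · refine Fin.cases ?_ (fun i => ?_) i
    · exact hs.1
    · have := (abs_le.mp (hxi i)).1
      simp only [Pi.zero_apply, Fin.cons_succ]; linarith
  · refine Fin.cases ?_ (fun i => ?_) i
    · exact hs.2
    · have := (abs_le.mp (hxi i)).2
      simp only [Pi.one_apply, Fin.cons_succ]; linarith
  · ext i
    simp only [cubeSpace, Fin.cons_succ]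
    field_simp
    ring

/-- The least admissible R serves. The upper bound on 2^R is what costs one factor 1 + |x|² when
box-wise estimates are reassembled into a weighted one. -/
theorem exists_two_pow_near (a : ℝ) : ∃ R : ℕ, a ≤ 2 ^ R ∧ (2 : ℝ) ^ R ≤ 2 * (1 + a ^ 2) := by
  have hex : ∃ R : ℕ, a ≤ 2 ^ R := by
    obtain ⟨R, hR⟩ := pow_unbounded_of_one_lt a (one_lt_two (α := ℝ))
    exact ⟨R, hR.le⟩
  classical
  refine ⟨Nat.find hex, Nat.find_spec hex, ?_⟩
  rcases h : Nat.find hex with _ | R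
  · simp; nlinarith [sq_nonneg a]
  · have : ¬ a ≤ 2 ^ R := Nat.find_min hex (by omega)
    rw [pow_succ]
    nlinarith [sq_nonneg (a - 1)]

theorem abs_pow_sub_pow_le_of_le {a b B : ℝ} (N : ℕ) (ha : 0 ≤ a) (hb : 0 ≤ b) (hB : 1 ≤ B)
    (haB : a ≤ B) (hbB : b ≤ B) : |a ^ N - b ^ N| ≤ N * B ^ N * |a - b| := by
  induction N with
  | zero => simp
  | succ N ih =>
    have h1 : a ^ (N + 1) - b ^ (N + 1) = a * (a ^ N - b ^ N) + (a - b) * b ^ N := by ring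
    have hBN : (0 : ℝ) ≤ N * B ^ N * |a - b| := by positivity
    calc |a ^ (N + 1) - b ^ (N + 1)| ≤ a * |a ^ N - b ^ N| + |a - b| * b ^ N := by
          rw [h1]
          refine (abs_add_le _ _).trans_eq ?_
          rw [abs_mul, abs_mul, abs_of_nonneg ha, abs_of_nonneg (pow_nonneg hb N)]
      _ ≤ B * (N * B ^ N * |a - b|) + |a - b| * (B * B ^ N) := by
          gcongr
          calc b ^ N ≤ B ^ N := by gcongr
            _ ≤ B * B ^ N := le_mul_of_one_le_left (by positivity) hB
      _ = _ := by push_cast; ring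

set_option maxHeartbeats 1000000 in
/-- Almost sure uniform bounds, with polynomial weights in space, for a countable family of
continuous fields on `[0, T] × ℝ^d`. -/
theorem ae_exists_weighted_bound {Ω ι : Type*} [MeasurableSpace Ω] [Countable ι]
    {P : Measure Ω} {d : ℕ} {T : ℝ≥0} {X : ι → Set.Icc (0 : ℝ≥0) T → Eucl d → Ω → ℂ}
    (hc : ∀ i, ∀ᵐ ω ∂P, Continuous (fun q : Set.Icc (0 : ℝ≥0) T × Eucl d => X i q.1 q.2 ω))
    {ρ : ι → ℝ} (hρ1 : ∀ i, 1 ≤ ρ i) {Q : ℕ} (hρ : ∑' i, ENNReal.ofReal (ρ i ^ (-(Q : ℝ))) < ⊤)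
    {C κ K : ℝ} (hC : 0 ≤ C) (hκ : 0 < κ) (hK : 0 ≤ K) (N : ℕ)
    (h1 : ∀ i t x, MomentBound P (X i t x)
      (ENNReal.ofReal (C * ρ i ^ (-κ) * ((1 + ‖x‖ ^ 2) ^ N)⁻¹)))
    (h2 : ∀ i t t' x x', MomentBound P (fun ω => X i t x ω - X i t' x' ω)
      (ENNReal.ofReal (C * ρ i ^ K * (dist t t' + ‖x - x'‖)))) :
    ∀ᵐ ω ∂P, ∃ C' : ℝ, 0 ≤ C' ∧ ∀ i t x,
      (1 + ‖x‖ ^ 2) ^ N * ‖X i t x ω‖ ≤ C' * ρ i ^ (-(κ / 2)) * (1 + ‖x‖ ^ 2) := by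
  have hρ0 : ∀ i, 0 < ρ i := fun i => lt_of_lt_of_le one_pos (hρ1 i)
  -- One exponent that serves for both the decay ρ^{-κ/2} in the index and the decay 2^{-R} in the
  -- size of the box.
  set κ' := min (κ / 2) 1 with hκ'
  have hκ'0 : 0 < κ' := lt_min (by positivity) one_pos
  -- ρ^{κ/2} spends half of the decay in the index, 2^{-R} creates decay over the boxes, and the
  -- last factor is the polynomial weight to be gained.
  set w : ι → ℕ → Eucl d → ℝ := fun i R x => ρ i ^ (κ / 2) * (1 / 2) ^ R * (1 + ‖x‖ ^ 2) ^ N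
    with hw
  have hw0 : ∀ i R x, 0 ≤ w i R x := fun i R x => by
    have := Real.rpow_nonneg (hρ0 i).le (κ / 2)
    simp only [hw]; positivity
  -- The weight and its gradient are bounded through (4^R)^{N+1} = (2^R)^{2N+2}; the factor 2^R from
  -- rescaling the box cancels the 2^{-R} in `w`.
  set K' : ℝ := K + κ / 2 + (2 * N + 3 : ℕ) with hK'
  set C₂ : ℝ := C * ((1 + d) ^ (N + 1) * ((1 + N) * (T + 2 * d))) with hC₂
  have hC₂0 : 0 ≤ C₂ := by positivity
  -- Fields are indexed by pairs (i, R) with parameter ρ_i 2^R; passing from Q to Q + 1 makes the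
  -- sum over R converge as well.
  have key := ae_exists_bound_of_fields (P := P) (ι := ι × ℕ) (D := d + 1)
    (X := fun j z ω => (w j.1 j.2 (cubeSpace d j.2 z) : ℂ) *
      X j.1 (cubeTime T (z 0)) (cubeSpace d j.2 z) ω)
    (ρ := fun j => ρ j.1 * 2 ^ j.2) (Q := Q + 1) (C := C + C₂) (κ := κ') (K := K')
    (fun j => by
      filter_upwards [hc j.1] with ω hω
      apply Continuous.continuousOn
      have h3 : Continuous fun z : Fin (d + 1) → ℝ => (cubeTime T (z 0), cubeSpace d j.2 z) :=
        (continuous_projIcc.comp (by fun_prop)).prodMk (continuous_cubeSpace d j.2)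
      refine Continuous.mul ?_ (hω.comp h3)
      have := continuous_cubeSpace d j.2
      simp only [hw]
      fun_prop)
    (fun j => one_le_mul_of_one_le_of_one_le (hρ1 _) (one_le_pow₀ one_le_two))
    (by
      rw [ENNReal.tsum_prod']
      have h3 : ∀ i : ι, ∑' R : ℕ, ENNReal.ofReal ((ρ i * 2 ^ R) ^ (-((Q + 1 : ℕ) : ℝ))) ≤
          ENNReal.ofReal (ρ i ^ (-(Q : ℝ))) * ∑' R : ℕ, (2⁻¹ : ℝ≥0∞) ^ R := fun i => by
        rw [← ENNReal.tsum_mul_left]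
        refine ENNReal.tsum_le_tsum fun R => ?_
        have e1 : (2⁻¹ : ℝ≥0∞) ^ R = ENNReal.ofReal ((2 ^ R)⁻¹) := by
          rw [ENNReal.ofReal_inv_of_pos (by positivity), ENNReal.ofReal_pow two_pos.le]
          simp [ENNReal.inv_pow]
        rw [e1, ← ENNReal.ofReal_mul (Real.rpow_nonneg (hρ0 i).le _)]
        apply ENNReal.ofReal_le_ofReal
        rw [Real.mul_rpow (hρ0 i).le (by positivity)]
        have h2R : (1 : ℝ) ≤ 2 ^ R := one_le_pow₀ one_le_two
        have hr := Real.rpow_nonneg (hρ0 i).le (-(Q : ℝ))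
        apply mul_le_mul _ _ (by positivity) hr
        · apply Real.rpow_le_rpow_of_exponent_le (hρ1 i)
          push_cast; linarith
        · rw [← Real.rpow_neg_one]
          apply Real.rpow_le_rpow_of_exponent_le h2R
          push_cast
          have : (0 : ℝ) ≤ Q := by positivity
          linarith
      refine (ENNReal.tsum_le_tsum h3).trans_lt ?_
      rw [ENNReal.tsum_mul_right, ENNReal.tsum_geometric, ENNReal.one_sub_inv_two]
      exact ENNReal.mul_lt_top hρ (by simp))
    (by positivity) hκ'0 (by positivity)
    (fun j z hz => by
      obtain ⟨i, R⟩ := j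
      refine ((h1 i (cubeTime T (z 0)) (cubeSpace d R z)).const_mul _).mono ?_
      rw [← ofReal_norm, ← ENNReal.ofReal_mul (norm_nonneg _), Complex.norm_real,
        Real.norm_of_nonneg (hw0 _ _ _)]
      apply ENNReal.ofReal_le_ofReal
      have hx : (0 : ℝ) < (1 + ‖cubeSpace d R z‖ ^ 2) ^ N := by positivity
      have e1 : w i R (cubeSpace d R z) * (C * ρ i ^ (-κ) * ((1 + ‖cubeSpace d R z‖ ^ 2) ^ N)⁻¹) =
          C * (ρ i ^ (-(κ / 2)) * (1 / 2) ^ R) := by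
        have : ρ i ^ (-(κ / 2)) = ρ i ^ (κ / 2) * ρ i ^ (-κ) := by
          rw [← Real.rpow_add (hρ0 i)]; congr 1; ring
        rw [this]
        simp only [hw]
        field_simp
      rw [e1, Real.mul_rpow (hρ0 i).le (by positivity)]
      have h2R : (1 : ℝ) ≤ 2 ^ R := one_le_pow₀ one_le_two
      have hr := Real.rpow_nonneg (hρ0 i).le (-κ')
      refine mul_le_mul (by linarith) ?_ (by
        have := Real.rpow_nonneg (hρ0 i).le (-(κ / 2)); positivity) (by positivity)
      apply mul_le_mul _ _ (by positivity) hr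
      · apply Real.rpow_le_rpow_of_exponent_le (hρ1 i)
        linarith [min_le_left (κ / 2) 1]
      · rw [one_div, inv_pow, ← Real.rpow_neg_one]
        apply Real.rpow_le_rpow_of_exponent_le h2R
        linarith [min_le_right (κ / 2) 1])
    (fun j z hz z' hz' => by
      obtain ⟨i, R⟩ := j
      set x := cubeSpace d R z with hx
      set x' := cubeSpace d R z' with hx'
      set t := cubeTime T (z 0)
      set t' := cubeTime T (z' 0)
      set B : ℝ := (1 + d) * 4 ^ R with hB
      have hxB : 1 + ‖x‖ ^ 2 ≤ B := norm_sq_cubeSpace_le d R hz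
      have hxB' : 1 + ‖x'‖ ^ 2 ≤ B := norm_sq_cubeSpace_le d R hz'
      have hB1 : 1 ≤ B := by nlinarith [sq_nonneg ‖x‖]
      have hxx : ‖x - x'‖ ≤ 2 * d * 2 ^ R * ‖z - z'‖ := norm_cubeSpace_sub_le d R z z'
      have htt : dist t t' ≤ T * ‖z - z'‖ :=
        (dist_cubeTime_le _ _ _).trans (by gcongr; exact norm_le_pi_norm (z - z') 0)
      -- Product rule: the increment of the field uses the Lipschitz moment bound, the increment of
      -- the weight the size bound.
      have e : (fun ω => (w i R x : ℂ) * X i t x ω - (w i R x' : ℂ) * X i t' x' ω) = fun ω =>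
          (w i R x : ℂ) * (X i t x ω - X i t' x' ω) +
            ((w i R x - w i R x' : ℝ) : ℂ) * X i t' x' ω := by
        funext ω; push_cast; ring
      show MomentBound P (fun ω => (w i R x : ℂ) * X i t x ω - (w i R x' : ℂ) * X i t' x' ω) _
      rw [e]
      refine (((h2 i t t' x x').const_mul _).add ((h1 i t' x').const_mul _)).mono ?_
      rw [← ofReal_norm, ← ofReal_norm, ← ENNReal.ofReal_mul (norm_nonneg _),
        ← ENNReal.ofReal_mul (norm_nonneg _), Complex.norm_real, Complex.norm_real,
        Real.norm_of_nonneg (hw0 _ _ _)]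
      have hρa := Real.rpow_pos_of_pos (hρ0 i) (κ / 2)
      have hρK := Real.rpow_pos_of_pos (hρ0 i) K
      have hρκ := Real.rpow_pos_of_pos (hρ0 i) (-κ)
      rw [← ENNReal.ofReal_add (mul_nonneg (hw0 _ _ _) (by positivity)) (by positivity)]
      apply ENNReal.ofReal_le_ofReal
      set a := ρ i ^ (κ / 2) * (1 / 2) ^ R with ha
      have ha0 : 0 ≤ a := by positivity
      have hwB : w i R x ≤ a * B ^ (N + 1) := by
        simp only [hw, ← ha]
        calc a * (1 + ‖x‖ ^ 2) ^ N ≤ a * B ^ N := by gcongr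
          _ ≤ a * B ^ (N + 1) := by
            gcongr
            exact Nat.le_succ N
      have hww : ‖w i R x - w i R x'‖ ≤ a * (N * B ^ (N + 1) * ‖x - x'‖) := by
        simp only [hw, ← ha, ← mul_sub]
        rw [norm_mul, Real.norm_of_nonneg ha0]
        gcongr
        refine (abs_pow_sub_pow_le_of_le N (by positivity) (by positivity) hB1 hxB hxB').trans ?_
        have : |1 + ‖x‖ ^ 2 - (1 + ‖x'‖ ^ 2)| ≤ B * ‖x - x'‖ := by
          have h5 : 1 + ‖x‖ ^ 2 - (1 + ‖x'‖ ^ 2) = (‖x‖ + ‖x'‖) * (‖x‖ - ‖x'‖) := by ring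
          rw [h5, abs_mul, abs_of_nonneg (by positivity)]
          gcongr
          · nlinarith [sq_nonneg (‖x‖ - 1), sq_nonneg (‖x'‖ - 1)]
          · exact abs_norm_sub_norm_le x x'
        calc N * B ^ N * |1 + ‖x‖ ^ 2 - (1 + ‖x'‖ ^ 2)| ≤ N * B ^ N * (B * ‖x - x'‖) := by gcongr
          _ = _ := by ring
      have hκ1 : ρ i ^ (-κ) * ((1 + ‖x'‖ ^ 2) ^ N)⁻¹ ≤ ρ i ^ K := by
        calc ρ i ^ (-κ) * ((1 + ‖x'‖ ^ 2) ^ N)⁻¹ ≤ ρ i ^ (-κ) * 1 := by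
              gcongr
              exact inv_le_one_of_one_le₀ (one_le_pow₀ (by nlinarith [sq_nonneg ‖x'‖]))
          _ ≤ ρ i ^ K := by
              rw [mul_one]
              exact Real.rpow_le_rpow_of_exponent_le (hρ1 i) (by linarith)
      have h2R : (1 : ℝ) ≤ 2 ^ R := one_le_pow₀ one_le_two
      have hδ : dist t t' + ‖x - x'‖ ≤ (T + 2 * d) * 2 ^ R * ‖z - z'‖ := by
        have : (T : ℝ) * ‖z - z'‖ ≤ T * 2 ^ R * ‖z - z'‖ := by
          gcongr; exact le_mul_of_one_le_right T.coe_nonneg h2R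
        calc dist t t' + ‖x - x'‖ ≤ T * 2 ^ R * ‖z - z'‖ + 2 * d * 2 ^ R * ‖z - z'‖ := by
              linarith
          _ = _ := by ring
      have hδ' : ‖x - x'‖ ≤ (T + 2 * d) * 2 ^ R * ‖z - z'‖ :=
        le_trans (le_add_of_nonneg_left dist_nonneg) hδ
      calc w i R x * (C * ρ i ^ K * (dist t t' + ‖x - x'‖)) +
            ‖w i R x - w i R x'‖ * (C * ρ i ^ (-κ) * ((1 + ‖x'‖ ^ 2) ^ N)⁻¹)
          ≤ a * B ^ (N + 1) * (C * ρ i ^ K * ((T + 2 * d) * 2 ^ R * ‖z - z'‖)) +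
            a * (N * B ^ (N + 1) * ((T + 2 * d) * 2 ^ R * ‖z - z'‖)) * (C * ρ i ^ K) := by
            rw [mul_assoc C (ρ i ^ (-κ))]
            gcongr
            refine hww.trans ?_
            gcongr
        _ = C₂ * (ρ i ^ K * ρ i ^ (κ / 2) * (4 ^ R) ^ (N + 1)) * ‖z - z'‖ := by
            rw [hC₂, ha, hB, mul_pow, one_div, inv_pow]
            field_simp
        _ ≤ (C + C₂) * (ρ i * 2 ^ R) ^ K' * ‖z - z'‖ := by
            gcongr
            · linarith
            · rw [Real.mul_rpow (hρ0 i).le (by positivity), hK', ← Real.rpow_add (hρ0 i)]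
              refine mul_le_mul ?_ ?_ (by positivity) (Real.rpow_nonneg (hρ0 i).le _)
              · apply Real.rpow_le_rpow_of_exponent_le (hρ1 i)
                have : (0 : ℝ) ≤ (2 * N + 3 : ℕ) := by positivity
                linarith
              · rw [Real.rpow_add (by positivity), Real.rpow_natCast]
                have e1 : (1 : ℝ) ≤ (2 ^ R) ^ (K + κ / 2) :=
                  Real.one_le_rpow h2R (by positivity)
                refine le_trans ?_ (le_mul_of_one_le_left (by positivity) e1)
                rw [show (4 : ℝ) = 2 ^ 2 by norm_num, ← pow_mul, ← pow_mul, ← pow_mul]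
                apply pow_le_pow_right₀ one_le_two
                nlinarith)
  filter_upwards [key] with ω ⟨C', hC'0, hC'⟩
  refine ⟨2 * C', by positivity, fun i t x => ?_⟩
  obtain ⟨R, hR1, hR2⟩ := exists_two_pow_near ‖x‖
  obtain ⟨s, hs, hst⟩ := exists_cubeTime_eq T t
  obtain ⟨z, hz, hz0, hzx⟩ := exists_cubeSpace_eq R x hR1 s hs
  have h3 := hC' (i, R) z hz
  simp only [hz0, hst, hzx, norm_mul, Complex.norm_real] at h3
  rw [Real.norm_of_nonneg (hw0 _ _ _)] at h3
  simp only [hw] at h3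
  have hρa := Real.rpow_pos_of_pos (hρ0 i) (κ / 2)
  rw [Real.rpow_neg (hρ0 i).le]
  have e3 : ((2 : ℝ) ^ R)⁻¹ * 2 ^ R = 1 := inv_mul_cancel₀ (by positivity)
  have h4 : (ρ i ^ (κ / 2)) * ((1 + ‖x‖ ^ 2) ^ N * ‖X i t x ω‖) ≤ C' * 2 ^ R := by
    calc (ρ i ^ (κ / 2)) * ((1 + ‖x‖ ^ 2) ^ N * ‖X i t x ω‖)
        = (ρ i ^ (κ / 2) * (1 / 2) ^ R * (1 + ‖x‖ ^ 2) ^ N * ‖X i t x ω‖) * 2 ^ R := by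
          rw [one_div, inv_pow]
          linear_combination (-(ρ i ^ (κ / 2)) * ((1 + ‖x‖ ^ 2) ^ N * ‖X i t x ω‖)) * e3
      _ ≤ C' * 2 ^ R := by gcongr
  have h5 : (ρ i ^ (κ / 2)) * ((1 + ‖x‖ ^ 2) ^ N * ‖X i t x ω‖) ≤ 2 * C' * (1 + ‖x‖ ^ 2) :=
    h4.trans (by nlinarith)
  calc (1 + ‖x‖ ^ 2) ^ N * ‖X i t x ω‖
      = (ρ i ^ (κ / 2))⁻¹ * ((ρ i ^ (κ / 2)) * ((1 + ‖x‖ ^ 2) ^ N * ‖X i t x ω‖)) := by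
        field_simp
    _ ≤ (ρ i ^ (κ / 2))⁻¹ * (2 * C' * (1 + ‖x‖ ^ 2)) := by gcongr
    _ = _ := by ring

/-! ### The spectral measure -/

theorem integrableOn_abs_rpow {b : ℝ} (hb : -1 < b) :
    IntegrableOn (fun x : ℝ => |x| ^ b) (Set.Icc (-1) 1) := by
  have h1 : IntegrableOn (fun x : ℝ => |x| ^ b) (Set.Ioc 0 1) := by
    have := (intervalIntegral.intervalIntegrable_rpow' hb (a := 0) (b := 1))
    rw [intervalIntegrable_iff_integrableOn_Ioc_of_le zero_le_one] at this
    refine this.congr_fun (fun x hx => ?_) measurableSet_Ioc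
    simp only [abs_of_pos hx.1]
  have h2 : IntegrableOn (fun x : ℝ => |x| ^ b) (Set.Ico (-1) 0) := by
    have h3 := (Measure.measurePreserving_neg (volume : Measure ℝ)).integrableOn_comp_preimage
      (Homeomorph.neg ℝ).measurableEmbedding (f := fun x : ℝ => |x| ^ b) (s := Set.Ioc 0 1)
    have h4 := h3.mpr h1
    simpa [Function.comp_def] using h4
  have h5 : IntegrableOn (fun x : ℝ => |x| ^ b) {0} := by simp
  refine ((h2.union h5).union h1).mono_set ?_
  intro x hx
  rcases lt_trichotomy x 0 with h | h | h
  · exact Or.inl (Or.inl ⟨hx.1, h⟩)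
  · exact Or.inl (Or.inr h)
  · exact Or.inr ⟨h, hx.2⟩

theorem one_add_abs_sq_le (x : ℝ) : (1 + |x|) ^ 2 ≤ 2 * (1 + x ^ 2) := by
  nlinarith [sq_nonneg (|x| - 1), sq_abs x]

/-- Near 0 the condition b > -1 suffices; for |x| ≥ 1 the integrand is comparable to |x|^{b-2β} with
2β - b > 1. -/
theorem integrable_abs_rpow_mul {b β : ℝ} (hb : -1 < b) (hβ : 1 + b < 2 * β) :
    Integrable (fun x : ℝ => |x| ^ b * (1 + x ^ 2) ^ (-β)) := by
  have hβ0 : 0 < β := by linarith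
  have h1 : Integrable (fun x : ℝ => (Set.Icc (-1) 1).indicator (fun x : ℝ => |x| ^ b) x +
      2 ^ |b| * 2 ^ β * (1 + ‖x‖) ^ (-(2 * β - b))) :=
    ((integrable_indicator_iff measurableSet_Icc).mpr (integrableOn_abs_rpow hb)).add
      ((integrable_one_add_norm (by simp; linarith)).const_mul _)
  refine h1.mono' (by fun_prop) (Eventually.of_forall fun x => ?_)
  have hx0 : (0 : ℝ) < 1 + x ^ 2 := by positivity
  rw [Real.norm_of_nonneg (by positivity)]
  by_cases hx : x ∈ Set.Icc (-1 : ℝ) 1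
  · rw [Set.indicator_of_mem hx]
    have h2 : (1 + x ^ 2) ^ (-β) ≤ 1 :=
      Real.rpow_le_one_of_one_le_of_nonpos (by nlinarith [sq_nonneg x]) (by linarith)
    have h3 : (0 : ℝ) ≤ |x| ^ b := by positivity
    have h4 : 0 ≤ 2 ^ |b| * 2 ^ β * (1 + ‖x‖) ^ (-(2 * β - b)) := by positivity
    nlinarith
  · rw [Set.indicator_of_notMem hx, zero_add]
    have hx1 : 1 ≤ |x| := by
      by_contra h
      push Not at h
      exact hx ⟨(abs_le.mp h.le).1, (abs_le.mp h.le).2⟩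
    have hx2 : 0 < 1 + |x| := by positivity
    have h2 : |x| ^ b ≤ 2 ^ |b| * (1 + |x|) ^ b := by
      rcases le_total 0 b with h | h
      · rw [abs_of_nonneg h]
        calc |x| ^ b ≤ (1 + |x|) ^ b := by gcongr; linarith
          _ ≤ _ := le_mul_of_one_le_left (by positivity) (Real.one_le_rpow one_le_two h)
      · rw [abs_of_nonpos h, Real.rpow_neg two_pos.le, ← Real.inv_rpow two_pos.le,
          ← Real.mul_rpow (by positivity) hx2.le]
        exact Real.rpow_le_rpow_of_nonpos (by positivity) (by linarith) h
    have h3 : (1 + x ^ 2) ^ (-β) ≤ 2 ^ β * ((1 + |x|) ^ (-(2 * β))) := by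
      have e : (1 + |x|) ^ (-(2 * β)) = ((1 + |x|) ^ 2) ^ (-β) := by
        rw [← Real.rpow_natCast, ← Real.rpow_mul hx2.le]; congr 1; push_cast; ring
      have e2 : (2 : ℝ) ^ β = (2⁻¹) ^ (-β) := by
        rw [Real.inv_rpow two_pos.le, ← Real.rpow_neg two_pos.le, neg_neg]
      rw [e, e2, ← Real.mul_rpow (by positivity) (by positivity)]
      apply Real.rpow_le_rpow_of_nonpos (by positivity) _ (by linarith)
      linarith [one_add_abs_sq_le x]
    calc |x| ^ b * (1 + x ^ 2) ^ (-β)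
        ≤ (2 ^ |b| * (1 + |x|) ^ b) * (2 ^ β * ((1 + |x|) ^ (-(2 * β)))) := by gcongr
      _ = 2 ^ |b| * 2 ^ β * ((1 + |x|) ^ b * (1 + |x|) ^ (-(2 * β))) := by ring
      _ = 2 ^ |b| * 2 ^ β * (1 + ‖x‖) ^ (-(2 * β - b)) := by
          rw [← Real.rpow_add hx2, Real.norm_eq_abs]; congr 2; ring

/-- Anisotropic power weights are integrable against inhomogeneous powers at infinity. -/
theorem integrable_prod_abs_rpow_mul {d : ℕ} (hd : 1 ≤ d) {b : Fin d → ℝ} (hb : ∀ i, -1 < b i)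
    {β : ℝ} (hβ : ∑ i, (1 + b i) < 2 * β) :
    Integrable (fun η : Eucl d => (∏ i, |η i| ^ b i) * (1 + ‖η‖ ^ 2) ^ (-β)) := by
  -- The surplus of β is shared equally among the coordinates. Each β'_i then exceeds (1 + b_i)/2,
  -- they sum to β, and (1 + |η|²)^{-β} ≤ ∏(1 + η_i²)^{-β'_i} reduces the integral to a product of
  -- one-dimensional ones.
  set δ : ℝ := (2 * β - ∑ i, (1 + b i)) / (2 * d) with hδ
  have hd0 : (0 : ℝ) < d := by exact_mod_cast hd
  have hδ0 : 0 < δ := by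
    apply div_pos <;> linarith
  set β' : Fin d → ℝ := fun i => (1 + b i) / 2 + δ
  have hβ' : ∑ i, β' i = β := by
    simp only [β', Finset.sum_add_distrib, ← Finset.sum_div, Finset.sum_const, Finset.card_univ,
      Fintype.card_fin, nsmul_eq_mul, hδ]
    field_simp
    ring
  have h1 : Integrable (fun x : Fin d → ℝ => ∏ i, (|x i| ^ b i * (1 + x i ^ 2) ^ (-β' i))) :=
    Integrable.fintype_prod (f := fun i (x : ℝ) => |x| ^ b i * (1 + x ^ 2) ^ (-β' i))
      (fun i => integrable_abs_rpow_mul (hb i) (by simp only [β']; linarith))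
  have h2 := ((PiLp.volume_preserving_ofLp (Fin d)).integrable_comp_emb
    (MeasurableEquiv.toLp 2 (Fin d → ℝ)).symm.measurableEmbedding).mpr h1
  refine h2.mono' ?_ (Eventually.of_forall fun η => ?_)
  · refine Measurable.aestronglyMeasurable ?_
    have : ∀ i, Measurable fun η : Eucl d => |η i| ^ b i := fun i => by fun_prop
    fun_prop
  · rw [Real.norm_of_nonneg (by positivity)]
    simp only [Function.comp, Finset.prod_mul_distrib]
    refine mul_le_mul_of_nonneg_left ?_ (by positivity)
    rw [← hβ', ← Finset.sum_neg_distrib, Real.rpow_sum_of_pos (by positivity)]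
    refine Finset.prod_le_prod (fun i _ => by positivity) fun i _ => ?_
    apply Real.rpow_le_rpow_of_nonpos (by positivity) _
      (by simp only [β']; linarith [hb i])
    have := PiLp.norm_apply_le η i
    rw [Real.norm_eq_abs] at this
    have h3 := sq_le_sq' (by linarith [abs_nonneg (η i), norm_nonneg η]) this
    rw [sq_abs] at h3
    linarith

/-- The singularity at `ξ = 0` and the resonance at `ξ = R` of the time frequency weight. -/
theorem exists_lintegral_resonance_le {a κ : ℝ} (hκ : 0 ≤ κ) (haκ : |a| + κ < 1) :
    ∃ C : ℝ≥0∞, C < ⊤ ∧ ∀ R : ℝ, 0 ≤ R →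
      ∫⁻ ξ : ℝ, ENNReal.ofReal (|ξ| ^ a * ((1 + |ξ|) ^ κ / (1 + (ξ - R) ^ 2))) ≤
        C * ENNReal.ofReal ((1 + R) ^ (a + κ)) := by
  -- The decay left at distance |ξ - R| from the resonance once |a| + κ powers are spent on moving
  -- the weights from ξ to R; δ > 1 by hypothesis.
  set δ : ℝ := 2 - |a| - κ with hδ
  have hI1 : Integrable (fun u : ℝ => (1 + ‖u‖) ^ (-δ)) :=
    integrable_one_add_norm (by simp [hδ]; linarith)
  have hI2 : Integrable ((Set.Icc (-1 : ℝ) 1).indicator (fun x : ℝ => |x| ^ (-|a|))) :=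
    (integrable_indicator_iff measurableSet_Icc).mpr (integrableOn_abs_rpow (by linarith))
  have hI1' := hI1.lintegral_lt_top
  have hI2' := hI2.lintegral_lt_top
  refine ⟨4 * ((∫⁻ u : ℝ, ENNReal.ofReal ((1 + ‖u‖) ^ (-δ))) +
    ∫⁻ u : ℝ, ENNReal.ofReal ((Set.Icc (-1 : ℝ) 1).indicator (fun x : ℝ => |x| ^ (-|a|)) u)),
    ENNReal.mul_lt_top (by simp) (ENNReal.add_lt_top.mpr ⟨hI1', hI2'⟩), fun R hR => ?_⟩
  have htr : ∫⁻ ξ : ℝ, ENNReal.ofReal ((1 + ‖ξ - R‖) ^ (-δ)) =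
      ∫⁻ u : ℝ, ENNReal.ofReal ((1 + ‖u‖) ^ (-δ)) :=
    lintegral_sub_right_eq_self (fun u : ℝ => ENNReal.ofReal ((1 + ‖u‖) ^ (-δ))) R
  rw [← htr, ← lintegral_add_left (by fun_prop), mul_assoc, mul_comm _ (ENNReal.ofReal _),
    ← mul_assoc, ← lintegral_const_mul' _ _ (ENNReal.mul_ne_top (by simp) (by simp))]
  refine lintegral_mono fun ξ => ?_
  have h4 : (4 : ℝ≥0∞) = ENNReal.ofReal 4 := by simp
  have hind : 0 ≤ (Set.Icc (-1 : ℝ) 1).indicator (fun x : ℝ => |x| ^ (-|a|)) ξ :=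
    Set.indicator_nonneg (fun x _ => by positivity) _
  rw [h4, ← ENNReal.ofReal_mul (by norm_num), ← ENNReal.ofReal_add (by positivity) hind,
    ← ENNReal.ofReal_mul (by positivity)]
  apply ENNReal.ofReal_le_ofReal
  set u := |ξ - R| with hu
  have hu0 : 0 ≤ u := abs_nonneg _
  have hξ0 : 0 ≤ |ξ| := abs_nonneg _
  -- At ξ = 0 the convention 0^0 = 1 makes a = 0 a genuine case; for a ≠ 0 the left side vanishes.
  rcases eq_or_ne ξ 0 with h0 | h0
  · rcases eq_or_ne a 0 with ha | ha
    · subst h0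
      subst ha
      simp only [abs_zero, Real.rpow_zero, add_zero, Real.one_rpow, zero_sub, zero_add, one_mul,
        neg_zero, even_two, Even.neg_pow]
      have hR' : ‖-R‖ = R := by rw [norm_neg, Real.norm_of_nonneg hR]
      rw [Set.indicator_of_mem (by simp), hR', hδ]
      have e1 : 1 / (1 + R ^ 2) ≤ 1 := by
        rw [div_le_one (by positivity)]; nlinarith
      have e2 : 1 ≤ (1 + R) ^ κ := Real.one_le_rpow (by linarith) hκ
      rw [mul_assoc]
      calc _ ≤ (4 : ℝ) * (1 * (0 + 1)) := by linarith
        _ ≤ _ := by gcongr; positivity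
    · rw [h0, abs_zero, Real.zero_rpow ha, zero_mul]
      rw [h0] at hind
      positivity
  have hξ : 0 < |ξ| := abs_pos.mpr h0
  have hineq : 1 + R ≤ (1 + |ξ|) * (1 + u) := by
    have : R ≤ |ξ| + u := by
      have := abs_sub_abs_le_abs_sub R ξ
      rw [abs_of_nonneg hR, abs_sub_comm] at this
      linarith
    nlinarith
  have hineq' : 1 + |ξ| ≤ (1 + R) * (1 + u) := by
    have : |ξ| ≤ R + u := by
      have := abs_sub_abs_le_abs_sub ξ R
      rw [abs_of_nonneg hR] at this
      linarith
    nlinarith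
  have h1R : 0 < 1 + R := by linarith
  -- The weight is moved from ξ to R at the price of |a| powers of 1 + u; for negative a the
  -- singularity at ξ = 0 stays in the last factor.
  have b1 : |ξ| ^ a ≤ (1 + R) ^ a * (1 + u) ^ |a| * (1 + |ξ| ^ (-|a|)) := by
    rcases le_total 0 a with h | h
    · rw [abs_of_nonneg h]
      calc |ξ| ^ a ≤ ((1 + R) * (1 + u)) ^ a := by gcongr; linarith
        _ = (1 + R) ^ a * (1 + u) ^ a := Real.mul_rpow h1R.le (by positivity)
        _ ≤ _ := le_mul_of_one_le_right (by positivity) (by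
          have : 0 ≤ |ξ| ^ (-a) := by positivity
          linarith)
    · rw [abs_of_nonpos h, neg_neg]
      have e1 : (1 + R) ^ (-a) ≤ (1 + |ξ|) ^ (-a) * (1 + u) ^ (-a) := by
        rw [← Real.mul_rpow (by positivity) (by positivity)]
        exact Real.rpow_le_rpow h1R.le hineq (by linarith)
      have e2 : (1 + |ξ|) ^ (-a) * |ξ| ^ a ≤ 1 + |ξ| ^ a := by
        have e3 : (1 + |ξ|) ^ (-a) ≤ 1 + |ξ| ^ (-a) := by
          have : -a ≤ 1 := by
            have := neg_le_abs a; linarith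
          simpa using Real.rpow_add_le_add_rpow zero_le_one hξ.le (by linarith : 0 ≤ -a) this
        have e4 : |ξ| ^ (-a) * |ξ| ^ a = 1 := by rw [← Real.rpow_add hξ]; simp
        have e5 : 0 ≤ |ξ| ^ a := by positivity
        nlinarith
      have e6 : (1 + R) ^ a * (1 + R) ^ (-a) = 1 := by rw [← Real.rpow_add h1R]; simp
      have e7 : 0 ≤ (1 + R) ^ a := by positivity
      calc |ξ| ^ a = (1 + R) ^ a * (1 + R) ^ (-a) * |ξ| ^ a := by rw [e6, one_mul]
        _ ≤ (1 + R) ^ a * ((1 + |ξ|) ^ (-a) * (1 + u) ^ (-a)) * |ξ| ^ a := by gcongr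
        _ = (1 + R) ^ a * (1 + u) ^ (-a) * ((1 + |ξ|) ^ (-a) * |ξ| ^ a) := by ring
        _ ≤ _ := by gcongr
  have b2 : (1 + |ξ|) ^ κ ≤ (1 + R) ^ κ * (1 + u) ^ κ := by
    rw [← Real.mul_rpow h1R.le (by positivity)]
    gcongr
  have b3 : (1 + (ξ - R) ^ 2)⁻¹ ≤ 2 * (1 + u) ^ (-2 : ℝ) := by
    have := one_add_abs_sq_le (ξ - R)
    rw [Real.rpow_neg (by positivity), ← div_eq_mul_inv, inv_le_comm₀ (by positivity)
      (by positivity), inv_div, div_le_iff₀ two_pos]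
    norm_num
    linarith
  have b4 : (1 + u) ^ (-δ) * (1 + |ξ| ^ (-|a|)) ≤
      2 * ((1 + u) ^ (-δ) + (Set.Icc (-1 : ℝ) 1).indicator (fun x : ℝ => |x| ^ (-|a|)) ξ) := by
    have e1 : (1 + u) ^ (-δ) ≤ 1 :=
      Real.rpow_le_one_of_one_le_of_nonpos (by linarith) (by simp [hδ]; linarith)
    have e2 : 0 ≤ (1 + u) ^ (-δ) := by positivity
    have e3 : 0 ≤ |ξ| ^ (-|a|) := by positivity
    by_cases hm : ξ ∈ Set.Icc (-1 : ℝ) 1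
    · rw [Set.indicator_of_mem hm]
      nlinarith
    · have : 1 ≤ |ξ| := by
        by_contra h
        push Not at h
        exact hm ⟨(abs_le.mp h.le).1, (abs_le.mp h.le).2⟩
      have e4 : |ξ| ^ (-|a|) ≤ 1 :=
        Real.rpow_le_one_of_one_le_of_nonpos this (by linarith [abs_nonneg a])
      rw [Set.indicator_of_notMem hm]
      nlinarith
  have e : (1 + u) ^ |a| * (1 + u) ^ κ * (1 + u) ^ (-2 : ℝ) = (1 + u) ^ (-δ) := by
    rw [← Real.rpow_add (by positivity), ← Real.rpow_add (by positivity)]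
    congr 1; rw [hδ]; ring
  calc |ξ| ^ a * ((1 + |ξ|) ^ κ / (1 + (ξ - R) ^ 2))
      = |ξ| ^ a * (1 + |ξ|) ^ κ * (1 + (ξ - R) ^ 2)⁻¹ := by ring
    _ ≤ ((1 + R) ^ a * (1 + u) ^ |a| * (1 + |ξ| ^ (-|a|))) * ((1 + R) ^ κ * (1 + u) ^ κ) *
        (2 * (1 + u) ^ (-2 : ℝ)) := by gcongr
    _ = 2 * ((1 + R) ^ a * (1 + R) ^ κ) *
        (((1 + u) ^ |a| * (1 + u) ^ κ * (1 + u) ^ (-2 : ℝ)) * (1 + |ξ| ^ (-|a|))) := by ring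
    _ = 2 * (1 + R) ^ (a + κ) * ((1 + u) ^ (-δ) * (1 + |ξ| ^ (-|a|))) := by
        rw [e, Real.rpow_add h1R]
    _ ≤ 2 * (1 + R) ^ (a + κ) * (2 * ((1 + u) ^ (-δ) +
        (Set.Icc (-1 : ℝ) 1).indicator (fun x : ℝ => |x| ^ (-|a|)) ξ)) := by gcongr
    _ = _ := by simp only [Real.norm_eq_abs, ← hu]; ring

theorem spectralWeight_eq {d : ℕ} (H : Fin (d + 1) → ℝ) (q : ℝ × Eucl d) :
    spectralWeight H q = |q.1| ^ (1 - 2 * H 0) * ∏ i : Fin d, |q.2 i| ^ (1 - 2 * H i.succ) := by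
  have h : ∀ a b : ℝ, 1 / |a| ^ (2 * b - 1) = |a| ^ (1 - 2 * b) := fun a b => by
    rw [one_div, ← Real.rpow_neg (abs_nonneg a)]; congr 1; ring
  simp only [spectralWeight, h]

theorem spectralWeight_nonneg {d : ℕ} (H : Fin (d + 1) → ℝ) (q : ℝ × Eucl d) :
    0 ≤ spectralWeight H q := by
  rw [spectralWeight_eq]; positivity

theorem measurable_spectralWeight {d : ℕ} (H : Fin (d + 1) → ℝ) :
    Measurable (spectralWeight H) := by
  have : spectralWeight H = fun q : ℝ × Eucl d =>
      |q.1| ^ (1 - 2 * H 0) * ∏ i : Fin d, |q.2 i| ^ (1 - 2 * H i.succ) :=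
    funext (spectralWeight_eq H)
  rw [this]
  have : ∀ i : Fin d, Measurable fun q : ℝ × Eucl d => |q.2 i| ^ (1 - 2 * H i.succ) := fun i => by
    fun_prop
  fun_prop

/-- The density of the spectral measure. -/
def spectralDensity {d : ℕ} (H : Fin (d + 1) → ℝ) (q : ℝ × Eucl d) : ℝ≥0 :=
  (harmonizableConst H ^ 2 * spectralWeight H q).toNNReal

theorem coe_spectralDensity {d : ℕ} (H : Fin (d + 1) → ℝ) (q : ℝ × Eucl d) :
    (spectralDensity H q : ℝ) = harmonizableConst H ^ 2 * spectralWeight H q :=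
  Real.coe_toNNReal _ (mul_nonneg (sq_nonneg _) (spectralWeight_nonneg H q))

theorem measurable_spectralDensity {d : ℕ} (H : Fin (d + 1) → ℝ) :
    Measurable (spectralDensity H) :=
  ((measurable_spectralWeight H).const_mul _).real_toNNReal

/-- The spectral measure of the noise. -/
def spectralMeasure {d : ℕ} (H : Fin (d + 1) → ℝ) : Measure (ℝ × Eucl d) :=
  volume.withDensity fun q => (spectralDensity H q : ℝ≥0∞)

theorem lintegral_spectralMeasure {d : ℕ} (H : Fin (d + 1) → ℝ) {f : ℝ × Eucl d → ℝ≥0∞}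
    (hf : Measurable f) :
    ∫⁻ q, f q ∂spectralMeasure H = ∫⁻ q, ENNReal.ofReal (harmonizableConst H ^ 2) *
      (ENNReal.ofReal (spectralWeight H q) * f q) := by
  rw [spectralMeasure, lintegral_withDensity_eq_lintegral_mul _
    (measurable_spectralDensity H).coe_nnreal_ennreal hf]
  refine lintegral_congr fun q => ?_
  rw [← mul_assoc, ← ENNReal.ofReal_mul (sq_nonneg _), ← coe_spectralDensity,
    ENNReal.ofReal_coe_nnreal]
  rfl

/-- The weight that dominates the linear solution, with a gain `κ` of integrability. -/
def resonanceWeight {d : ℕ} (κ β : ℝ) (q : ℝ × Eucl d) : ℝ :=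
  (1 + |q.1|) ^ κ / (1 + (q.1 - ‖q.2‖ ^ 2) ^ 2) * (1 + ‖q.2‖ ^ 2) ^ (-β)

theorem measurable_resonanceWeight {d : ℕ} (κ β : ℝ) :
    Measurable (resonanceWeight (d := d) κ β) := by
  unfold resonanceWeight; fun_prop

/-- Integrating in ξ first replaces |ξ|^{1-2H_0} (1 + |ξ|)^κ by its size (1 + |η|²)^{1-2H_0+κ} at
the resonance ξ = |η|². The condition on β is integrability at infinity of what is left in η. -/
theorem lintegral_resonanceWeight_lt_top {d : ℕ} (hd : 1 ≤ d) {H : Fin (d + 1) → ℝ}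
    (hH : ∀ i, H i ∈ Set.Ioo (0 : ℝ) 1) {κ β : ℝ} (hκ : 0 ≤ κ) (hκ' : |1 - 2 * H 0| + κ < 1)
    (hβ : ∑ i : Fin d, (1 + (1 - 2 * H i.succ)) < 2 * (β - (1 - 2 * H 0 + κ))) :
    ∫⁻ q, ENNReal.ofReal (resonanceWeight κ β q) ∂spectralMeasure H < ⊤ := by
  have hm := measurable_resonanceWeight (d := d) κ β
  have hw := measurable_spectralWeight H
  rw [lintegral_spectralMeasure H hm.ennreal_ofReal,
    lintegral_const_mul' _ _ ENNReal.ofReal_ne_top]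
  refine ENNReal.mul_lt_top ENNReal.ofReal_lt_top ?_
  obtain ⟨C, hC, hCR⟩ := exists_lintegral_resonance_le hκ hκ'
  have hint := (integrable_prod_abs_rpow_mul hd (b := fun i => 1 - 2 * H i.succ)
    (fun i => by linarith [(hH i.succ).2]) hβ).lintegral_lt_top
  have hv : (volume : Measure (ℝ × Eucl d)) = volume.prod volume := rfl
  rw [hv, lintegral_prod_symm' _ (by fun_prop)]
  have hb : ∀ η : Eucl d, ∫⁻ ξ : ℝ, ENNReal.ofReal (spectralWeight H (ξ, η)) *
      ENNReal.ofReal (resonanceWeight κ β (ξ, η)) ≤ C * ENNReal.ofReal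
        ((∏ i, |η i| ^ (1 - 2 * H i.succ)) *
          (1 + ‖η‖ ^ 2) ^ (-(β - (1 - 2 * H 0 + κ)))) := fun η => by
    set A : ℝ := (∏ i, |η i| ^ (1 - 2 * H i.succ)) * (1 + ‖η‖ ^ 2) ^ (-β) with hA
    have hA0 : 0 ≤ A := by positivity
    have e1 : ∀ ξ : ℝ, ENNReal.ofReal (spectralWeight H (ξ, η)) *
        ENNReal.ofReal (resonanceWeight κ β (ξ, η)) = ENNReal.ofReal A *
          ENNReal.ofReal (|ξ| ^ (1 - 2 * H 0) *
            ((1 + |ξ|) ^ κ / (1 + (ξ - ‖η‖ ^ 2) ^ 2))) := fun ξ => by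
      rw [← ENNReal.ofReal_mul (spectralWeight_nonneg _ _), ← ENNReal.ofReal_mul hA0]
      congr 1
      rw [spectralWeight_eq, resonanceWeight, hA]
      ring
    simp only [e1]
    rw [lintegral_const_mul' _ _ ENNReal.ofReal_ne_top]
    calc ENNReal.ofReal A * _ ≤ ENNReal.ofReal A *
          (C * ENNReal.ofReal ((1 + ‖η‖ ^ 2) ^ (1 - 2 * H 0 + κ))) := by
          gcongr; exact hCR (‖η‖ ^ 2) (by positivity)
      _ = C * (ENNReal.ofReal A * ENNReal.ofReal ((1 + ‖η‖ ^ 2) ^ (1 - 2 * H 0 + κ))) := by ring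
      _ = _ := by
        rw [← ENNReal.ofReal_mul hA0]
        congr 2
        rw [hA, mul_assoc, ← Real.rpow_add (by positivity)]
        congr 2; ring
  refine (lintegral_mono hb).trans_lt ?_
  rw [lintegral_const_mul' _ _ hC.ne]
  exact ENNReal.mul_lt_top hC hint

/-! ### Estimates for `γ` -/

theorem continuous_gammaKernel : Continuous fun q : ℝ × ℝ × ℝ => gammaKernel q.1 q.2.1 q.2.2 := by
  unfold gammaKernel
  refine Continuous.mul (by fun_prop) ?_
  have h : Continuous (Function.uncurry fun (q : ℝ × ℝ × ℝ) (s : ℝ) =>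
      Complex.exp (Complex.I * s * ((q.2.2 : ℂ) ^ 2 - q.2.1))) := by
    unfold Function.uncurry
    fun_prop
  exact intervalIntegral.continuous_parametric_intervalIntegral_of_continuous h continuous_fst

theorem norm_exp_I_mul (a : ℝ) : ‖Complex.exp (Complex.I * a)‖ = 1 := by
  rw [mul_comm]; exact Complex.norm_exp_ofReal_mul_I a

theorem norm_exp_I_mul_sub_le (a b : ℝ) :
    ‖Complex.exp (Complex.I * a) - Complex.exp (Complex.I * b)‖ ≤ |a - b| := by
  have h : Complex.exp (Complex.I * a) - Complex.exp (Complex.I * b) =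
      Complex.exp (Complex.I * b) * (Complex.exp (Complex.I * (a - b : ℝ)) - 1) := by
    rw [mul_sub, ← Complex.exp_add]
    push_cast
    ring_nf
  rw [h, norm_mul, norm_exp_I_mul, one_mul]
  simpa using Real.norm_exp_I_mul_ofReal_sub_one_le (x := a - b)

theorem norm_gammaKernel_le {t : ℝ} (ht : 0 ≤ t) (ξ r : ℝ) : ‖gammaKernel t ξ r‖ ≤ t := by
  have h1 : Complex.I * ξ * t = Complex.I * (ξ * t : ℝ) := by push_cast; ring
  rw [gammaKernel, norm_mul, h1, norm_exp_I_mul, one_mul]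
  have := intervalIntegral.norm_integral_le_of_norm_le_const (a := 0) (b := t) (C := 1)
    (f := fun s : ℝ => Complex.exp (Complex.I * s * ((r : ℂ) ^ 2 - ξ))) (fun s _ => by
      have h2 : Complex.I * s * ((r : ℂ) ^ 2 - ξ) = Complex.I * (s * (r ^ 2 - ξ) : ℝ) := by
        push_cast; ring
      rw [h2, norm_exp_I_mul])
  simpa [abs_of_nonneg ht] using this

/-- Away from resonance the oscillatory integral is explicit, and its primitive has the denominator
|r² - ξ|. -/
theorem abs_mul_norm_gammaKernel_le (t ξ r : ℝ) : |ξ - r ^ 2| * ‖gammaKernel t ξ r‖ ≤ 2 := by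
  rcases eq_or_ne (ξ - r ^ 2) 0 with h0 | h0
  · rw [h0]; simp
  have h1 : Complex.I * ξ * t = Complex.I * (ξ * t : ℝ) := by push_cast; ring
  have hc : Complex.I * ((r : ℂ) ^ 2 - ξ) ≠ 0 := by
    refine mul_ne_zero Complex.I_ne_zero ?_
    intro h
    apply h0
    have : ((ξ - r ^ 2 : ℝ) : ℂ) = 0 := by push_cast; linear_combination -h
    exact_mod_cast this
  have h2 : ∫ s in (0 : ℝ)..t, Complex.exp (Complex.I * s * ((r : ℂ) ^ 2 - ξ)) =
      (Complex.exp (Complex.I * (t * (r ^ 2 - ξ) : ℝ)) - 1) / (Complex.I * ((r : ℂ) ^ 2 - ξ)) := by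
    have := integral_exp_mul_complex (a := 0) (b := t) hc
    simp only [Complex.ofReal_zero, mul_zero, Complex.exp_zero] at this
    rw [← show Complex.I * ((r : ℂ) ^ 2 - ξ) * t = Complex.I * (t * (r ^ 2 - ξ) : ℝ) by
      push_cast; ring, ← this]
    congr 1; ext s; congr 1; ring
  have h3 : ‖Complex.I * ((r : ℂ) ^ 2 - ξ)‖ = |ξ - r ^ 2| := by
    rw [norm_mul, Complex.norm_I, one_mul, ← abs_neg, ← Real.norm_eq_abs, ← Complex.norm_real]
    congr 1; push_cast; ring
  rw [gammaKernel, norm_mul, h1, norm_exp_I_mul, one_mul, h2, norm_div, h3,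
    mul_div_cancel₀ _ (abs_ne_zero.mpr h0)]
  refine (norm_sub_le _ _).trans ?_
  rw [norm_exp_I_mul]; norm_num

theorem norm_gammaKernel_sq_le {t T : ℝ} (ht : 0 ≤ t) (htT : t ≤ T) (ξ r : ℝ) :
    ‖gammaKernel t ξ r‖ ^ 2 ≤ (T ^ 2 + 4) / (1 + (ξ - r ^ 2) ^ 2) := by
  rw [le_div_iff₀ (by positivity), mul_add, mul_one]
  have h1 := (norm_gammaKernel_le ht ξ r).trans htT
  have h2 := abs_mul_norm_gammaKernel_le t ξ r
  have h3 : ‖gammaKernel t ξ r‖ ^ 2 ≤ T ^ 2 := by gcongr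
  have h4 : (|ξ - r ^ 2| * ‖gammaKernel t ξ r‖) ^ 2 ≤ 2 ^ 2 := by gcongr
  rw [mul_pow, sq_abs] at h4
  linarith

/-- The prefactor e^{iξt} contributes T|ξ| and the moving endpoint of the integral contributes 1.
Growth in ξ is harmless, as it is only polynomial on the truncated domains. -/
theorem norm_gammaKernel_sub_le {s t T : ℝ} (ht : 0 ≤ t) (htT : t ≤ T) (ξ r : ℝ) :
    ‖gammaKernel t ξ r - gammaKernel s ξ r‖ ≤ (1 + T * |ξ|) * |t - s| := by
  set f : ℝ → ℂ := fun u => Complex.exp (Complex.I * u * ((r : ℂ) ^ 2 - ξ)) with hf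
  have hf1 : ∀ u, ‖f u‖ = 1 := fun u => by
    have h2 : Complex.I * u * ((r : ℂ) ^ 2 - ξ) = Complex.I * (u * (r ^ 2 - ξ) : ℝ) := by
      push_cast; ring
    rw [hf]
    simp only [h2, norm_exp_I_mul]
  have hfi : ∀ a b : ℝ, IntervalIntegrable f volume a b := fun a b =>
    (by fun_prop : Continuous f).intervalIntegrable a b
  have hI : ‖∫ u in (0 : ℝ)..t, f u‖ ≤ t := by
    simpa [abs_of_nonneg ht] using intervalIntegral.norm_integral_le_of_norm_le_const
      (a := 0) (b := t) (C := 1) (f := f) (fun u _ => (hf1 u).le)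
  have hD : ‖∫ u in s..t, f u‖ ≤ |t - s| := by
    simpa using intervalIntegral.norm_integral_le_of_norm_le_const
      (a := s) (b := t) (C := 1) (f := f) (fun u _ => (hf1 u).le)
  have e : gammaKernel t ξ r - gammaKernel s ξ r =
      (Complex.exp (Complex.I * (ξ * t : ℝ)) - Complex.exp (Complex.I * (ξ * s : ℝ))) *
        (∫ u in (0 : ℝ)..t, f u) + Complex.exp (Complex.I * (ξ * s : ℝ)) * ∫ u in s..t, f u := by
    have h1 : ∀ t : ℝ, Complex.I * ξ * t = Complex.I * (ξ * t : ℝ) := fun t => by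
      push_cast; ring
    have h3 : ∫ u in s..t, f u = (∫ u in (0 : ℝ)..t, f u) - ∫ u in (0 : ℝ)..s, f u :=
      (intervalIntegral.integral_interval_sub_left (hfi _ _) (hfi _ _)).symm
    rw [gammaKernel, gammaKernel, h3, h1, h1]
    ring
  rw [e]
  calc _ ≤ ‖Complex.exp (Complex.I * (ξ * t : ℝ)) - Complex.exp (Complex.I * (ξ * s : ℝ))‖ *
        ‖∫ u in (0 : ℝ)..t, f u‖ + 1 * ‖∫ u in s..t, f u‖ := by
        refine (norm_add_le _ _).trans ?_
        rw [norm_mul, norm_mul, norm_exp_I_mul]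
    _ ≤ |ξ * t - ξ * s| * T + 1 * |t - s| := by
        gcongr
        · exact norm_exp_I_mul_sub_le _ _
        · exact hI.trans htT
    _ = _ := by rw [← mul_sub, abs_mul]; ring

/-! ### Frequency shells -/

theorem measurableSet_freqDomain (d n : ℕ) : MeasurableSet (freqDomain d n) := by
  have h1 : MeasurableSet {q : ℝ × Eucl d | |q.1| ≤ 2 ^ (2 * n)} :=
    measurableSet_le (by fun_prop) measurable_const
  have h2 : MeasurableSet {q : ℝ × Eucl d | ‖q.2‖ ≤ 2 ^ n} :=
    measurableSet_le (by fun_prop) measurable_const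
  exact (MeasurableSet.const (1 ≤ n)).inter (h1.inter h2)

theorem freqDomain_zero (d : ℕ) : freqDomain d 0 = ∅ := by
  ext q; simp [freqDomain]

theorem freqDomain_mono (d : ℕ) {m n : ℕ} (h : m ≤ n) : freqDomain d m ⊆ freqDomain d n := by
  rintro q ⟨h1, h2, h3⟩
  refine ⟨h1.trans h, h2.trans ?_, h3.trans ?_⟩
  · exact pow_le_pow_right₀ one_le_two (by omega)
  · exact pow_le_pow_right₀ one_le_two h

/-- The frequencies that are added in the `n`-th approximation. -/
def freqShell (d n : ℕ) : Set (ℝ × Eucl d) := freqDomain d n \ freqDomain d (n - 1)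

theorem measurableSet_freqShell (d n : ℕ) : MeasurableSet (freqShell d n) :=
  (measurableSet_freqDomain d n).diff (measurableSet_freqDomain d _)

/-- Because of the parabolic scaling both cut-offs of D_{n-1} read 4^{n-1}, in |ξ| and in |η|²
respectively, and outside D_{n-1} at least one of them is exceeded. -/
theorem rpow_le_of_mem_freqShell {d n : ℕ} {κ : ℝ} (hκ : 0 ≤ κ) {q : ℝ × Eucl d}
    (hq : q ∈ freqShell d n) :
    (2 : ℝ) ^ (2 * κ * (n - 1)) ≤ (1 + |q.1|) ^ κ * (1 + ‖q.2‖ ^ 2) ^ κ := by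
  obtain ⟨⟨h1, h2, h3⟩, h4⟩ := hq
  have e : (2 : ℝ) ^ (2 * κ * (n - 1)) = (4 ^ (n - 1)) ^ κ := by
    rw [show (4 : ℝ) = 2 ^ (2 : ℝ) by norm_num, ← Real.rpow_natCast, ← Real.rpow_mul (by norm_num),
      ← Real.rpow_mul (by norm_num)]
    congr 1
    rw [Nat.cast_sub h1]; push_cast; ring
  rw [e, ← Real.mul_rpow (by positivity) (by positivity)]
  apply Real.rpow_le_rpow (by positivity) _ hκ
  have hq1 : 0 ≤ |q.1| := abs_nonneg _
  have hq2 : 0 ≤ ‖q.2‖ ^ 2 := by positivity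
  -- For n = 1 the removed domain D_0 is empty and gives no lower bound on the frequency, but then
  -- the claim only asks for 1.
  rcases Nat.lt_or_ge (n - 1) 1 with h | h
  · have : n - 1 = 0 := by omega
    rw [this]; simp; nlinarith
  · simp only [freqDomain, Set.mem_ofPred_eq, not_and_or, not_le] at h4
    rcases h4 with h4 | h4 | h4
    · omega
    · rw [pow_mul] at h4
      norm_num at h4
      nlinarith
    · have : (4 : ℝ) ^ (n - 1) ≤ ‖q.2‖ ^ 2 := by
        rw [show (4 : ℝ) = 2 ^ 2 by norm_num, ← pow_mul, mul_comm, pow_mul]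
        gcongr
      nlinarith

theorem one_add_norm_sq_le_of_mem_freqDomain {d n : ℕ} {q : ℝ × Eucl d} (hq : q ∈ freqDomain d n) :
    1 + ‖q.2‖ ^ 2 ≤ 2 * 4 ^ n := by
  obtain ⟨_, _, h3⟩ := hq
  have : ‖q.2‖ ^ 2 ≤ 4 ^ n := by
    rw [show (4 : ℝ) = 2 ^ 2 by norm_num, ← pow_mul, mul_comm, pow_mul]
    gcongr
  have : (1 : ℝ) ≤ 4 ^ n := one_le_pow₀ (by norm_num)
  linarith

theorem abs_fst_le_of_mem_freqDomain {d n : ℕ} {q : ℝ × Eucl d} (hq : q ∈ freqDomain d n) :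
    |q.1| ≤ 4 ^ n := by
  obtain ⟨_, h, _⟩ := hq
  rw [pow_mul] at h
  norm_num at h
  exact h

/-- The mass of the truncated spectral measures grows at most polynomially. -/
theorem exists_spectralMeasure_freqDomain_le {d : ℕ} (hd : 1 ≤ d) {H : Fin (d + 1) → ℝ}
    (hH : ∀ i, H i ∈ Set.Ioo (0 : ℝ) 1) :
    ∃ (C : ℝ≥0∞) (K : ℕ), C < ⊤ ∧ ∀ n, spectralMeasure H (freqDomain d n) ≤ C * (2 ^ K) ^ n := by
  -- Any large enough β would do; an integer keeps the powers polynomial.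
  obtain ⟨β, hβ⟩ := exists_nat_gt (∑ i : Fin d, (1 + (1 - 2 * H i.succ)) +
    2 * |1 - 2 * H 0|)
  have hI := lintegral_resonanceWeight_lt_top hd hH (κ := 0) (β := β) le_rfl (by
    rw [add_zero, abs_lt]; constructor <;> linarith [(hH 0).1, (hH 0).2]) (by
    have h0 := le_abs_self (1 - 2 * H 0)
    have h1 : 0 ≤ ∑ i : Fin d, (1 + (1 - 2 * H i.succ)) :=
      Finset.sum_nonneg fun i _ => by linarith [(hH i.succ).2]
    have h2 := abs_nonneg (1 - 2 * H 0)
    linarith)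
  set I := ∫⁻ q, ENNReal.ofReal (resonanceWeight 0 (β : ℝ) q) ∂spectralMeasure H with hIdef
  refine ⟨I * ENNReal.ofReal (10 * 2 ^ β), 4 + 2 * β,
    ENNReal.mul_lt_top hI ENNReal.ofReal_lt_top, fun n => ?_⟩
  -- On D_n the integrable weight is bounded below by a negative power of 2^n, so Chebyshev's
  -- inequality bounds the mass. The 10 comes from |ξ - |η|²| ≤ 3 · 4^n.
  have key : ∀ q ∈ freqDomain d n, 1 ≤
      10 * 2 ^ β * (2 ^ (4 + 2 * β)) ^ n * resonanceWeight 0 (β : ℝ) q := fun q hq => by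
    have h1 := one_add_norm_sq_le_of_mem_freqDomain hq
    have h2 := abs_le.mp (abs_fst_le_of_mem_freqDomain hq)
    have h0 : 0 ≤ ‖q.2‖ ^ 2 := by positivity
    have h4 : (1 : ℝ) ≤ 4 ^ n := one_le_pow₀ (by norm_num)
    have h5 : 1 + (q.1 - ‖q.2‖ ^ 2) ^ 2 ≤ 10 * (4 ^ n) ^ 2 := by nlinarith
    have h6 : (1 + ‖q.2‖ ^ 2) ^ β ≤ (2 * 4 ^ n) ^ β := by gcongr
    rw [resonanceWeight, Real.rpow_zero, Real.rpow_neg (by positivity), Real.rpow_natCast, one_div,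
      ← mul_inv, ← div_eq_mul_inv, one_le_div (by positivity)]
    calc (1 + (q.1 - ‖q.2‖ ^ 2) ^ 2) * (1 + ‖q.2‖ ^ 2) ^ β
        ≤ (10 * (4 ^ n) ^ 2) * (2 * 4 ^ n) ^ β := by gcongr
      _ = _ := by
        have e : (4 : ℝ) ^ n = (2 ^ n) ^ 2 := by
          rw [← pow_mul, mul_comm, pow_mul]; norm_num
        have e' : ((2 : ℝ) ^ (4 + 2 * β)) ^ n = ((2 ^ n) ^ 2) ^ 2 * ((2 ^ n) ^ 2) ^ β := by
          simp only [← pow_mul, ← pow_add]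
          congr 1; ring
        rw [e, e', mul_pow]
        ring
  calc spectralMeasure H (freqDomain d n)
      = ∫⁻ q in freqDomain d n, 1 ∂spectralMeasure H := by simp
    _ ≤ ∫⁻ q in freqDomain d n, ENNReal.ofReal (10 * 2 ^ β * (2 ^ (4 + 2 * β)) ^ n) *
        ENNReal.ofReal (resonanceWeight 0 (β : ℝ) q) ∂spectralMeasure H := by
        refine setLIntegral_mono' (measurableSet_freqDomain d n) fun q hq => ?_
        rw [← ENNReal.ofReal_mul (by positivity), ← ENNReal.ofReal_one]
        exact ENNReal.ofReal_le_ofReal (key q hq)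
    _ ≤ ∫⁻ q, ENNReal.ofReal (10 * 2 ^ β * (2 ^ (4 + 2 * β)) ^ n) *
        ENNReal.ofReal (resonanceWeight 0 (β : ℝ) q) ∂spectralMeasure H :=
        setLIntegral_le_lintegral _ _
    _ = I * ENNReal.ofReal (10 * 2 ^ β) * (2 ^ (4 + 2 * β)) ^ n := by
        rw [lintegral_const_mul' _ _ ENNReal.ofReal_ne_top, ENNReal.ofReal_mul (by positivity),
          ENNReal.ofReal_pow (by positivity), ENNReal.ofReal_pow (by positivity)]
        simp only [ENNReal.ofReal_ofNat]
        ring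

theorem spectralMeasure_freqDomain_lt_top {d : ℕ} (hd : 1 ≤ d) {H : Fin (d + 1) → ℝ}
    (hH : ∀ i, H i ∈ Set.Ioo (0 : ℝ) 1) (n : ℕ) : spectralMeasure H (freqDomain d n) < ⊤ := by
  obtain ⟨C, K, hC, h⟩ := exists_spectralMeasure_freqDomain_le hd hH
  exact (h n).trans_lt (ENNReal.mul_lt_top hC (by simp))

/-- The shells contribute geometrically small amounts to the linear solution in negative Sobolev
spaces. -/
theorem exists_setLIntegral_freqShell_le {d : ℕ} (hd : 1 ≤ d) {H : Fin (d + 1) → ℝ}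
    (hH : ∀ i, H i ∈ Set.Ioo (0 : ℝ) 1) {α : ℝ}
    (hα : α > d + 1 - (2 * H 0 + ∑ i : Fin d, H i.succ)) :
    ∃ (C κ : ℝ), 0 ≤ C ∧ 0 < κ ∧ ∀ n : ℕ,
      ∫⁻ q in freqShell d n, ENNReal.ofReal (resonanceWeight 0 α q) ∂spectralMeasure H ≤
        ENNReal.ofReal (C * 2 ^ (-(2 * κ * n))) := by
  set ε := α - (d + 1 - (2 * H 0 + ∑ i : Fin d, H i.succ)) with hε
  have hε0 : 0 < ε := by linarith
  have ha : |1 - 2 * H 0| < 1 := by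
    rw [abs_lt]; constructor <;> linarith [(hH 0).1, (hH 0).2]
  -- The gain costs κ twice, in lowering the exponent to α - κ and through (1 + |ξ|)^κ at the
  -- resonance, so 2κ < ε is needed. The second bound keeps |1 - 2H_0| + κ < 1.
  set κ := min (ε / 4) ((1 - |1 - 2 * H 0|) / 2) with hκ
  have hκ0 : 0 < κ := lt_min (by positivity) (by linarith)
  have hκ1 : κ ≤ ε / 4 := min_le_left _ _
  have hκ2 : κ ≤ (1 - |1 - 2 * H 0|) / 2 := min_le_right _ _
  have hI := lintegral_resonanceWeight_lt_top hd hH (κ := κ) (β := α - κ) hκ0.le (by linarith) (by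
    simp only [Finset.sum_add_distrib, Finset.sum_sub_distrib, ← Finset.mul_sum, Finset.sum_const,
      Finset.card_univ, Fintype.card_fin, nsmul_eq_mul]
    linarith)
  set I := ∫⁻ q, ENNReal.ofReal (resonanceWeight κ (α - κ) q) ∂spectralMeasure H with hIdef
  refine ⟨I.toReal * 2 ^ (2 * κ), κ, by positivity, hκ0, fun n => ?_⟩
  have e1 : I.toReal * 2 ^ (2 * κ) * 2 ^ (-(2 * κ * n)) =
      2 ^ (-(2 * κ * (n - 1))) * I.toReal := by
    rw [mul_assoc, ← Real.rpow_add two_pos, mul_comm]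
    congr 2; ring
  rw [e1, ENNReal.ofReal_mul (by positivity), ENNReal.ofReal_toReal hI.ne, hIdef,
    ← lintegral_const_mul' _ _ ENNReal.ofReal_ne_top]
  refine le_trans ?_ (setLIntegral_le_lintegral (freqShell d n) _)
  refine setLIntegral_mono' (measurableSet_freqShell d n) fun q hq => ?_
  rw [← ENNReal.ofReal_mul (by positivity)]
  apply ENNReal.ofReal_le_ofReal
  have h1 := rpow_le_of_mem_freqShell hκ0.le hq
  have e2 : (1 + ‖q.2‖ ^ 2) ^ (-(α - κ)) = (1 + ‖q.2‖ ^ 2) ^ κ * (1 + ‖q.2‖ ^ 2) ^ (-α) := by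
    rw [← Real.rpow_add (by positivity)]; congr 1; ring
  rw [resonanceWeight, resonanceWeight, Real.rpow_zero, e2, Real.rpow_neg two_pos.le,
    le_inv_mul_iff₀ (by positivity)]
  have h3 : (0 : ℝ) ≤ 1 / (1 + (q.1 - ‖q.2‖ ^ 2) ^ 2) * (1 + ‖q.2‖ ^ 2) ^ (-α) := by positivity
  calc _ ≤ ((1 + |q.1|) ^ κ * (1 + ‖q.2‖ ^ 2) ^ κ) *
        (1 / (1 + (q.1 - ‖q.2‖ ^ 2) ^ 2) * (1 + ‖q.2‖ ^ 2) ^ (-α)) := by gcongr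
    _ = _ := by ring

/-! ### Gaussian moment bounds -/

theorem integral_norm_sq_eq {α : Type*} [MeasurableSpace α] {μ : Measure α} (f : α → ℂ) :
    ((∫ a, ‖f a‖ ^ 2 ∂μ : ℝ) : ℂ) = ∫ a, f a * conj (f a) ∂μ := by
  rw [← integral_complex_ofReal]
  refine integral_congr_ae (Eventually.of_forall fun a => ?_)
  simp only
  rw [Complex.mul_conj, Complex.normSq_eq_norm_sq]

theorem eLpNorm_two_eq {α E : Type*} [MeasurableSpace α] [NormedAddCommGroup E] {μ : Measure α}
    {f : α → E} (hf : MemLp f 2 μ) :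
    eLpNorm f 2 μ = ENNReal.ofReal (Real.sqrt (∫ a, ‖f a‖ ^ 2 ∂μ)) := by
  rw [hf.eLpNorm_eq_integral_rpow_norm two_ne_zero ENNReal.ofNat_ne_top, Real.sqrt_eq_rpow]
  simp

theorem gaussNorm_two : eLpNorm (id : ℝ → ℝ) 2 (gaussianReal 0 1) = 1 := by
  have h := memLp_id_gaussianReal' (μ := 0) (v := 1) 2 (by simp)
  rw [eLpNorm_two_eq h]
  have h1 := variance_id_gaussianReal (μ := 0) (v := 1)
  rw [variance_eq_sub h] at h1
  have h2 : ∫ a, ‖id a‖ ^ 2 ∂gaussianReal 0 1 = 1 := by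
    simpa using h1
  rw [h2]; simp

theorem eLpNorm_gaussianReal (v : ℝ≥0) (p : ℝ≥0∞) :
    eLpNorm (id : ℝ → ℝ) p (gaussianReal 0 v) =
      ‖Real.sqrt v‖ₑ * eLpNorm (id : ℝ → ℝ) p (gaussianReal 0 1) := by
  have h := gaussianReal_map_const_mul (μ := 0) (v := 1) (Real.sqrt v)
  have e : (⟨Real.sqrt v ^ 2, sq_nonneg _⟩ : ℝ≥0) * 1 = v := by
    rw [mul_one]; exact NNReal.eq (Real.sq_sqrt v.coe_nonneg)
  rw [mul_zero] at h
  have h' : (gaussianReal 0 1).map (fun x => Real.sqrt v * x) = gaussianReal 0 v := by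
    rw [h]; exact congrArg _ e
  rw [← h', eLpNorm_map_measure aestronglyMeasurable_id (by fun_prop), ← eLpNorm_const_smul]
  rfl

theorem eLpNorm_le_of_hasGaussianLaw {Ω : Type*} [MeasurableSpace Ω] {P : Measure Ω} {X : Ω → ℝ}
    (h : HasGaussianLaw X P) (h0 : ∫ ω, X ω ∂P = 0) (p : ℕ) :
    eLpNorm X p P = gaussNorm p * eLpNorm X 2 P := by
  have hm := h.aemeasurable
  have hmap := h.map_eq_gaussianReal
  rw [h0] at hmap
  have key : ∀ p : ℝ≥0∞, eLpNorm X p P = ‖Real.sqrt (Var[X; P].toNNReal)‖ₑ *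
      eLpNorm (id : ℝ → ℝ) p (gaussianReal 0 1) := fun p => by
    rw [← eLpNorm_gaussianReal, ← hmap, eLpNorm_map_measure aestronglyMeasurable_id hm]
    rfl
  rw [key p, key 2, gaussNorm_two, gaussNorm]
  ring

/-- Real and imaginary parts are centered real Gaussians, whose L^p norms are `gaussNorm p` times
their L² norms. The triangle inequality gives the factor 2, without any information on the
correlation of the two parts. -/
theorem momentBound_of_hasGaussianLaw {Ω : Type*} [MeasurableSpace Ω] {P : Measure Ω} {V : Ω → ℂ}
    (h : HasGaussianLaw V P) (h0 : ∫ ω, V ω ∂P = 0) : MomentBound P V (eLpNorm V 2 P) := by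
  have hi : Integrable V P := h.integrable
  have hV : AEStronglyMeasurable V P := hi.1
  refine ⟨hV, fun p hp => ?_⟩
  have hre : HasGaussianLaw (fun ω => (V ω).re) P := h.map_fun Complex.reCLM
  have him : HasGaussianLaw (fun ω => (V ω).im) P := h.map_fun Complex.imCLM
  have hre0 : ∫ ω, (V ω).re ∂P = 0 := by
    have := Complex.reCLM.integral_comp_comm hi
    rw [h0] at this
    simpa using this
  have him0 : ∫ ω, (V ω).im ∂P = 0 := by
    have := Complex.imCLM.integral_comp_comm hi
    rw [h0] at this
    simpa using this
  have m1 : AEStronglyMeasurable (fun ω => ((V ω).re : ℂ)) P :=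
    Complex.continuous_ofReal.comp_aestronglyMeasurable
      (Complex.continuous_re.comp_aestronglyMeasurable hV)
  have m2 : AEStronglyMeasurable (fun ω => ((V ω).im : ℂ) * Complex.I) P :=
    (Complex.continuous_ofReal.comp_aestronglyMeasurable
      (Complex.continuous_im.comp_aestronglyMeasurable hV)).mul_const _
  have e : V = (fun ω => ((V ω).re : ℂ)) + fun ω => ((V ω).im : ℂ) * Complex.I := by
    funext ω; simp [Complex.re_add_im]
  have n1 : eLpNorm (fun ω => ((V ω).re : ℂ)) p P = eLpNorm (fun ω => (V ω).re) p P :=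
    eLpNorm_congr_norm_ae (Eventually.of_forall fun ω => by simp)
  have n2 : eLpNorm (fun ω => ((V ω).im : ℂ) * Complex.I) p P = eLpNorm (fun ω => (V ω).im) p P :=
    eLpNorm_congr_norm_ae (Eventually.of_forall fun ω => by simp)
  have l1 : eLpNorm (fun ω => (V ω).re) 2 P ≤ eLpNorm V 2 P :=
    eLpNorm_mono fun ω => by simpa using Complex.abs_re_le_norm (V ω)
  have l2 : eLpNorm (fun ω => (V ω).im) 2 P ≤ eLpNorm V 2 P :=
    eLpNorm_mono fun ω => by simpa using Complex.abs_im_le_norm (V ω)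
  calc eLpNorm V p P ≤ eLpNorm (fun ω => (V ω).re) p P + eLpNorm (fun ω => (V ω).im) p P := by
        conv_lhs => rw [e]
        rw [← n1, ← n2]
        exact eLpNorm_add_le m1 m2 (by exact_mod_cast hp)
    _ = gaussNorm p * eLpNorm (fun ω => (V ω).re) 2 P +
        gaussNorm p * eLpNorm (fun ω => (V ω).im) 2 P := by
        rw [eLpNorm_le_of_hasGaussianLaw hre hre0, eLpNorm_le_of_hasGaussianLaw him him0]
    _ ≤ gaussNorm p * eLpNorm V 2 P + gaussNorm p * eLpNorm V 2 P := by gcongr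
    _ = _ := by ring

/-! ### Spectral representation of the linear solution -/

/-- The spectral representative of `Ψ_n(t, x)`. -/
def solKernel {d : ℕ} (k : ℕ × ℝ≥0 × Eucl d) : ℝ × Eucl d → ℂ :=
  (freqDomain d k.1).indicator fun q =>
    gammaKernel k.2.1 q.1 ‖q.2‖ * Complex.exp (Complex.I * (inner ℝ q.2 k.2.2 : ℝ))

theorem measurable_gammaKernel {d : ℕ} (t : ℝ) :
    Measurable fun q : ℝ × Eucl d => gammaKernel t q.1 ‖q.2‖ :=
  (continuous_gammaKernel.comp (by fun_prop : Continuous fun q : ℝ × Eucl d =>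
    (t, q.1, ‖q.2‖))).measurable

theorem measurable_solKernel {d : ℕ} (k : ℕ × ℝ≥0 × Eucl d) : Measurable (solKernel k) := by
  refine Measurable.indicator ?_ (measurableSet_freqDomain d _)
  refine (measurable_gammaKernel _).mul ?_
  have : Continuous fun q : ℝ × Eucl d => Complex.exp (Complex.I * (inner ℝ q.2 k.2.2 : ℝ)) := by
    fun_prop
  exact this.measurable

theorem memLp_of_bounded_of_support {α : Type*} [MeasurableSpace α] {μ : Measure α} {A : Set α}
    (hA : MeasurableSet A) (hμA : μ A < ⊤) {f : α → ℂ} (hf : AEStronglyMeasurable f μ) {C : ℝ}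
    (hC : ∀ a ∈ A, ‖f a‖ ≤ C) (h0 : ∀ a ∉ A, f a = 0) (p : ℝ≥0∞) : MemLp f p μ := by
  have h : MemLp (A.indicator fun _ => C) p μ :=
    memLp_indicator_const p hA C (Or.inr hμA.ne)
  refine h.mono' hf (Eventually.of_forall fun a => ?_)
  by_cases ha : a ∈ A
  · simpa [ha] using hC a ha
  · simp [ha, h0 a ha]

theorem memLp_solKernel {d : ℕ} (hd : 1 ≤ d) {H : Fin (d + 1) → ℝ}
    (hH : ∀ i, H i ∈ Set.Ioo (0 : ℝ) 1) (k : ℕ × ℝ≥0 × Eucl d) :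
    MemLp (solKernel k) 2 (spectralMeasure H) := by
  refine memLp_of_bounded_of_support (measurableSet_freqDomain d k.1)
    (spectralMeasure_freqDomain_lt_top hd hH k.1) (measurable_solKernel k).aestronglyMeasurable
    (C := k.2.1) (fun q hq => ?_) (fun q hq => Set.indicator_of_notMem hq _) 2
  rw [solKernel, Set.indicator_of_mem hq, norm_mul, norm_exp_I_mul, mul_one]
  exact norm_gammaKernel_le k.2.1.coe_nonneg _ _

section Span

variable {d : ℕ} {Ω : Type*} {Ψ : ℕ → ℝ≥0 → Eucl d → Ω → ℂ}

/-- The random variable `Ψ_n(t, x)`, with a single index. -/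
def solValue (Ψ : ℕ → ℝ≥0 → Eucl d → Ω → ℂ) (k : ℕ × ℝ≥0 × Eucl d) : Ω → ℂ := Ψ k.1 k.2.1 k.2.2

/-- Finite linear combinations of the `Ψ_n(t, x)`, with their spectral representatives. -/
def solSpan (Ψ : ℕ → ℝ≥0 → Eucl d → Ω → ℂ) : Submodule ℂ ((Ω → ℂ) × (ℝ × Eucl d → ℂ)) :=
  Submodule.span ℂ (Set.range fun k => (solValue Ψ k, solKernel k))

theorem exists_finset_of_mem_solSpan {p : (Ω → ℂ) × (ℝ × Eucl d → ℂ)} (hp : p ∈ solSpan Ψ) :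
    ∃ (s : Finset (ℕ × ℝ≥0 × Eucl d)) (c : ℕ × ℝ≥0 × Eucl d → ℂ),
      (p.1 = fun ω => ∑ k ∈ s, c k * solValue Ψ k ω) ∧
      (p.2 = fun q => ∑ k ∈ s, c k * solKernel k q) := by
  obtain ⟨c, hc⟩ := Finsupp.mem_span_range_iff_exists_finsupp.mp hp
  refine ⟨c.support, c, ?_, ?_⟩
  · funext ω
    rw [← hc, Finsupp.sum, Prod.fst_sum, Finset.sum_apply]
    simp
  · funext q
    rw [← hc, Finsupp.sum, Prod.snd_sum, Finset.sum_apply]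
    simp

end Span

section Solution

variable {d : ℕ} {H : Fin (d + 1) → ℝ} {Ω : Type*} [MeasurableSpace Ω] {P : Measure Ω}
  {Ψ : ℕ → ℝ≥0 → Eucl d → Ω → ℂ}

/-- The integral over D_n ∩ D_m is the product of two indicators and e^{i⟨η, x - y⟩} factorises, so
the covariance is an inner product of kernels: this is the isometry behind all the estimates. -/
theorem IsLinearSolution.integral_mul_conj (hΨ : IsLinearSolution H P Ψ)
    (k l : ℕ × ℝ≥0 × Eucl d) :
    ∫ ω, solValue Ψ k ω * conj (solValue Ψ l ω) ∂P =
      ∫ q, solKernel k q * conj (solKernel l q) ∂spectralMeasure H := by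
  obtain ⟨n, s, x⟩ := k
  obtain ⟨m, t, y⟩ := l
  have h := hΨ.covariance n m s t x y
  simp only [solValue]
  rw [h, spectralMeasure, integral_withDensity_eq_integral_smul (measurable_spectralDensity H),
    ← integral_indicator ((measurableSet_freqDomain d n).inter (measurableSet_freqDomain d m)),
    ← integral_const_mul]
  refine integral_congr_ae (Eventually.of_forall fun q => ?_)
  simp only [NNReal.smul_def, coe_spectralDensity, Complex.real_smul]
  by_cases hn : q ∈ freqDomain d n
  · by_cases hm : q ∈ freqDomain d m
    · rw [Set.indicator_of_mem (Set.mem_inter hn hm), solKernel, solKernel, Set.indicator_of_mem hn,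
        Set.indicator_of_mem hm]
      have e : Complex.exp (Complex.I * (inner ℝ q.2 (x - y) : ℝ)) =
          Complex.exp (Complex.I * (inner ℝ q.2 x : ℝ)) *
            conj (Complex.exp (Complex.I * (inner ℝ q.2 y : ℝ))) := by
        rw [← Complex.exp_conj, ← Complex.exp_add, inner_sub_right]
        congr 1
        simp
        ring
      rw [e]
      push_cast
      rw [map_mul]
      ring
    · rw [Set.indicator_of_notMem (fun h => hm (Set.mem_of_mem_inter_right h)), solKernel, solKernel,
        Set.indicator_of_notMem hm]
      simp
  · rw [Set.indicator_of_notMem (fun h => hn (Set.mem_of_mem_inter_left h)), solKernel, Set.indicator_of_notMem hn]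
    simp

theorem IsLinearSolution.memLp (hΨ : IsLinearSolution H P Ψ) (k : ℕ × ℝ≥0 × Eucl d) :
    MemLp (solValue Ψ k) 2 P := by
  have h := hΨ.gaussian.hasGaussianLaw {k}
  exact (h.eval ⟨k, by simp⟩).memLp_two

theorem integral_sum_mul_conj_sum {α : Type*} [MeasurableSpace α] {μ : Measure α} {ι : Type*}
    (s : Finset ι) (c : ι → ℂ) {f : ι → α → ℂ} (hf : ∀ i, MemLp (f i) 2 μ) :
    ∫ a, (∑ i ∈ s, c i * f i a) * conj (∑ j ∈ s, c j * f j a) ∂μ =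
      ∑ i ∈ s, ∑ j ∈ s, c i * conj (c j) * ∫ a, f i a * conj (f j a) ∂μ := by
  have hint : ∀ i j, Integrable (fun a => c i * conj (c j) * (f i a * conj (f j a))) μ :=
    fun i j => ((hf i).integrable_mul (hf j).star).const_mul _
  have e : (fun a => (∑ i ∈ s, c i * f i a) * conj (∑ j ∈ s, c j * f j a)) =
      fun a => ∑ i ∈ s, ∑ j ∈ s, c i * conj (c j) * (f i a * conj (f j a)) := by
    funext a
    rw [map_sum, Finset.sum_mul_sum]
    refine Finset.sum_congr rfl fun i _ => Finset.sum_congr rfl fun j _ => ?_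
    rw [map_mul]; ring
  rw [e, integral_finsetSum _ fun i _ => integrable_finsetSum _ fun j _ => hint i j]
  refine Finset.sum_congr rfl fun i _ => ?_
  rw [integral_finsetSum _ fun j _ => hint i j]
  exact Finset.sum_congr rfl fun j _ => integral_const_mul _ _

/-- Expanding the square carries the covariance isometry to linear combinations, and joint
Gaussianity makes the combination itself Gaussian. -/
theorem momentBound_of_mem_solSpan (hd : 1 ≤ d) (hH : ∀ i, H i ∈ Set.Ioo (0 : ℝ) 1)
    (hΨ : IsLinearSolution H P Ψ) {p : (Ω → ℂ) × (ℝ × Eucl d → ℂ)} (hp : p ∈ solSpan Ψ) :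
    MomentBound P p.1 (eLpNorm p.2 2 (spectralMeasure H)) := by
  obtain ⟨s, c, h1, h2⟩ := exists_finset_of_mem_solSpan hp
  have hm1 : MemLp p.1 2 P := by
    rw [h1]; exact memLp_finsetSum _ fun k _ => (hΨ.memLp k).const_mul (c k)
  have hm2 : MemLp p.2 2 (spectralMeasure H) := by
    rw [h2]; exact memLp_finsetSum _ fun k _ => (memLp_solKernel hd hH k).const_mul (c k)
  have hnorm : eLpNorm p.1 2 P = eLpNorm p.2 2 (spectralMeasure H) := by
    rw [eLpNorm_two_eq hm1, eLpNorm_two_eq hm2]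
    congr 2
    have : ((∫ a, ‖p.1 a‖ ^ 2 ∂P : ℝ) : ℂ) = ((∫ q, ‖p.2 q‖ ^ 2 ∂spectralMeasure H : ℝ) : ℂ) := by
      rw [integral_norm_sq_eq, integral_norm_sq_eq, h1, h2,
        integral_sum_mul_conj_sum s c hΨ.memLp, integral_sum_mul_conj_sum s c
        (memLp_solKernel hd hH)]
      simp only [hΨ.integral_mul_conj]
    exact_mod_cast this
  have hg : HasGaussianLaw p.1 P := by
    have h := hΨ.gaussian.hasGaussianLaw s
    have h3 := h.map_fun (∑ k : s, (ContinuousLinearMap.mul ℝ ℂ (c k)).comp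
      (ContinuousLinearMap.proj (R := ℝ) (φ := fun _ : s => ℂ) k))
    have e : p.1 = fun ω => (∑ k : s, (ContinuousLinearMap.mul ℝ ℂ (c k)).comp
      (ContinuousLinearMap.proj (R := ℝ) (φ := fun _ : s => ℂ) k))
        (s.restrict fun k : ℕ × ℝ≥0 × Eucl d => Ψ k.1 k.2.1 k.2.2 ω) := by
      rw [h1]
      funext ω
      rw [← Finset.sum_coe_sort]
      simp [solValue]
    rw [e]
    exact h3
  rw [← hnorm]
  have := hg.isProbabilityMeasure
  refine momentBound_of_hasGaussianLaw hg ?_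
  rw [h1, integral_finsetSum _ fun k _ => (((hΨ.memLp k).integrable one_le_two).const_mul (c k))]
  refine Finset.sum_eq_zero fun k _ => ?_
  rw [integral_const_mul]
  have := hΨ.centered k.1 k.2.1 k.2.2
  simp only [solValue]
  rw [this, mul_zero]

end Solution

/-! ### Sequential closure -/

section LimClosure

variable {Ω β : Type*} [MeasurableSpace Ω] [MeasurableSpace β]

/-- The pairs `(V, v)` that are limits of pairs in `S`, almost surely in the first and in `L²` in
the second component. -/
def limClosure (P : Measure Ω) (ν : Measure β) (S : Submodule ℂ ((Ω → ℂ) × (β → ℂ))) :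
    Submodule ℂ ((Ω → ℂ) × (β → ℂ)) where
  carrier := {p | AEStronglyMeasurable p.2 ν ∧ ∃ s : ℕ → (Ω → ℂ) × (β → ℂ), (∀ N, s N ∈ S) ∧
    (∀ N, AEStronglyMeasurable (s N).2 ν) ∧
    (∀ᵐ ω ∂P, Tendsto (fun N => (s N).1 ω) atTop (𝓝 (p.1 ω))) ∧
    Tendsto (fun N => eLpNorm ((s N).2 - p.2) 2 ν) atTop (𝓝 0)}
  add_mem' := by
    rintro p q ⟨hp, s, hs, hsm, hs1, hs2⟩ ⟨hq, t, ht, htm, ht1, ht2⟩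
    refine ⟨hp.add hq, fun N => s N + t N, fun N => S.add_mem (hs N) (ht N),
      fun N => (hsm N).add (htm N), ?_, ?_⟩
    · filter_upwards [hs1, ht1] with ω h1 h2 using h1.add h2
    · refine tendsto_of_tendsto_of_tendsto_of_le_of_le tendsto_const_nhds
        (by simpa using hs2.add ht2) (fun _ => bot_le) fun N => ?_
      have e : (s N + t N).2 - (p + q).2 = ((s N).2 - p.2) + ((t N).2 - q.2) := by
        simp only [Prod.snd_add]; ring
      simp only [e]
      exact eLpNorm_add_le ((hsm N).sub hp) ((htm N).sub hq) one_le_two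
  zero_mem' := ⟨aestronglyMeasurable_const, fun _ => 0, fun _ => S.zero_mem,
    fun _ => aestronglyMeasurable_const, by simp, by simp⟩
  smul_mem' := by
    rintro c p ⟨hp, s, hs, hsm, hs1, hs2⟩
    refine ⟨hp.const_smul c, fun N => c • s N, fun N => S.smul_mem c (hs N),
      fun N => (hsm N).const_smul c, ?_, ?_⟩
    · filter_upwards [hs1] with ω h1 using h1.const_smul c
    · have e : ∀ N, (c • s N).2 - (c • p).2 = c • ((s N).2 - p.2) := fun N => by
        simp only [Prod.smul_snd, smul_sub]
      simp only [e, eLpNorm_const_smul]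
      simpa using ENNReal.Tendsto.const_mul hs2 (Or.inr (enorm_ne_top (x := c)))

/-- Fatou's lemma for L^p norms. Working with moment bounds instead of Gaussian laws spares a proof
that limits are again Gaussian. -/
theorem momentBound_of_mem_limClosure {P : Measure Ω} {ν : Measure β}
    {S : Submodule ℂ ((Ω → ℂ) × (β → ℂ))} (hS : ∀ p ∈ S, MomentBound P p.1 (eLpNorm p.2 2 ν))
    {p : (Ω → ℂ) × (β → ℂ)} (hp : p ∈ limClosure P ν S) :
    MomentBound P p.1 (eLpNorm p.2 2 ν) := by
  obtain ⟨hpm, s, hs, hsm, hs1, hs2⟩ := hp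
  have hm : ∀ N, AEStronglyMeasurable (s N).1 P := fun N => (hS _ (hs N)).1
  refine ⟨aestronglyMeasurable_of_tendsto_ae atTop hm hs1, fun m h1m => ?_⟩
  refine (Lp.eLpNorm_lim_le_liminf_eLpNorm hm _ hs1).trans ?_
  have hle : ∀ N, eLpNorm (s N).1 m P ≤
      2 * gaussNorm m * (eLpNorm p.2 2 ν + eLpNorm ((s N).2 - p.2) 2 ν) := fun N => by
    refine ((hS _ (hs N)).2 m h1m).trans ?_
    gcongr
    have e : (s N).2 = p.2 + ((s N).2 - p.2) := by ring
    conv_lhs => rw [e]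
    exact eLpNorm_add_le hpm ((hsm N).sub hpm) one_le_two
  have hlim : Tendsto (fun N => 2 * gaussNorm m * (eLpNorm p.2 2 ν + eLpNorm ((s N).2 - p.2) 2 ν))
      atTop (𝓝 (2 * gaussNorm m * eLpNorm p.2 2 ν)) := by
    refine ENNReal.Tendsto.const_mul ?_ (Or.inr (ENNReal.mul_ne_top (by simp)
      (gaussNorm_lt_top m).ne))
    simpa using tendsto_const_nhds.add hs2
  exact (liminf_le_liminf (Eventually.of_forall hle)).trans hlim.liminf_eq.le

theorem tendsto_eLpNorm_two_of_bounded {ν : Measure β} {A : Set β} (hA : MeasurableSet A)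
    (hνA : ν A < ⊤) {s : ℕ → β → ℂ} {v : β → ℂ} (hs : ∀ N, AEStronglyMeasurable (s N) ν)
    (hv : AEStronglyMeasurable v ν) {C : ℝ} (hC : ∀ N, ∀ a ∈ A, ‖s N a‖ ≤ C)
    (h0 : ∀ N, ∀ a ∉ A, s N a = 0) (hlim : ∀ a, Tendsto (fun N => s N a) atTop (𝓝 (v a))) :
    Tendsto (fun N => eLpNorm (s N - v) 2 ν) atTop (𝓝 0) := by
  have hvC : ∀ a ∈ A, ‖v a‖ ≤ C := fun a ha =>
    le_of_tendsto (hlim a).norm (Eventually.of_forall fun N => hC N a ha)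
  have hv0 : ∀ a ∉ A, v a = 0 := fun a ha =>
    tendsto_nhds_unique (hlim a) (by simp [h0 _ a ha])
  have key : Tendsto (fun N => ∫⁻ a, ‖(s N - v) a‖ₑ ^ 2 ∂ν) atTop (𝓝 (∫⁻ _, 0 ∂ν)) := by
    refine tendsto_lintegral_of_dominated_convergence'
      (A.indicator fun _ => ENNReal.ofReal (C + C) ^ 2)
      (fun N => ((hs N).sub hv).enorm.pow_const 2)
      (fun N => Eventually.of_forall fun a => ?_) ?_ (Eventually.of_forall fun a => ?_)
    · by_cases ha : a ∈ A
      · simp only [Set.indicator_of_mem ha, ← ofReal_norm]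
        gcongr
        exact (norm_sub_le _ _).trans (add_le_add (hC N a ha) (hvC a ha))
      · simp [h0 N a ha, hv0 a ha, ha]
    · rw [lintegral_indicator hA, setLIntegral_const]
      exact ENNReal.mul_ne_top (ENNReal.pow_ne_top ENNReal.ofReal_ne_top) hνA.ne
    · have h1 : Tendsto (fun N => (s N - v) a) atTop (𝓝 0) := by
        simpa using (hlim a).sub_const (v a)
      have h2 := (continuous_enorm.tendsto (0 : ℂ)).comp h1
      have h3 := ((ENNReal.continuous_pow 2).tendsto _).comp h2
      simpa [Function.comp_def] using h3
  have e : ∀ N, eLpNorm (s N - v) 2 ν = (∫⁻ a, ‖(s N - v) a‖ₑ ^ 2 ∂ν) ^ (1 / 2 : ℝ) := fun N => by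
    rw [eLpNorm_eq_lintegral_rpow_enorm_toReal two_ne_zero ENNReal.ofNat_ne_top]
    simp
  simp only [e]
  have h4 := ((ENNReal.continuous_rpow_const (y := 1 / 2)).tendsto _).comp key
  simpa [Function.comp_def] using h4

end LimClosure

/-! ### Integrals of continuous functions as limits of finite sums -/

/-- Nearest point projections to finite subsets of the closed ball of radius `r`. -/
def ballApprox (d : ℕ) (r : ℝ) (hr : 0 ≤ r) (N : ℕ) : SimpleFunc (Eucl d) (Eucl d) :=
  SimpleFunc.approxOn id measurable_id (Metric.closedBall 0 r) 0 (Metric.mem_closedBall_self hr) N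

theorem ballApprox_mem {d : ℕ} {r : ℝ} (hr : 0 ≤ r) (N : ℕ) (z : Eucl d) :
    ballApprox d r hr N z ∈ Metric.closedBall (0 : Eucl d) r :=
  SimpleFunc.approxOn_mem _ _ _ _

theorem tendsto_ballApprox {d : ℕ} {r : ℝ} (hr : 0 ≤ r) {z : Eucl d}
    (hz : z ∈ Metric.closedBall (0 : Eucl d) r) :
    Tendsto (fun N => ballApprox d r hr N z) atTop (𝓝 z) :=
  SimpleFunc.tendsto_approxOn measurable_id (Metric.mem_closedBall_self hr)
    (by simpa using subset_closure hz)

/-- The weights of the finite sums that approximate `∫ K f`. -/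
def ballWeight {d : ℕ} (K : Eucl d → ℂ) (r : ℝ) (hr : 0 ≤ r) (N : ℕ) (y : Eucl d) : ℂ :=
  ∫ z in ballApprox d r hr N ⁻¹' {y}, K z

/-- The weights depend on `K` only, not on `f`, so the same finite sum approximates the integral of
a random path and of the exponential in its spectral representative. -/
theorem sum_ballWeight_mul {d : ℕ} {K : Eucl d → ℂ} (hK : Integrable K) {r : ℝ} (hr : 0 ≤ r)
    (N : ℕ) (f : Eucl d → ℂ) :
    ∑ y ∈ (ballApprox d r hr N).range, ballWeight K r hr N y * f y =
      ∫ z, K z * f (ballApprox d r hr N z) := by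
  set π := ballApprox d r hr N
  have hm : ∀ y, MeasurableSet (π ⁻¹' {y}) := fun y => π.measurableSet_fiber y
  have e : (fun z => K z * f (π z)) =
      fun z => ∑ y ∈ π.range, (π ⁻¹' {y}).indicator (fun z => K z * f y) z := by
    funext z
    rw [Finset.sum_eq_single (π z)]
    · rw [Set.indicator_of_mem (by simp)]
    · intro y _ hy
      rw [Set.indicator_of_notMem]
      simpa using fun h => hy h.symm
    · intro h
      exact absurd (π.mem_range_self z) h
  rw [e, integral_finsetSum _ fun y _ => (hK.mul_const _).indicator (hm y)]
  refine Finset.sum_congr rfl fun y _ => ?_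
  rw [integral_indicator (hm y), integral_mul_const]
  rfl

theorem tendsto_integral_ballApprox {d : ℕ} {K : Eucl d → ℂ} (hK : Integrable K) {r : ℝ}
    (hr : 0 ≤ r) (hKr : ∀ z, r < ‖z‖ → K z = 0) {f : Eucl d → ℂ} (hf : Continuous f) :
    Tendsto (fun N => ∫ z, K z * f (ballApprox d r hr N z)) atTop (𝓝 (∫ z, K z * f z)) := by
  obtain ⟨M, hM⟩ := (isCompact_closedBall (0 : Eucl d) r).exists_bound_of_continuousOn
    hf.continuousOn
  refine tendsto_integral_of_dominated_convergence (fun z => ‖K z‖ * M) (fun N => ?_)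
    (hK.norm.mul_const M) (fun N => Eventually.of_forall fun z => ?_)
    (Eventually.of_forall fun z => ?_)
  · exact hK.1.mul (hf.measurable.comp (ballApprox d r hr N).measurable).aestronglyMeasurable
  · rw [norm_mul]
    gcongr
    exact hM _ (ballApprox_mem hr N z)
  · by_cases hz : z ∈ Metric.closedBall (0 : Eucl d) r
    · exact tendsto_const_nhds.mul ((hf.tendsto z).comp (tendsto_ballApprox hr hz))
    · have : K z = 0 := hKr z (by simpa using hz)
      simp [this]

section Solution

variable {d : ℕ} {H : Fin (d + 1) → ℝ} {Ω : Type*} [MeasurableSpace Ω] {P : Measure Ω}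
  {Ψ : ℕ → ℝ≥0 → Eucl d → Ω → ℂ}

/-- The spectral representative of `∫ K(z) Ψ_n(t, z) dz`. -/
def intKernel (n : ℕ) (t : ℝ≥0) (K : Eucl d → ℂ) : ℝ × Eucl d → ℂ :=
  (freqDomain d n).indicator fun q =>
    gammaKernel t q.1 ‖q.2‖ * ∫ z, K z * Complex.exp (Complex.I * (inner ℝ q.2 z : ℝ))

/-- Nearest-point sums converge along every continuous path, and their kernels converge in L² by
dominated convergence, since D_n has finite mass and γ_t is bounded by t. -/
theorem mem_limClosure_integral (hd : 1 ≤ d) (hH : ∀ i, H i ∈ Set.Ioo (0 : ℝ) 1)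
    {n : ℕ} {t : ℝ≥0} (hc : ∀ᵐ ω ∂P, Continuous fun z => Ψ n t z ω)
    {K : Eucl d → ℂ} (hK : Integrable K) {r : ℝ} (hr : 0 ≤ r) (hKr : ∀ z, r < ‖z‖ → K z = 0) :
    ((fun ω => ∫ z, K z * Ψ n t z ω), intKernel n t K) ∈
      limClosure P (spectralMeasure H) (solSpan Ψ) := by
  set s : ℕ → (Ω → ℂ) × (ℝ × Eucl d → ℂ) := fun N =>
    ∑ y ∈ (ballApprox d r hr N).range, ballWeight K r hr N y •
      (solValue Ψ (n, t, y), solKernel (n, t, y)) with hs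
  have hs1 : ∀ N ω, (s N).1 ω = ∫ z, K z * Ψ n t (ballApprox d r hr N z) ω := fun N ω => by
    rw [← sum_ballWeight_mul hK hr N fun y => Ψ n t y ω]
    simp [hs, Prod.fst_sum, Finset.sum_apply, solValue]
  have hs2' : ∀ N, (s N).2 = fun q =>
      ∑ y ∈ (ballApprox d r hr N).range, ballWeight K r hr N y * solKernel (n, t, y) q := fun N => by
    funext q
    simp [hs, Prod.snd_sum, Finset.sum_apply]
  have hs2 : ∀ N q, (s N).2 q = (freqDomain d n).indicator (fun q => gammaKernel t q.1 ‖q.2‖ *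
      ∫ z, K z * Complex.exp (Complex.I * (inner ℝ q.2 (ballApprox d r hr N z) : ℝ))) q :=
    fun N q => by
    rw [hs2']
    by_cases hq : q ∈ freqDomain d n
    · rw [Set.indicator_of_mem hq, ← sum_ballWeight_mul hK hr N
        fun y => Complex.exp (Complex.I * (inner ℝ q.2 y : ℝ)), Finset.mul_sum]
      refine Finset.sum_congr rfl fun y _ => ?_
      rw [solKernel, Set.indicator_of_mem hq]
      ring
    · rw [Set.indicator_of_notMem hq]
      refine Finset.sum_eq_zero fun y _ => ?_
      rw [solKernel, Set.indicator_of_notMem hq, mul_zero]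
  have hsm : ∀ N, Measurable (s N).2 := fun N => by
    rw [hs2']
    exact Finset.measurable_fun_sum _ fun y _ => (measurable_solKernel _).const_mul _
  have hlim : ∀ q, Tendsto (fun N => (s N).2 q) atTop (𝓝 (intKernel n t K q)) := fun q => by
    simp only [hs2, intKernel]
    by_cases hq : q ∈ freqDomain d n
    · simp only [Set.indicator_of_mem hq]
      exact tendsto_const_nhds.mul (tendsto_integral_ballApprox hK hr hKr
        (f := fun z => Complex.exp (Complex.I * (inner ℝ q.2 z : ℝ))) (by fun_prop))
    · simp only [Set.indicator_of_notMem hq]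
      exact tendsto_const_nhds
  have hvm : Measurable (intKernel n t K) :=
    measurable_of_tendsto_metrizable hsm (tendsto_pi_nhds.mpr hlim)
  refine ⟨hvm.aestronglyMeasurable, s, fun N => ?_, fun N => (hsm N).aestronglyMeasurable, ?_, ?_⟩
  · exact Submodule.sum_mem _ fun y _ => Submodule.smul_mem _ _
      (Submodule.subset_span ⟨(n, t, y), rfl⟩)
  · filter_upwards [hc] with ω hω
    simp only [hs1]
    exact tendsto_integral_ballApprox hK hr hKr hω
  · refine tendsto_eLpNorm_two_of_bounded (measurableSet_freqDomain d n)
      (spectralMeasure_freqDomain_lt_top hd hH n) (fun N => (hsm N).aestronglyMeasurable)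
      hvm.aestronglyMeasurable (C := t * ∫ z, ‖K z‖) (fun N q hq => ?_) (fun N q hq => ?_) hlim
    · rw [hs2, Set.indicator_of_mem hq, norm_mul]
      gcongr
      · exact norm_gammaKernel_le t.coe_nonneg _ _
      · refine (norm_integral_le_integral_norm _).trans_eq ?_
        refine integral_congr_ae (Eventually.of_forall fun z => ?_)
        simp only [norm_mul, norm_exp_I_mul, mul_one]
    · rw [hs2, Set.indicator_of_notMem hq]

/-- Limits of linear functionals of the solution, with their spectral representatives. -/
def solSpace (P : Measure Ω) (H : Fin (d + 1) → ℝ) (Ψ : ℕ → ℝ≥0 → Eucl d → Ω → ℂ) :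
    Submodule ℂ ((Ω → ℂ) × (ℝ × Eucl d → ℂ)) :=
  limClosure P (spectralMeasure H) (limClosure P (spectralMeasure H) (solSpan Ψ))

/-- Two closures occur because two limits are taken: finite sums to integrals against compactly
supported kernels, then frequency truncations of the Bessel potential to the full one. -/
theorem momentBound_of_mem_solSpace (hd : 1 ≤ d) (hH : ∀ i, H i ∈ Set.Ioo (0 : ℝ) 1)
    (hΨ : IsLinearSolution H P Ψ) {p : (Ω → ℂ) × (ℝ × Eucl d → ℂ)} (hp : p ∈ solSpace P H Ψ) :
    MomentBound P p.1 (eLpNorm p.2 2 (spectralMeasure H)) :=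
  momentBound_of_mem_limClosure (fun _ hq => momentBound_of_mem_limClosure
    (fun _ hq => momentBound_of_mem_solSpan hd hH hΨ hq) hq) hp

end Solution

/-! ### Symbol estimates -/

theorem one_add_norm_add_sq_le {E : Type*} [NormedAddCommGroup E] (a b : E) :
    1 + ‖a + b‖ ^ 2 ≤ 2 * (1 + ‖a‖ ^ 2) * (1 + ‖b‖ ^ 2) := by
  have h := norm_add_le a b
  have h2 : ‖a + b‖ ^ 2 ≤ (‖a‖ + ‖b‖) ^ 2 := by gcongr
  nlinarith [sq_nonneg (‖a‖ - ‖b‖), mul_nonneg (sq_nonneg ‖a‖) (sq_nonneg ‖b‖)]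

/-- Peetre's inequality. -/
theorem one_add_norm_add_sq_rpow_le {E : Type*} [NormedAddCommGroup E] (a b : E) (s : ℝ) :
    (1 + ‖a + b‖ ^ 2) ^ s ≤ 2 ^ |s| * (1 + ‖b‖ ^ 2) ^ s * (1 + ‖a‖ ^ 2) ^ |s| := by
  have ha : 0 < 1 + ‖a‖ ^ 2 := by positivity
  have hb : 0 < 1 + ‖b‖ ^ 2 := by positivity
  have hab : 0 < 1 + ‖a + b‖ ^ 2 := by positivity
  rcases le_total 0 s with h | h
  · rw [abs_of_nonneg h, ← Real.mul_rpow (by norm_num) hb.le,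
      ← Real.mul_rpow (by positivity) ha.le]
    apply Real.rpow_le_rpow hab.le _ h
    linarith [one_add_norm_add_sq_le a b]
  · rw [abs_of_nonpos h]
    have h1 : (1 + ‖b‖ ^ 2) ≤ 2 * (1 + ‖a‖ ^ 2) * (1 + ‖a + b‖ ^ 2) := by
      have := one_add_norm_add_sq_le (-a) (a + b)
      rwa [neg_add_cancel_left, norm_neg] at this
    have h2 := Real.rpow_le_rpow_of_nonpos hb h1 h
    rw [Real.mul_rpow (by positivity) hab.le, Real.mul_rpow (by norm_num) ha.le] at h2
    have e1 : (2 : ℝ) ^ (-s) * 2 ^ s = 1 := by rw [← Real.rpow_add two_pos]; simp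
    have e2 : (1 + ‖a‖ ^ 2) ^ (-s) * (1 + ‖a‖ ^ 2) ^ s = 1 := by rw [← Real.rpow_add ha]; simp
    calc (1 + ‖a + b‖ ^ 2) ^ s
        = (2 ^ (-s) * 2 ^ s) * ((1 + ‖a‖ ^ 2) ^ (-s) * (1 + ‖a‖ ^ 2) ^ s) *
          (1 + ‖a + b‖ ^ 2) ^ s := by rw [e1, e2]; ring
      _ = (2 ^ (-s) * (1 + ‖a‖ ^ 2) ^ (-s)) *
          (2 ^ s * (1 + ‖a‖ ^ 2) ^ s * (1 + ‖a + b‖ ^ 2) ^ s) := by ring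
      _ ≤ (2 ^ (-s) * (1 + ‖a‖ ^ 2) ^ (-s)) * (1 + ‖b‖ ^ 2) ^ s := by gcongr
      _ = _ := by ring

theorem norm_besselSymbol (d : ℕ) (s : ℝ) (x : Eucl d) :
    ‖besselSymbol d s x‖ = (1 + ‖(2 * Real.pi) • x‖ ^ 2) ^ (s / 2) := by
  rw [besselSymbol, Complex.norm_real, Real.norm_of_nonneg (by positivity)]

theorem contDiff_besselSymbol (d : ℕ) (s : ℝ) : ContDiff ℝ (⊤ : ℕ∞) (besselSymbol d s) :=
  (besselSymbol_hasTemperateGrowth d s).1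

/-- The function is quadratic, so only the first two derivatives matter. The form D^i is the one
required by the estimate for derivatives of compositions. -/
theorem norm_iteratedFDeriv_const_add_norm_sq_le {E : Type*} [NormedAddCommGroup E]
    [InnerProductSpace ℝ E] {a c D : ℝ} (x : E) (h1 : 2 * |c| * ‖x‖ ≤ D) (h2 : 2 * |c| ≤ D ^ 2)
    {i : ℕ} (hi : 1 ≤ i) : ‖iteratedFDeriv ℝ i (fun y : E => a + c * ‖y‖ ^ 2) x‖ ≤ D ^ i := by
  have hD : 0 ≤ D := le_trans (by positivity) h1
  have hder : fderiv ℝ (fun y : E => a + c * ‖y‖ ^ 2) = ((2 * c) • innerSL ℝ : E →L[ℝ] E →L[ℝ] ℝ) := by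
    funext y
    have := ((hasStrictFDerivAt_norm_sq y).hasFDerivAt.const_mul c).const_add a
    rw [this.fderiv]
    ext v
    simp
    ring
  have hL : ‖((2 * c) • innerSL ℝ : E →L[ℝ] E →L[ℝ] ℝ)‖ ≤ 2 * |c| := by
    refine ContinuousLinearMap.opNorm_le_bound _ (by positivity) fun v =>
      ContinuousLinearMap.opNorm_le_bound _ (by positivity) fun w => ?_
    have e : ((2 * c) • innerSL ℝ : E →L[ℝ] E →L[ℝ] ℝ) v w = (2 * c) * inner ℝ v w := by simp
    rw [e, norm_mul, norm_mul, Real.norm_ofNat, Real.norm_eq_abs, Real.norm_eq_abs, mul_assoc _ ‖v‖]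
    gcongr
    exact abs_real_inner_le_norm v w
  match i, hi with
  | 1, _ =>
    rw [norm_iteratedFDeriv_one, hder, pow_one]
    refine (ContinuousLinearMap.le_opNorm _ _).trans (le_trans ?_ h1)
    gcongr
  | 2, _ =>
    rw [← norm_iteratedFDeriv_fderiv, hder, norm_iteratedFDeriv_one, ContinuousLinearMap.fderiv]
    exact hL.trans h2
  | (j + 3), _ =>
    have e : fderiv ℝ (((2 * c) • innerSL ℝ : E →L[ℝ] E →L[ℝ] ℝ) : E → E →L[ℝ] ℝ) =
        fun _ => ((2 * c) • innerSL ℝ : E →L[ℝ] E →L[ℝ] ℝ) := by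
      funext y; exact ContinuousLinearMap.fderiv _
    rw [← norm_iteratedFDeriv_fderiv, hder, ← norm_iteratedFDeriv_fderiv, e,
      iteratedFDeriv_const_of_ne (by omega)]
    simp only [Pi.zero_apply, norm_zero]
    positivity

/-- The derivatives of the Bessel symbol are bounded by the symbol itself. -/
theorem exists_norm_iteratedFDeriv_besselSymbol_le (d : ℕ) (s : ℝ) (n : ℕ) :
    ∃ C : ℝ, 0 ≤ C ∧ ∀ x : Eucl d, ‖iteratedFDeriv ℝ n (besselSymbol d s) x‖ ≤
      C * (1 + ‖(2 * Real.pi) • x‖ ^ 2) ^ (s / 2) := by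
  set g : ℝ → ℝ := fun u => u ^ (s / 2)
  set C₀ : ℝ := ∑ i ∈ Finset.range (n + 1), ‖iteratedFDerivWithin ℝ i g (Set.Ioi 0) 1‖
  set D : ℝ := 2 * (2 * Real.pi) ^ 2 with hD
  have hpi : 0 < Real.pi := Real.pi_pos
  have hpi3 := Real.pi_gt_three
  refine ⟨n.factorial * C₀ * D ^ n, by positivity, fun x => ?_⟩
  set R : ℝ := 1 + ‖(2 * Real.pi) • x‖ ^ 2 with hR
  have hR1 : 1 ≤ R := by rw [hR]; nlinarith [sq_nonneg ‖(2 * Real.pi) • x‖]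
  have hR0 : 0 < R := by linarith
  -- Dividing by the value R at the point x gives F(x) = 1 and derivatives bounded independently of
  -- x. The power function is then differentiated only at 1, which makes the constants uniform.
  set F : Eucl d → ℝ := fun y => R⁻¹ + (R⁻¹ * (2 * Real.pi) ^ 2) * ‖y‖ ^ 2 with hF
  have hFy : ∀ y, F y = R⁻¹ * (1 + ‖(2 * Real.pi) • y‖ ^ 2) := fun y => by
    simp only [hF, norm_smul, Real.norm_of_nonneg (by positivity : (0 : ℝ) ≤ 2 * Real.pi)]
    ring
  have hFx : F x = 1 := by rw [hFy, ← hR, inv_mul_cancel₀ hR0.ne']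
  have hF0 : ∀ y, 0 < F y := fun y => by rw [hFy]; positivity
  have hsym : besselSymbol d s = fun y => (((R ^ (s / 2)) • (g ∘ F)) y : ℂ) := by
    funext y
    rw [besselSymbol]
    congr 1
    simp only [Pi.smul_apply, Function.comp, smul_eq_mul, g]
    rw [← Real.mul_rpow hR0.le (hF0 y).le, hFy, ← mul_assoc, mul_inv_cancel₀ hR0.ne', one_mul]
  have hFc : ContDiff ℝ (⊤ : ℕ∞) F := by
    simp only [hF]; exact contDiff_const.add (contDiff_const.mul (contDiff_norm_sq ℝ))
  have hgc : ContDiffOn ℝ (⊤ : ℕ∞) g (Set.Ioi 0) :=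
    contDiffOn_fun_id.rpow_const_of_ne fun u hu => (ne_of_gt hu)
  have hgF : ContDiff ℝ (⊤ : ℕ∞) (g ∘ F) := by
    rw [← contDiffOn_univ]
    exact hgc.comp hFc.contDiffOn fun y _ => hF0 y
  have h1 : ‖iteratedFDeriv ℝ n (g ∘ F) x‖ ≤ n.factorial * C₀ * D ^ n := by
    rw [← iteratedFDerivWithin_univ]
    refine norm_iteratedFDerivWithin_comp_le hgc hFc.contDiffOn
      (mod_cast le_top) (uniqueDiffOn_Ioi 0) uniqueDiffOn_univ (fun y _ => hF0 y)
      (Set.mem_univ x) (fun i hi => ?_) (fun i hi _ => ?_)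
    · rw [hFx]
      exact Finset.single_le_sum (f := fun i => ‖iteratedFDerivWithin ℝ i g (Set.Ioi 0) 1‖)
        (fun _ _ => norm_nonneg _) (Finset.mem_range.mpr (by omega))
    · rw [iteratedFDerivWithin_univ]
      have hc : |R⁻¹ * (2 * Real.pi) ^ 2| = R⁻¹ * (2 * Real.pi) ^ 2 :=
        abs_of_nonneg (by positivity)
      apply norm_iteratedFDeriv_const_add_norm_sq_le x _ _ hi
      · rw [hc, hD]
        have hxR : ‖x‖ ≤ R := by
          rw [hR, norm_smul, Real.norm_of_nonneg (by positivity)]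
          have : (1 : ℝ) ≤ (2 * Real.pi) ^ 2 := by nlinarith
          nlinarith [sq_nonneg (‖x‖ - 1), sq_nonneg ‖x‖]
        calc 2 * (R⁻¹ * (2 * Real.pi) ^ 2) * ‖x‖ ≤ 2 * (R⁻¹ * (2 * Real.pi) ^ 2) * R := by gcongr
          _ = _ := by field_simp
      · rw [hc, hD]
        have hRi : R⁻¹ ≤ 1 := inv_le_one_of_one_le₀ hR1
        have h4 : (1 : ℝ) ≤ (2 * Real.pi) ^ 2 := by nlinarith
        calc 2 * (R⁻¹ * (2 * Real.pi) ^ 2) ≤ 2 * (1 * (2 * Real.pi) ^ 2) := by gcongr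
          _ ≤ (2 * (2 * Real.pi) ^ 2) ^ 2 := by nlinarith
  have h2 : ‖iteratedFDeriv ℝ n (besselSymbol d s) x‖ =
      R ^ (s / 2) * ‖iteratedFDeriv ℝ n (g ∘ F) x‖ := by
    rw [hsym]
    have e : (fun y => (((R ^ (s / 2)) • (g ∘ F)) y : ℂ)) =
        Complex.ofRealLI ∘ ((R ^ (s / 2)) • (g ∘ F)) := rfl
    have hsm : ContDiff ℝ (⊤ : ℕ∞) ((R ^ (s / 2)) • (g ∘ F)) := contDiff_const.smul hgF
    rw [e, LinearIsometry.norm_iteratedFDeriv_comp_left _ hsm.contDiffAt (mod_cast le_top),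
      iteratedFDeriv_const_smul_apply (hgF.of_le (mod_cast le_top)).contDiffAt, norm_smul,
      Real.norm_of_nonneg (by positivity)]
  rw [h2, mul_comm]
  gcongr

/-! ### The action of `(Id - Δ)^{s/2}` on modulated functions -/

/-- The value at `x` of `(Id - Δ)^{s/2}` applied to the function with Fourier transform
`u (· - η / 2π)`. -/
def besselKernel {d : ℕ} (s : ℝ) (u : 𝓢(Eucl d, ℂ)) (η x : Eucl d) : ℂ :=
  ∫ ζ, besselSymbol d s ζ * Complex.exp (Complex.I * (2 * Real.pi * inner ℝ ζ x : ℝ)) *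
    u (ζ - (2 * Real.pi)⁻¹ • η)

theorem norm_besselSymbol_add_le (d : ℕ) (s : ℝ) (ζ η : Eucl d) :
    (1 + ‖(2 * Real.pi) • (ζ + (2 * Real.pi)⁻¹ • η)‖ ^ 2) ^ (s / 2) ≤
      2 ^ |s / 2| * (1 + ‖η‖ ^ 2) ^ (s / 2) * (1 + ‖(2 * Real.pi) • ζ‖ ^ 2) ^ |s / 2| := by
  rw [smul_add, smul_smul, mul_inv_cancel₀ (by positivity), one_smul]
  exact one_add_norm_add_sq_rpow_le _ _ _

theorem one_add_norm_two_pi_smul_sq_le {d : ℕ} (ζ : Eucl d) :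
    1 + ‖(2 * Real.pi) • ζ‖ ^ 2 ≤ 64 * (1 + ‖ζ‖) ^ 2 := by
  rw [norm_smul, Real.norm_of_nonneg (by positivity)]
  have h1 := Real.pi_le_four
  have h0 := Real.pi_pos
  have : (2 * Real.pi * ‖ζ‖) ^ 2 ≤ (8 * ‖ζ‖) ^ 2 := by gcongr; linarith
  nlinarith [norm_nonneg ζ]

/-- Products of symbols and Schwartz functions are integrable, together with their derivatives,
uniformly in the shift. -/
theorem exists_norm_iteratedFDeriv_shift_mul_le {d : ℕ} (s : ℝ) (u : 𝓢(Eucl d, ℂ)) (n : ℕ) :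
    ∃ C : ℝ, 0 ≤ C ∧ ∀ η ζ : Eucl d, ‖iteratedFDeriv ℝ n (fun ζ =>
      besselSymbol d s (ζ + (2 * Real.pi)⁻¹ • η) * u ζ) ζ‖ ≤
        C * (1 + ‖η‖ ^ 2) ^ (s / 2) * (1 + ‖ζ‖) ^ (-((d : ℝ) + 1)) := by
  choose C hC0 hC using exists_norm_iteratedFDeriv_besselSymbol_le d s
  obtain ⟨M, hM⟩ := exists_nat_ge |s|
  have hu : ∀ j, ∃ B : ℝ, 0 ≤ B ∧ ∀ ζ, (1 + ‖ζ‖) ^ (M + (d + 1)) * ‖iteratedFDeriv ℝ j u ζ‖ ≤ B :=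
    fun j => ⟨_, by positivity, fun ζ =>
      SchwartzMap.one_add_le_sup_seminorm_apply (𝕜 := ℝ) (m := (M + (d + 1), j)) le_rfl le_rfl u ζ⟩
  choose B hB0 hB using hu
  refine ⟨∑ i ∈ Finset.range (n + 1), (n.choose i : ℝ) * (C i * (2 ^ |s / 2| * 64 ^ |s / 2|)) *
    B (n - i), Finset.sum_nonneg fun i _ => by have := hC0 i; have := hB0 (n - i); positivity,
    fun η ζ => ?_⟩
  have hm : ContDiff ℝ (⊤ : ℕ∞) fun ζ => besselSymbol d s (ζ + (2 * Real.pi)⁻¹ • η) :=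
    (contDiff_besselSymbol d s).comp (contDiff_id.add contDiff_const)
  refine (norm_iteratedFDeriv_mul_le hm (u.smooth ⊤) ζ (n := n) (mod_cast le_top)).trans ?_
  rw [Finset.sum_mul, Finset.sum_mul]
  refine Finset.sum_le_sum fun i _ => ?_
  have hζ : 0 < 1 + ‖ζ‖ := by positivity
  have h1 : ‖iteratedFDeriv ℝ i (fun ζ => besselSymbol d s (ζ + (2 * Real.pi)⁻¹ • η)) ζ‖ ≤
      C i * (2 ^ |s / 2| * 64 ^ |s / 2|) * (1 + ‖η‖ ^ 2) ^ (s / 2) * (1 + ‖ζ‖) ^ M := by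
    rw [iteratedFDeriv_comp_add_right]
    refine (hC i _).trans ?_
    have h3 : (1 + ‖(2 * Real.pi) • ζ‖ ^ 2) ^ |s / 2| ≤ 64 ^ |s / 2| * (1 + ‖ζ‖) ^ M := by
      calc (1 + ‖(2 * Real.pi) • ζ‖ ^ 2) ^ |s / 2| ≤ (64 * (1 + ‖ζ‖) ^ 2) ^ |s / 2| := by
            gcongr; exact one_add_norm_two_pi_smul_sq_le ζ
        _ = 64 ^ |s / 2| * (1 + ‖ζ‖) ^ |s| := by
            rw [Real.mul_rpow (by norm_num) (by positivity), ← Real.rpow_natCast,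
              ← Real.rpow_mul hζ.le]
            congr 2
            rw [abs_div, abs_two]; push_cast; ring
        _ ≤ 64 ^ |s / 2| * (1 + ‖ζ‖) ^ M := by
            gcongr
            rw [← Real.rpow_natCast]
            exact Real.rpow_le_rpow_of_exponent_le (by linarith [norm_nonneg ζ]) hM
    have h4 := norm_besselSymbol_add_le d s ζ η
    have := hC0 i
    calc C i * (1 + ‖(2 * Real.pi) • (ζ + (2 * Real.pi)⁻¹ • η)‖ ^ 2) ^ (s / 2)
        ≤ C i * (2 ^ |s / 2| * (1 + ‖η‖ ^ 2) ^ (s / 2) * (64 ^ |s / 2| * (1 + ‖ζ‖) ^ M)) := by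
          gcongr
          refine h4.trans ?_
          gcongr
      _ = _ := by ring
  have h2 : (1 + ‖ζ‖) ^ M * ‖iteratedFDeriv ℝ (n - i) u ζ‖ ≤
      B (n - i) * (1 + ‖ζ‖) ^ (-((d : ℝ) + 1)) := by
    have h3 := hB (n - i) ζ
    have e : (1 + ‖ζ‖) ^ ((d : ℝ) + 1) = (1 + ‖ζ‖) ^ (d + 1) := by
      rw [← Real.rpow_natCast]; push_cast; rfl
    rw [Real.rpow_neg hζ.le, e, ← div_eq_mul_inv, le_div_iff₀ (by positivity)]
    rw [pow_add] at h3
    linarith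
  have := hC0 i
  calc (n.choose i : ℝ) * ‖iteratedFDeriv ℝ i
        (fun ζ => besselSymbol d s (ζ + (2 * Real.pi)⁻¹ • η)) ζ‖ * ‖iteratedFDeriv ℝ (n - i) u ζ‖
      ≤ (n.choose i : ℝ) * (C i * (2 ^ |s / 2| * 64 ^ |s / 2|) * (1 + ‖η‖ ^ 2) ^ (s / 2) *
        (1 + ‖ζ‖) ^ M) * ‖iteratedFDeriv ℝ (n - i) u ζ‖ := by gcongr
    _ = (n.choose i : ℝ) * (C i * (2 ^ |s / 2| * 64 ^ |s / 2|)) * (1 + ‖η‖ ^ 2) ^ (s / 2) *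
        ((1 + ‖ζ‖) ^ M * ‖iteratedFDeriv ℝ (n - i) u ζ‖) := by ring
    _ ≤ (n.choose i : ℝ) * (C i * (2 ^ |s / 2| * 64 ^ |s / 2|)) * (1 + ‖η‖ ^ 2) ^ (s / 2) *
        (B (n - i) * (1 + ‖ζ‖) ^ (-((d : ℝ) + 1))) := by gcongr
    _ = _ := by ring

theorem integrable_one_add_norm_eucl (d : ℕ) :
    Integrable fun ζ : Eucl d => (1 + ‖ζ‖) ^ (-((d : ℝ) + 1)) :=
  integrable_one_add_norm (by simp)

/-- Translating ζ by η/2π pulls out the modulation e^{i⟨η, x⟩} and moves the shift from `u` to the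
symbol, where Peetre's inequality controls it. -/
theorem besselKernel_eq {d : ℕ} (s : ℝ) (u : 𝓢(Eucl d, ℂ)) (η x : Eucl d) :
    besselKernel s u η x = Complex.exp (Complex.I * (inner ℝ η x : ℝ)) *
      FourierTransform.fourier (fun ζ => besselSymbol d s (ζ + (2 * Real.pi)⁻¹ • η) * u ζ) (-x) := by
  rw [besselKernel, ← integral_add_right_eq_self _ ((2 * Real.pi)⁻¹ • η), Real.fourier_eq',
    ← integral_const_mul]
  refine integral_congr_ae (Eventually.of_forall fun ζ => ?_)
  simp only [add_sub_cancel_right, smul_eq_mul, inner_neg_right, mul_neg, neg_mul, neg_neg]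
  have e : Complex.exp (Complex.I *
      (2 * Real.pi * inner ℝ (ζ + (2 * Real.pi)⁻¹ • η) x : ℝ)) =
      Complex.exp (Complex.I * (inner ℝ η x : ℝ)) *
        Complex.exp ((2 * Real.pi * inner ℝ ζ x : ℝ) * Complex.I) := by
    rw [← Complex.exp_add, inner_add_left, real_inner_smul_left, mul_add, ← mul_assoc,
      mul_inv_cancel₀ (by positivity), one_mul]
    congr 1
    push_cast
    ring
  rw [e]
  ring

/-- Powers of x become derivatives in ζ of the shifted symbol times `u`; these are integrable, with
a bound in which η enters only through (1 + |η|²)^{s/2}. -/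
theorem exists_pow_mul_norm_besselKernel_le {d : ℕ} (s : ℝ) (u : 𝓢(Eucl d, ℂ)) (n : ℕ) :
    ∃ C : ℝ, 0 ≤ C ∧ ∀ η x : Eucl d,
      ‖x‖ ^ n * ‖besselKernel s u η x‖ ≤ C * (1 + ‖η‖ ^ 2) ^ (s / 2) := by
  choose C hC0 hC using exists_norm_iteratedFDeriv_shift_mul_le s u
  set I : ℝ := ∫ ζ : Eucl d, (1 + ‖ζ‖) ^ (-((d : ℝ) + 1)) with hI
  have hI0 : 0 ≤ I := integral_nonneg fun ζ => by positivity
  have hCs : 0 ≤ ∑ p ∈ Finset.range 1 ×ˢ Finset.range (n + 1), C p.2 :=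
    Finset.sum_nonneg fun p _ => hC0 _
  refine ⟨2 ^ n * ∑ p ∈ Finset.range 1 ×ˢ Finset.range (n + 1), C p.2 * I, by
    rw [← Finset.sum_mul]; positivity, fun η x => ?_⟩
  set f : Eucl d → ℂ := fun ζ => besselSymbol d s (ζ + (2 * Real.pi)⁻¹ • η) * u ζ with hf
  have hfc : ContDiff ℝ (⊤ : ℕ∞) f :=
    ((contDiff_besselSymbol d s).comp (contDiff_id.add contDiff_const)).mul (u.smooth ⊤)
  have hint : ∀ j, Integrable fun ζ => ‖iteratedFDeriv ℝ j f ζ‖ := fun j => by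
    refine ((integrable_one_add_norm_eucl d).const_mul (C j * (1 + ‖η‖ ^ 2) ^ (s / 2))).mono'
      ?_ (Eventually.of_forall fun ζ => ?_)
    · exact (hfc.continuous_iteratedFDeriv (m := j) (mod_cast le_top)).norm.aestronglyMeasurable
    · rw [norm_norm]; exact hC j η ζ
  have key := Real.pow_mul_norm_iteratedFDeriv_fourier_le (K := 0) (N := ⊤) hfc
    (fun k j hk _ => by
      have : k = 0 := by simpa using hk
      subst this
      simpa using hint j) (k := 0) (n := n) le_rfl le_top (-x)
  rw [besselKernel_eq, norm_mul, norm_exp_I_mul, one_mul]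
  rw [norm_iteratedFDeriv_zero, norm_neg] at key
  refine key.trans ?_
  simp only [pow_zero, one_mul, CharP.cast_eq_zero, mul_zero, zero_add]
  rw [mul_assoc, Finset.sum_mul]
  gcongr with p hp
  have hp1 : p.1 = 0 := by
    have := (Finset.mem_product.mp hp).1
    simpa using this
  simp only [hp1, pow_zero, one_mul]
  calc ∫ ζ, ‖iteratedFDeriv ℝ p.2 f ζ‖
      ≤ ∫ ζ : Eucl d, C p.2 * (1 + ‖η‖ ^ 2) ^ (s / 2) * (1 + ‖ζ‖) ^ (-((d : ℝ) + 1)) :=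
        integral_mono (hint _) ((integrable_one_add_norm_eucl d).const_mul _) (hC _ _)
    _ = _ := by rw [integral_const_mul, hI]; ring

theorem exists_weight_mul_norm_besselKernel_le {d : ℕ} (s : ℝ) (u : 𝓢(Eucl d, ℂ)) (N : ℕ) :
    ∃ C : ℝ, 0 ≤ C ∧ ∀ η x : Eucl d,
      (1 + ‖x‖ ^ 2) ^ N * ‖besselKernel s u η x‖ ≤ C * (1 + ‖η‖ ^ 2) ^ (s / 2) := by
  obtain ⟨C₁, hC₁, h1⟩ := exists_pow_mul_norm_besselKernel_le s u 0
  obtain ⟨C₂, hC₂, h2⟩ := exists_pow_mul_norm_besselKernel_le s u (2 * N)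
  refine ⟨2 ^ N * (C₁ + C₂), by positivity, fun η x => ?_⟩
  have h3 : (1 + ‖x‖ ^ 2) ^ N ≤ 2 ^ N * (1 + ‖x‖ ^ (2 * N)) := by
    have := add_pow_le (zero_le_one (α := ℝ)) (sq_nonneg ‖x‖) N
    rw [one_pow, ← pow_mul] at this
    refine this.trans ?_
    gcongr
    · norm_num
    · omega
  have h1' := h1 η x
  have h2' := h2 η x
  rw [pow_zero, one_mul] at h1'
  calc (1 + ‖x‖ ^ 2) ^ N * ‖besselKernel s u η x‖
      ≤ 2 ^ N * (1 + ‖x‖ ^ (2 * N)) * ‖besselKernel s u η x‖ := by gcongr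
    _ = 2 ^ N * (‖besselKernel s u η x‖ + ‖x‖ ^ (2 * N) * ‖besselKernel s u η x‖) := by ring
    _ ≤ 2 ^ N * (C₁ * (1 + ‖η‖ ^ 2) ^ (s / 2) + C₂ * (1 + ‖η‖ ^ 2) ^ (s / 2)) := by gcongr
    _ = _ := by ring

theorem exists_norm_besselKernel_integrand_le {d : ℕ} (s : ℝ) (u : 𝓢(Eucl d, ℂ)) :
    ∃ C : ℝ, 0 ≤ C ∧ ∀ η ζ : Eucl d, ‖besselSymbol d s ζ * u (ζ - (2 * Real.pi)⁻¹ • η)‖ ≤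
      C * (1 + ‖η‖ ^ 2) ^ (s / 2) *
        (1 + ‖ζ - (2 * Real.pi)⁻¹ • η‖) ^ (-((d : ℝ) + 1)) := by
  obtain ⟨C, hC0, hC⟩ := exists_norm_iteratedFDeriv_shift_mul_le s u 0
  refine ⟨C, hC0, fun η ζ => ?_⟩
  have := hC η (ζ - (2 * Real.pi)⁻¹ • η)
  rwa [norm_iteratedFDeriv_zero, sub_add_cancel] at this

/-- The difference of the two exponentials costs a factor |2πζ|, absorbed by replacing the symbol of
order s by that of order s + 1. -/
theorem exists_norm_besselKernel_sub_le {d : ℕ} (s : ℝ) (u : 𝓢(Eucl d, ℂ)) :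
    ∃ C : ℝ, 0 ≤ C ∧ ∀ η x x' : Eucl d,
      ‖besselKernel s u η x - besselKernel s u η x'‖ ≤
        C * (1 + ‖η‖ ^ 2) ^ ((s + 1) / 2) * ‖x - x'‖ := by
  obtain ⟨C, hC0, hC⟩ := exists_norm_besselKernel_integrand_le (s + 1) u
  obtain ⟨C', hC0', hC'⟩ := exists_norm_besselKernel_integrand_le s u
  set I : ℝ := ∫ ζ : Eucl d, (1 + ‖ζ‖) ^ (-((d : ℝ) + 1)) with hI
  have hI0 : 0 ≤ I := integral_nonneg fun ζ => by positivity
  have hint : ∀ η : Eucl d, Integrable fun ζ : Eucl d =>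
      (1 + ‖ζ - (2 * Real.pi)⁻¹ • η‖) ^ (-((d : ℝ) + 1)) := fun η =>
    (integrable_one_add_norm_eucl d).comp_sub_right _
  refine ⟨C * I, by positivity, fun η x x' => ?_⟩
  have hi : ∀ x, Integrable fun ζ => besselSymbol d s ζ *
      Complex.exp (Complex.I * (2 * Real.pi * inner ℝ ζ x : ℝ)) *
        u (ζ - (2 * Real.pi)⁻¹ • η) := fun x => by
    refine ((hint η).const_mul (C' * (1 + ‖η‖ ^ 2) ^ (s / 2))).mono' ?_
      (Eventually.of_forall fun ζ => ?_)
    · have h1 := (contDiff_besselSymbol d s).continuous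
      have h2 := u.continuous
      exact Continuous.aestronglyMeasurable (by fun_prop)
    · have := hC' η ζ
      rw [norm_mul] at this
      rwa [norm_mul, norm_mul, norm_exp_I_mul, mul_one]
  rw [besselKernel, besselKernel, ← integral_sub (hi x) (hi x')]
  have hb : ∀ ζ, ‖besselSymbol d s ζ * Complex.exp (Complex.I * (2 * Real.pi * inner ℝ ζ x : ℝ)) *
      u (ζ - (2 * Real.pi)⁻¹ • η) - besselSymbol d s ζ *
      Complex.exp (Complex.I * (2 * Real.pi * inner ℝ ζ x' : ℝ)) *
        u (ζ - (2 * Real.pi)⁻¹ • η)‖ ≤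
      C * (1 + ‖η‖ ^ 2) ^ ((s + 1) / 2) * ‖x - x'‖ *
        (1 + ‖ζ - (2 * Real.pi)⁻¹ • η‖) ^ (-((d : ℝ) + 1)) := fun ζ => by
    have e : besselSymbol d s ζ * Complex.exp (Complex.I * (2 * Real.pi * inner ℝ ζ x : ℝ)) *
      u (ζ - (2 * Real.pi)⁻¹ • η) - besselSymbol d s ζ *
      Complex.exp (Complex.I * (2 * Real.pi * inner ℝ ζ x' : ℝ)) * u (ζ - (2 * Real.pi)⁻¹ • η) =
      (Complex.exp (Complex.I * (2 * Real.pi * inner ℝ ζ x : ℝ)) -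
        Complex.exp (Complex.I * (2 * Real.pi * inner ℝ ζ x' : ℝ))) *
        (besselSymbol d s ζ * u (ζ - (2 * Real.pi)⁻¹ • η)) := by ring
    have h1 : ‖Complex.exp (Complex.I * (2 * Real.pi * inner ℝ ζ x : ℝ)) -
        Complex.exp (Complex.I * (2 * Real.pi * inner ℝ ζ x' : ℝ))‖ ≤
        ‖(2 * Real.pi) • ζ‖ * ‖x - x'‖ := by
      refine (norm_exp_I_mul_sub_le _ _).trans ?_
      rw [← mul_sub, ← inner_sub_right, ← real_inner_smul_left]
      exact abs_real_inner_le_norm _ _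
    have h2 : ‖(2 * Real.pi) • ζ‖ * ‖besselSymbol d s ζ‖ ≤ ‖besselSymbol d (s + 1) ζ‖ := by
      rw [norm_besselSymbol, norm_besselSymbol, add_div, Real.rpow_add (by positivity), mul_comm]
      gcongr
      rw [← Real.sqrt_eq_rpow]
      apply Real.le_sqrt_of_sq_le
      linarith
    have h3 := hC η ζ
    rw [norm_mul] at h3
    rw [e, norm_mul, norm_mul]
    calc _ ≤ (‖(2 * Real.pi) • ζ‖ * ‖x - x'‖) *
          (‖besselSymbol d s ζ‖ * ‖u (ζ - (2 * Real.pi)⁻¹ • η)‖) := by gcongr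
      _ = (‖(2 * Real.pi) • ζ‖ * ‖besselSymbol d s ζ‖) * ‖u (ζ - (2 * Real.pi)⁻¹ • η)‖ *
          ‖x - x'‖ := by ring
      _ ≤ ‖besselSymbol d (s + 1) ζ‖ * ‖u (ζ - (2 * Real.pi)⁻¹ • η)‖ * ‖x - x'‖ := by gcongr
      _ ≤ (C * (1 + ‖η‖ ^ 2) ^ ((s + 1) / 2) *
        (1 + ‖ζ - (2 * Real.pi)⁻¹ • η‖) ^ (-((d : ℝ) + 1))) * ‖x - x'‖ := by gcongr
      _ = _ := by ring
  refine (norm_integral_le_of_norm_le ((hint η).const_mul _)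
    (Eventually.of_forall hb)).trans_eq ?_
  rw [integral_const_mul, integral_sub_right_eq_self
    (fun ζ : Eucl d => (1 + ‖ζ‖) ^ (-((d : ℝ) + 1)))]
  ring

/-! ### The localised Bessel potential of a continuous function -/

section Localised

variable {d : ℕ}

/-- The Fourier transform of the product of the cut-off `c` and `f`. -/
def cutoffFourier (c : 𝓢(Eucl d, ℂ)) (f : Eucl d → ℂ) (ζ : Eucl d) : ℂ :=
  ∫ z, c z * Complex.exp (Complex.I * (-(2 * Real.pi * inner ℝ ζ z) : ℝ)) * f z

/-- `(Id - Δ)^{s/2}` applied to the product of the cut-off `c` and `f`. -/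
def besselApply (s : ℝ) (c : 𝓢(Eucl d, ℂ)) (f : Eucl d → ℂ) (x : Eucl d) : ℂ :=
  ∫ ζ, besselSymbol d s ζ * Complex.exp (Complex.I * (2 * Real.pi * inner ℝ ζ x : ℝ)) *
    cutoffFourier c f ζ

/-- Modulation becomes translation. Hence `besselKernel` is `besselApply` on exponentials, which
identifies the spectral representative. -/
theorem cutoffFourier_exp (c : 𝓢(Eucl d, ℂ)) (η ζ : Eucl d) :
    cutoffFourier c (fun z => Complex.exp (Complex.I * (inner ℝ η z : ℝ))) ζ =
      (FourierTransform.fourier c : 𝓢(Eucl d, ℂ)) (ζ - (2 * Real.pi)⁻¹ • η) := by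
  rw [SchwartzMap.fourier_coe, Real.fourier_eq', cutoffFourier]
  refine integral_congr_ae (Eventually.of_forall fun z => ?_)
  simp only [smul_eq_mul]
  rw [mul_assoc, mul_comm (c z), ← Complex.exp_add]
  congr 2
  rw [inner_sub_right, real_inner_smul_right, real_inner_comm, real_inner_comm η z]
  push_cast
  have : (Real.pi : ℂ) ≠ 0 := by exact_mod_cast Real.pi_ne_zero
  field_simp
  ring

theorem cutoffFourier_eq_setIntegral {c : 𝓢(Eucl d, ℂ)} {r : ℝ}
    (hr : ∀ z, r < ‖z‖ → c z = 0) (f : Eucl d → ℂ) (ζ : Eucl d) :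
    cutoffFourier c f ζ = ∫ z in Metric.closedBall 0 r,
      c z * Complex.exp (Complex.I * (-(2 * Real.pi * inner ℝ ζ z) : ℝ)) * f z := by
  refine (setIntegral_eq_integral_of_forall_compl_eq_zero fun z hz => ?_).symm
  rw [hr z (by simpa using hz)]
  simp

theorem continuous_cutoffFourier {c : 𝓢(Eucl d, ℂ)} {r : ℝ} (hr : ∀ z, r < ‖z‖ → c z = 0)
    {A : Type*} [TopologicalSpace A] [FirstCountableTopology A] [LocallyCompactSpace A]
    {f : A → Eucl d → ℂ} (hf : Continuous fun q : A × Eucl d => f q.1 q.2) :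
    Continuous fun q : A × Eucl d => cutoffFourier c (f q.1) q.2 := by
  simp only [cutoffFourier_eq_setIntegral hr]
  refine continuous_parametric_integral_of_continuous (f := fun (q : A × Eucl d) z =>
    c z * Complex.exp (Complex.I * (-(2 * Real.pi * inner ℝ q.2 z) : ℝ)) * f q.1 z) ?_
    (isCompact_closedBall 0 r)
  have hc := c.continuous
  have hf' : Continuous fun q : (A × Eucl d) × Eucl d => f q.1.1 q.2 :=
    hf.comp (by fun_prop : Continuous fun q : (A × Eucl d) × Eucl d => (q.1.1, q.2))
  simp only [Function.uncurry_def]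
  fun_prop

theorem integral_swap_of_isCompact {f : Eucl d → Eucl d → ℂ}
    (hf : Continuous fun q : Eucl d × Eucl d => f q.1 q.2) {A B : Set (Eucl d)} (hA : IsCompact A)
    (hB : IsCompact B) : ∫ x in A, ∫ y in B, f x y = ∫ y in B, ∫ x in A, f x y := by
  refine integral_integral_swap ?_
  rw [Measure.prod_restrict]
  exact hf.continuousOn.integrableOn_compact (hA.prod hB)

/-- The kernel of the frequency truncation of `besselApply`. -/
def truncatedKernel (s : ℝ) (c : 𝓢(Eucl d, ℂ)) (R : ℝ) (x z : Eucl d) : ℂ :=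
  c z * ∫ ζ in Metric.closedBall 0 R,
    besselSymbol d s ζ * Complex.exp (Complex.I * (2 * Real.pi * inner ℝ ζ (x - z) : ℝ))

theorem continuous_besselSymbol (d : ℕ) (s : ℝ) : Continuous (besselSymbol d s) :=
  (contDiff_besselSymbol d s).continuous

theorem continuous_truncatedKernel (s : ℝ) (c : 𝓢(Eucl d, ℂ)) (R : ℝ) (x : Eucl d) :
    Continuous (truncatedKernel s c R x) := by
  refine c.continuous.mul ?_
  refine continuous_parametric_integral_of_continuous (f := fun (z ζ : Eucl d) =>
    besselSymbol d s ζ * Complex.exp (Complex.I * (2 * Real.pi * inner ℝ ζ (x - z) : ℝ))) ?_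
    (isCompact_closedBall 0 R)
  have := continuous_besselSymbol d s
  simp only [Function.uncurry_def]
  fun_prop

theorem truncatedKernel_eq_zero {s : ℝ} {c : 𝓢(Eucl d, ℂ)} {r : ℝ}
    (hr : ∀ z, r < ‖z‖ → c z = 0) {R : ℝ} {x z : Eucl d} (hz : r < ‖z‖) :
    truncatedKernel s c R x z = 0 := by
  rw [truncatedKernel, hr z hz, zero_mul]

/-- Once frequencies are cut off at R, Fubini on compact sets turns the Bessel potential into an
integral of `f` against a continuous compactly supported kernel, to which `mem_limClosure_integral`
applies. -/
theorem integral_truncatedKernel_mul {s : ℝ} {c : 𝓢(Eucl d, ℂ)} {r : ℝ}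
    (hr : ∀ z, r < ‖z‖ → c z = 0) {R : ℝ} {x : Eucl d} {f : Eucl d → ℂ} (hf : Continuous f) :
    ∫ z, truncatedKernel s c R x z * f z = ∫ ζ in Metric.closedBall 0 R, besselSymbol d s ζ *
      Complex.exp (Complex.I * (2 * Real.pi * inner ℝ ζ x : ℝ)) * cutoffFourier c f ζ := by
  have hc := c.continuous
  have hm := continuous_besselSymbol d s
  have h := integral_swap_of_isCompact (f := fun ζ z => (besselSymbol d s ζ *
      Complex.exp (Complex.I * (2 * Real.pi * inner ℝ ζ x : ℝ))) *
      (c z * Complex.exp (Complex.I * (-(2 * Real.pi * inner ℝ ζ z) : ℝ)) * f z)) (by fun_prop)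
    (isCompact_closedBall 0 R) (isCompact_closedBall 0 r)
  simp only [integral_const_mul, ← cutoffFourier_eq_setIntegral hr] at h
  rw [h, ← setIntegral_eq_integral_of_forall_compl_eq_zero (s := Metric.closedBall 0 r)
    fun z hz => by rw [truncatedKernel_eq_zero hr (by simpa using hz), zero_mul]]
  refine integral_congr_ae (Eventually.of_forall fun z => ?_)
  simp only [truncatedKernel]
  rw [mul_right_comm, ← integral_const_mul]
  refine integral_congr_ae (Eventually.of_forall fun ζ => ?_)
  simp only
  rw [inner_sub_right, mul_sub, Complex.ofReal_sub, mul_sub, sub_eq_add_neg, Complex.exp_add,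
    Complex.ofReal_neg, mul_neg]
  ring

theorem tendsto_integral_truncatedKernel_mul {s : ℝ} {c : 𝓢(Eucl d, ℂ)} {r : ℝ}
    (hr : ∀ z, r < ‖z‖ → c z = 0) (x : Eucl d) {f : Eucl d → ℂ} (hf : Continuous f)
    (hi : Integrable fun ζ => besselSymbol d s ζ *
      Complex.exp (Complex.I * (2 * Real.pi * inner ℝ ζ x : ℝ)) * cutoffFourier c f ζ) :
    Tendsto (fun N : ℕ => ∫ z, truncatedKernel s c N x z * f z) atTop
      (𝓝 (besselApply s c f x)) := by
  simp only [integral_truncatedKernel_mul hr hf]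
  exact (aecover_closedBall tendsto_natCast_atTop_atTop).integral_tendsto_of_countably_generated hi

theorem integrable_besselKernel_integrand (s : ℝ) (u : 𝓢(Eucl d, ℂ)) (η x : Eucl d) :
    Integrable fun ζ => besselSymbol d s ζ *
      Complex.exp (Complex.I * (2 * Real.pi * inner ℝ ζ x : ℝ)) *
        u (ζ - (2 * Real.pi)⁻¹ • η) := by
  obtain ⟨C, hC0, hC⟩ := exists_norm_besselKernel_integrand_le s u
  refine (((integrable_one_add_norm_eucl d).comp_sub_right ((2 * Real.pi)⁻¹ • η)).const_mul
    (C * (1 + ‖η‖ ^ 2) ^ (s / 2))).mono' ?_ (Eventually.of_forall fun ζ => ?_)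
  · have h1 := continuous_besselSymbol d s
    have h2 := u.continuous
    exact Continuous.aestronglyMeasurable (by fun_prop)
  · have := hC η ζ
    rw [norm_mul] at this
    rwa [norm_mul, norm_mul, norm_exp_I_mul, mul_one]

end Localised

/-! ### Norms of spectral representatives -/

section ShiftKernel

variable {d : ℕ}

/-- The spectral representative of a functional of the solution at time `t` that maps
`exp (i ⟨η, ·⟩)` to `f η`, restricted to the frequencies in `A`. -/
def shiftKernel (A : Set (ℝ × Eucl d)) (t : ℝ≥0) (f : Eucl d → ℂ) : ℝ × Eucl d → ℂ :=
  A.indicator fun q => gammaKernel t q.1 ‖q.2‖ * f q.2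

theorem eLpNorm_two_le_of_support {α : Type*} [MeasurableSpace α] {μ : Measure α} {A : Set α}
    (hA : MeasurableSet A) {v : α → ℂ} {B : ℝ} (hB : ∀ a ∈ A, ‖v a‖ ≤ B) (h0 : ∀ a ∉ A, v a = 0) :
    eLpNorm v 2 μ ≤ ENNReal.ofReal B * μ A ^ (1 / 2 : ℝ) := by
  have h : eLpNorm v 2 μ ≤ eLpNorm (A.indicator fun _ => max B 0) 2 μ := by
    refine eLpNorm_mono fun a => ?_
    by_cases ha : a ∈ A
    · rw [Set.indicator_of_mem ha, Real.norm_of_nonneg (le_max_right _ _)]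
      exact (hB a ha).trans (le_max_left _ _)
    · simp [h0 a ha]
  refine h.trans_eq ?_
  rw [eLpNorm_indicator_const hA two_ne_zero ENNReal.ofNat_ne_top, ← ofReal_norm,
    Real.norm_of_nonneg (le_max_right _ _), ENNReal.ofReal_max]
  simp

theorem exists_sqrt_spectralMeasure_freqDomain_le (hd : 1 ≤ d) {H : Fin (d + 1) → ℝ}
    (hH : ∀ i, H i ∈ Set.Ioo (0 : ℝ) 1) :
    ∃ (C : ℝ) (K : ℕ), 0 ≤ C ∧ ∀ n,
      spectralMeasure H (freqDomain d n) ^ (1 / 2 : ℝ) ≤ ENNReal.ofReal (C * (2 ^ K) ^ n) := by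
  obtain ⟨C, K, hC, h⟩ := exists_spectralMeasure_freqDomain_le hd hH
  refine ⟨1 + C.toReal, K, by positivity, fun n => ?_⟩
  have h1 : (1 : ℝ) ≤ (2 ^ K) ^ n := one_le_pow₀ (one_le_pow₀ one_le_two)
  have h2 : spectralMeasure H (freqDomain d n) ≤
      ENNReal.ofReal ((1 + C.toReal) * (2 ^ K) ^ n) := by
    refine (h n).trans ?_
    rw [← ENNReal.ofReal_toReal hC.ne, ENNReal.toReal_ofReal ENNReal.toReal_nonneg]
    have e : ((2 : ℝ≥0∞) ^ K) ^ n = ENNReal.ofReal ((2 ^ K) ^ n) := by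
      rw [ENNReal.ofReal_pow (by positivity), ENNReal.ofReal_pow (by positivity)]; simp
    rw [e, ← ENNReal.ofReal_mul ENNReal.toReal_nonneg]
    gcongr
    linarith
  have h3 : 1 ≤ ENNReal.ofReal ((1 + C.toReal) * (2 ^ K) ^ n) := by
    rw [ENNReal.one_le_ofReal]
    nlinarith [ENNReal.toReal_nonneg (a := C)]
  calc _ ≤ ENNReal.ofReal ((1 + C.toReal) * (2 ^ K) ^ n) ^ (1 / 2 : ℝ) := by gcongr
    _ ≤ ENNReal.ofReal ((1 + C.toReal) * (2 ^ K) ^ n) ^ (1 : ℝ) :=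
        ENNReal.rpow_le_rpow_of_exponent_le h3 (by norm_num)
    _ = _ := ENNReal.rpow_one _

/-- A deliberately crude estimate: exponential growth in n is allowed, because the chaining only
interpolates a small power of it against the decay of the size. -/
theorem eLpNorm_shiftKernel_sub_le {ν : Measure (ℝ × Eucl d)} {A : Set (ℝ × Eucl d)} {n : ℕ}
    (hAm : MeasurableSet A) (hA : A ⊆ freqDomain d n) {t t' T : ℝ≥0} (ht : t ≤ T) (ht' : t' ≤ T) {f f' : Eucl d → ℂ}
    {B δ : ℝ} (hf : ∀ q ∈ A, ‖f q.2‖ ≤ B) (hff' : ∀ q ∈ A, ‖f q.2 - f' q.2‖ ≤ B * δ) :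
    eLpNorm (shiftKernel A t f - shiftKernel A t' f') 2 ν ≤
      ENNReal.ofReal ((1 + T) * 4 ^ n * B * (dist t t' + δ)) *
        ν (freqDomain d n) ^ (1 / 2 : ℝ) := by
  refine (eLpNorm_two_le_of_support hAm (B := (1 + T) * 4 ^ n * B * (dist t t' + δ))
    (fun q hqA => ?_) (fun q hq => ?_)).trans
    (mul_le_mul_right (ENNReal.rpow_le_rpow (measure_mono hA) (by norm_num)) _)
  · rw [Pi.sub_apply, shiftKernel, shiftKernel, Set.indicator_of_mem hqA,
      Set.indicator_of_mem hqA]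
    have e : gammaKernel t q.1 ‖q.2‖ * f q.2 - gammaKernel t' q.1 ‖q.2‖ * f' q.2 =
        (gammaKernel t q.1 ‖q.2‖ - gammaKernel t' q.1 ‖q.2‖) * f q.2 +
          gammaKernel t' q.1 ‖q.2‖ * (f q.2 - f' q.2) := by ring
    have h1 := norm_gammaKernel_sub_le (s := t') t.coe_nonneg
      (NNReal.coe_le_coe.mpr ht) q.1 ‖q.2‖
    have h2 := (norm_gammaKernel_le t'.coe_nonneg q.1 ‖q.2‖).trans (NNReal.coe_le_coe.mpr ht')
    have h3 := abs_fst_le_of_mem_freqDomain (hA hqA)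
    have h4 : (1 : ℝ) ≤ 4 ^ n := one_le_pow₀ (by norm_num)
    have h5 := hf q hqA
    have h6 := hff' q hqA
    have hT := T.coe_nonneg
    have hB : 0 ≤ B := (norm_nonneg _).trans h5
    rw [e, NNReal.dist_eq]
    refine (norm_add_le _ _).trans ?_
    rw [norm_mul, norm_mul]
    calc _ ≤ (1 + T * |q.1|) * |(t : ℝ) - t'| * B + T * (B * δ) := by gcongr
      _ ≤ (4 ^ n + T * 4 ^ n) * |(t : ℝ) - t'| * B + (1 + T) * 4 ^ n * (B * δ) := by
          have h7 : (T : ℝ) ≤ (1 + T) * 4 ^ n := by nlinarith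
          have h8 := (norm_nonneg _).trans h6
          gcongr
      _ = _ := by ring
  · rw [Pi.sub_apply, shiftKernel, shiftKernel, Set.indicator_of_notMem hq,
      Set.indicator_of_notMem hq, sub_zero]

/-- This gives the geometric smallness: the bound on γ_t and the decay (1 + |η|²)^{-α/2} of `f`
multiply to the resonance weight, whose integral over the shell is small. -/
theorem eLpNorm_shiftKernel_le {H : Fin (d + 1) → ℝ} {n : ℕ} {t T : ℝ≥0} (ht : t ≤ T)
    {f : Eucl d → ℂ} {α B I : ℝ} (hB : 0 ≤ B)
    (hf : ∀ η, ‖f η‖ ≤ B * (1 + ‖η‖ ^ 2) ^ (-α / 2))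
    (hI : ∫⁻ q in freqShell d n, ENNReal.ofReal (resonanceWeight 0 α q) ∂spectralMeasure H ≤
      ENNReal.ofReal (I ^ 2)) (hI0 : 0 ≤ I) :
    eLpNorm (shiftKernel (freqShell d n) t f) 2 (spectralMeasure H) ≤
      ENNReal.ofReal ((T + 2) * B * I) := by
  have hT := T.coe_nonneg
  have hpt : ∀ q, ‖shiftKernel (freqShell d n) t f q‖ₑ ^ 2 ≤ (freqShell d n).indicator
      (fun q => ENNReal.ofReal (((T + 2) * B) ^ 2) * ENNReal.ofReal (resonanceWeight 0 α q)) q :=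
    fun q => by
    by_cases hq : q ∈ freqShell d n
    · rw [shiftKernel, Set.indicator_of_mem hq, Set.indicator_of_mem hq, ← ofReal_norm,
        ← ENNReal.ofReal_pow (norm_nonneg _), ← ENNReal.ofReal_mul (by positivity)]
      refine ENNReal.ofReal_le_ofReal ?_
      rw [norm_mul, mul_pow]
      have h1 := norm_gammaKernel_sq_le t.coe_nonneg (NNReal.coe_le_coe.mpr ht) q.1 ‖q.2‖
      have h2 : ‖f q.2‖ ^ 2 ≤ B ^ 2 * (1 + ‖q.2‖ ^ 2) ^ (-α) := by
        calc ‖f q.2‖ ^ 2 ≤ (B * (1 + ‖q.2‖ ^ 2) ^ (-α / 2)) ^ 2 := by gcongr; exact hf _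
          _ = _ := by
            rw [mul_pow, ← Real.rpow_natCast (_ ^ _), ← Real.rpow_mul (by positivity)]
            congr 2; push_cast; ring
      calc _ ≤ ((T : ℝ) ^ 2 + 4) / (1 + (q.1 - ‖q.2‖ ^ 2) ^ 2) *
            (B ^ 2 * (1 + ‖q.2‖ ^ 2) ^ (-α)) := by gcongr
        _ ≤ ((T : ℝ) + 2) ^ 2 / (1 + (q.1 - ‖q.2‖ ^ 2) ^ 2) *
            (B ^ 2 * (1 + ‖q.2‖ ^ 2) ^ (-α)) := by gcongr; nlinarith
        _ = _ := by rw [resonanceWeight, Real.rpow_zero]; ring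
    · rw [shiftKernel, Set.indicator_of_notMem hq, Set.indicator_of_notMem hq]
      simp
  rw [eLpNorm_eq_lintegral_rpow_enorm_toReal two_ne_zero ENNReal.ofNat_ne_top]
  have h3 : ∫⁻ q, ‖shiftKernel (freqShell d n) t f q‖ₑ ^ (2 : ℝ≥0∞).toReal ∂spectralMeasure H ≤
      ENNReal.ofReal (((T + 2) * B * I) ^ 2) := by
    simp only [ENNReal.toReal_ofNat, ENNReal.rpow_ofNat]
    refine (lintegral_mono hpt).trans ?_
    rw [lintegral_indicator (measurableSet_freqShell d n), lintegral_const_mul _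
      (measurable_resonanceWeight 0 α).ennreal_ofReal, mul_pow _ I,
      ENNReal.ofReal_mul (by positivity)]
    gcongr
  refine (ENNReal.rpow_le_rpow h3 (by simp)).trans_eq ?_
  rw [ENNReal.ofReal_pow (by positivity)]
  simp only [ENNReal.toReal_ofNat, ← ENNReal.rpow_natCast, ← ENNReal.rpow_mul]
  norm_num

end ShiftKernel

/-! ### Bounds for Schwartz functions -/

section Schwartz

variable {d : ℕ}

theorem SchwartzMap.exists_weight_mul_norm_le (u : 𝓢(Eucl d, ℂ)) (M : ℕ) :
    ∃ B : ℝ, 0 ≤ B ∧ ∀ y, (1 + ‖y‖ ^ 2) ^ M * ‖u y‖ ≤ B := by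
  refine ⟨_, by positivity, fun y => le_trans ?_
    (SchwartzMap.one_add_le_sup_seminorm_apply (𝕜 := ℝ) (m := (2 * M, 0)) le_rfl le_rfl u y)⟩
  rw [norm_iteratedFDeriv_zero, pow_mul]
  gcongr
  nlinarith [norm_nonneg y]

theorem SchwartzMap.exists_norm_sub_le (u : 𝓢(Eucl d, ℂ)) :
    ∃ B : ℝ, 0 ≤ B ∧ ∀ y y', ‖u y - u y'‖ ≤ B * ‖y - y'‖ := by
  obtain ⟨C, hC⟩ := u.decay 0 1
  refine ⟨C, hC.1.le, fun y y' => ?_⟩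
  refine convex_univ.norm_image_sub_le_of_norm_fderiv_le (𝕜 := ℝ)
    (fun x _ => u.differentiableAt) (fun x _ => ?_) (Set.mem_univ _) (Set.mem_univ _)
  have := hC.2 x
  rwa [pow_zero, one_mul, norm_iteratedFDeriv_one] at this

/-- On D_n the shift is at most 2^n, so Schwartz decay in ζ survives with a constant depending on n.
It is applied at fixed n, where this loss does no harm. -/
theorem weight_mul_norm_shift_le {u : 𝓢(Eucl d, ℂ)} {M : ℕ} {B : ℝ}
    (hB : ∀ y, (1 + ‖y‖ ^ 2) ^ M * ‖u y‖ ≤ B) {n : ℕ} {q : ℝ × Eucl d} (hq : q ∈ freqDomain d n)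
    (ζ : Eucl d) :
    ‖u (ζ - (2 * Real.pi)⁻¹ • q.2)‖ ≤ (4 * 4 ^ n) ^ M * B * ((1 + ‖ζ‖ ^ 2) ^ M)⁻¹ := by
  rw [← div_eq_mul_inv, le_div_iff₀ (by positivity)]
  have h1 := one_add_norm_add_sq_le ((2 * Real.pi)⁻¹ • q.2) (ζ - (2 * Real.pi)⁻¹ • q.2)
  rw [add_sub_cancel] at h1
  have h2 : ‖(2 * Real.pi)⁻¹ • q.2‖ ≤ ‖q.2‖ := by
    rw [norm_smul, Real.norm_of_nonneg (by positivity)]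
    refine mul_le_of_le_one_left (norm_nonneg _) (inv_le_one_of_one_le₀ ?_)
    linarith [Real.pi_gt_three]
  have h3 := one_add_norm_sq_le_of_mem_freqDomain hq
  have h4 : 1 + ‖ζ‖ ^ 2 ≤ 4 * 4 ^ n * (1 + ‖ζ - (2 * Real.pi)⁻¹ • q.2‖ ^ 2) := by
    refine h1.trans ?_
    have : ‖(2 * Real.pi)⁻¹ • q.2‖ ^ 2 ≤ ‖q.2‖ ^ 2 := by gcongr
    exact mul_le_mul_of_nonneg_right (by linarith) (by positivity)
  calc _ ≤ ‖u (ζ - (2 * Real.pi)⁻¹ • q.2)‖ *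
        (4 * 4 ^ n * (1 + ‖ζ - (2 * Real.pi)⁻¹ • q.2‖ ^ 2)) ^ M := by gcongr
    _ = (4 * 4 ^ n) ^ M * ((1 + ‖ζ - (2 * Real.pi)⁻¹ • q.2‖ ^ 2) ^ M *
        ‖u (ζ - (2 * Real.pi)⁻¹ • q.2)‖) := by rw [mul_pow]; ring
    _ ≤ _ := by gcongr; exact hB _

end Schwartz

/-! ### The Fourier transform of the localised solution -/

section Localised

variable {d : ℕ} {H : Fin (d + 1) → ℝ} {Ω : Type*} [MeasurableSpace Ω] {P : Measure Ω}
  {Ψ : ℕ → ℝ≥0 → Eucl d → Ω → ℂ} {T : ℝ≥0}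

theorem ae_continuous_slice
    (hc : ∀ n, ∀ᵐ ω ∂P, Continuous fun q : Set.Icc (0 : ℝ≥0) T × Eucl d => Ψ n q.1 q.2 ω)
    (n : ℕ) (t : Set.Icc (0 : ℝ≥0) T) : ∀ᵐ ω ∂P, Continuous fun z => Ψ n t z ω := by
  filter_upwards [hc n] with ω hω
  exact hω.comp (by fun_prop : Continuous fun z : Eucl d => (t, z))

theorem mem_limClosure_cutoffFourier (hd : 1 ≤ d) (hH : ∀ i, H i ∈ Set.Ioo (0 : ℝ) 1)
    (hc : ∀ n, ∀ᵐ ω ∂P, Continuous fun q : Set.Icc (0 : ℝ≥0) T × Eucl d => Ψ n q.1 q.2 ω)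
    {c : 𝓢(Eucl d, ℂ)} {r : ℝ} (hr0 : 0 ≤ r) (hr : ∀ z, r < ‖z‖ → c z = 0)
    (n : ℕ) (t : Set.Icc (0 : ℝ≥0) T) (ζ : Eucl d) :
    ((fun ω => cutoffFourier c (fun z => Ψ n t z ω) ζ), shiftKernel (freqDomain d n) t
      fun η => (FourierTransform.fourier c : 𝓢(Eucl d, ℂ)) (ζ - (2 * Real.pi)⁻¹ • η)) ∈
      limClosure P (spectralMeasure H) (solSpan Ψ) := by
  have h := mem_limClosure_integral (Ψ := Ψ) hd hH (ae_continuous_slice hc n t)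
    (K := fun z => c z * Complex.exp (Complex.I * (-(2 * Real.pi * inner ℝ ζ z) : ℝ))) ?_ hr0
    (fun z hz => by rw [hr z hz, zero_mul])
  · have e : ∀ η, (∫ z, c z * Complex.exp (Complex.I * (-(2 * Real.pi * inner ℝ ζ z) : ℝ)) *
        Complex.exp (Complex.I * (inner ℝ η z : ℝ))) =
        (FourierTransform.fourier c : 𝓢(Eucl d, ℂ)) (ζ - (2 * Real.pi)⁻¹ • η) := fun η =>
      cutoffFourier_exp c η ζ
    simp only [intKernel, e] at h
    exact h
  · have h1 := c.continuous
    refine (c.integrable (μ := volume)).norm.mono'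
      (Continuous.aestronglyMeasurable (by fun_prop)) (Eventually.of_forall fun z => ?_)
    rw [norm_mul, norm_exp_I_mul, mul_one]

/-- For each `n`, the Fourier transform of the localised solution decays rapidly. -/
theorem ae_exists_cutoffFourier_bound (hd : 1 ≤ d) (hH : ∀ i, H i ∈ Set.Ioo (0 : ℝ) 1)
    (hΨ : IsLinearSolution H P Ψ)
    (hc : ∀ n, ∀ᵐ ω ∂P, Continuous fun q : Set.Icc (0 : ℝ≥0) T × Eucl d => Ψ n q.1 q.2 ω)
    {c : 𝓢(Eucl d, ℂ)} {r : ℝ} (hr0 : 0 ≤ r) (hr : ∀ z, r < ‖z‖ → c z = 0) (n M : ℕ) :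
    ∀ᵐ ω ∂P, ∃ C : ℝ, 0 ≤ C ∧ ∀ (t : Set.Icc (0 : ℝ≥0) T) (ζ : Eucl d),
      (1 + ‖ζ‖ ^ 2) ^ M * ‖cutoffFourier c (fun z => Ψ n t z ω) ζ‖ ≤ C * (1 + ‖ζ‖ ^ 2) := by
  set u : 𝓢(Eucl d, ℂ) := FourierTransform.fourier c with hu
  obtain ⟨B, hB0, hB⟩ := u.exists_weight_mul_norm_le M
  obtain ⟨B', hB'0, hB'⟩ := u.exists_norm_sub_le
  obtain ⟨B₂, hB₂0, hB₂⟩ := u.exists_weight_mul_norm_le 0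
  have hνlt := spectralMeasure_freqDomain_lt_top hd hH n
  set I : ℝ := (spectralMeasure H (freqDomain d n) ^ (1 / 2 : ℝ)).toReal with hI
  have hIe : spectralMeasure H (freqDomain d n) ^ (1 / 2 : ℝ) = ENNReal.ofReal I := by
    rw [hI, ENNReal.ofReal_toReal]
    exact (ENNReal.rpow_lt_top_of_nonneg (by norm_num) hνlt.ne).ne
  have hI0 : 0 ≤ I := ENNReal.toReal_nonneg
  set C₁ : ℝ := T * ((4 * 4 ^ n) ^ M * B) * I with hC₁
  set C₂ : ℝ := (1 + T) * 4 ^ n * (B₂ + B') * I with hC₂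
  have hC₁0 : 0 ≤ C₁ := by positivity
  have hC₂0 : 0 ≤ C₂ := by positivity
  have hMB : ∀ p ∈ limClosure P (spectralMeasure H) (solSpan Ψ),
      MomentBound P p.1 (eLpNorm p.2 2 (spectralMeasure H)) := fun p hp =>
    momentBound_of_mem_limClosure (fun _ => momentBound_of_mem_solSpan hd hH hΨ) hp
  have hmem := mem_limClosure_cutoffFourier hd hH hc hr0 hr n
  rw [← hu] at hmem
  -- A single field with ρ = 1: no smallness is sought, only the weighted bound in ζ, and κ = 1 is
  -- arbitrary.
  have key := ae_exists_weighted_bound (P := P) (ι := Unit) (T := T)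
    (X := fun _ t ζ ω => cutoffFourier c (fun z => Ψ n t z ω) ζ) (fun _ => by
      filter_upwards [hc n] with ω hω
      exact continuous_cutoffFourier hr (f := fun (t : Set.Icc (0 : ℝ≥0) T) z => Ψ n t z ω) hω)
    (ρ := fun _ => 1) (fun _ => le_rfl) (Q := 0) (by simp) (C := C₁ + C₂) (κ := 1) (K := 0)
    (by positivity) one_pos le_rfl M (fun _ t ζ => ?_) (fun _ t t' ζ ζ' => ?_)
  · filter_upwards [key] with ω hω
    obtain ⟨C, hC0, hC⟩ := hω
    exact ⟨C, hC0, fun t ζ => by simpa using hC () t ζ⟩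
  · refine (hMB _ (hmem t ζ)).mono ?_
    refine (eLpNorm_two_le_of_support (measurableSet_freqDomain d n)
      (B := T * ((4 * 4 ^ n) ^ M * B * ((1 + ‖ζ‖ ^ 2) ^ M)⁻¹)) (fun q hq => ?_) (fun q hq => ?_)).trans
      ?_
    · dsimp only
      rw [shiftKernel, Set.indicator_of_mem hq, norm_mul]
      gcongr
      · exact (norm_gammaKernel_le t.1.coe_nonneg _ _).trans (NNReal.coe_le_coe.mpr t.2.2)
      · exact weight_mul_norm_shift_le hB hq ζ
    · dsimp only
      rw [shiftKernel, Set.indicator_of_notMem hq]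
    · rw [hIe, ← ENNReal.ofReal_mul (by positivity)]
      apply ENNReal.ofReal_le_ofReal
      rw [Real.one_rpow, mul_one]
      calc _ = C₁ * ((1 + ‖ζ‖ ^ 2) ^ M)⁻¹ := by rw [hC₁]; ring
        _ ≤ _ := by gcongr; linarith
  · have h := hMB _ (Submodule.sub_mem _ (hmem t ζ) (hmem t' ζ'))
    refine (h.congr (Eventually.of_forall fun ω => rfl)).mono ?_
    refine (eLpNorm_shiftKernel_sub_le (measurableSet_freqDomain d n) subset_rfl (T := T)
      t.2.2 t'.2.2 (B := B₂ + B') (δ := ‖ζ - ζ'‖) (fun q _ => ?_) (fun q _ => ?_)).trans ?_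
    · have := hB₂ (ζ - (2 * Real.pi)⁻¹ • q.2)
      rw [pow_zero, one_mul] at this
      linarith
    · refine (hB' _ _).trans ?_
      rw [sub_sub_sub_cancel_right]
      gcongr
      linarith
    · rw [hIe, ← ENNReal.ofReal_mul (by positivity)]
      apply ENNReal.ofReal_le_ofReal
      rw [Real.one_rpow, mul_one, Subtype.dist_eq]
      calc _ = C₂ * (dist (t : ℝ≥0) t' + ‖ζ - ζ'‖) := by rw [hC₂]; ring
        _ ≤ _ := by gcongr; linarith

/-! ### The Bessel potential of the localised solution -/

/-- A number of weights that suffices to absorb the symbol of `(Id - Δ)^{s/2}`. -/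
def decayOrder (d : ℕ) (s : ℝ) : ℕ := ⌈|s / 2|⌉₊ + d + 2

/-- Of the weights in `decayOrder`, one cancels the factor on the right of the hypothesis, ⌈|s/2|⌉
absorb the symbol and d + 1 make the product integrable. -/
theorem exists_norm_besselSymbol_mul_le (d : ℕ) (s : ℝ) :
    ∃ K : ℝ, 0 ≤ K ∧ ∀ (C : ℝ) (y : Eucl d → ℂ),
      (∀ ζ, (1 + ‖ζ‖ ^ 2) ^ decayOrder d s * ‖y ζ‖ ≤ C * (1 + ‖ζ‖ ^ 2)) →
      ∀ ζ, ‖besselSymbol d s ζ‖ * ‖y ζ‖ ≤ K * C * (1 + ‖ζ‖) ^ (-((d : ℝ) + 1)) := by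
  set m := ⌈|s / 2|⌉₊ with hm
  refine ⟨64 ^ m * 2 ^ (d + 1), by positivity, fun C y hy ζ => ?_⟩
  have hζ : 0 < 1 + ‖ζ‖ ^ 2 := by positivity
  have h1 : (1 + ‖ζ‖ ^ 2) ^ (m + d + 1) * ‖y ζ‖ ≤ C := by
    have := hy ζ
    rw [decayOrder, ← hm, show m + d + 2 = m + d + 1 + 1 by ring, pow_succ, mul_right_comm] at this
    exact le_of_mul_le_mul_right this hζ
  have h2 : ‖besselSymbol d s ζ‖ ≤ (64 * (1 + ‖ζ‖ ^ 2)) ^ m := by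
    rw [norm_besselSymbol]
    have h3 : 1 + ‖(2 * Real.pi) • ζ‖ ^ 2 ≤ 64 * (1 + ‖ζ‖ ^ 2) := by
      rw [norm_smul, Real.norm_of_nonneg (by positivity)]
      have := Real.pi_le_four
      have := Real.pi_pos
      have : (2 * Real.pi * ‖ζ‖) ^ 2 ≤ (8 * ‖ζ‖) ^ 2 := by gcongr; linarith
      nlinarith [norm_nonneg ζ]
    calc _ ≤ (1 + ‖(2 * Real.pi) • ζ‖ ^ 2) ^ (m : ℝ) := by
          apply Real.rpow_le_rpow_of_exponent_le
          · nlinarith [sq_nonneg ‖(2 * Real.pi) • ζ‖]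
          · exact (le_abs_self _).trans (Nat.le_ceil _)
      _ = (1 + ‖(2 * Real.pi) • ζ‖ ^ 2) ^ m := Real.rpow_natCast _ _
      _ ≤ _ := by gcongr
  have e : (1 + ‖ζ‖) ^ ((d : ℝ) + 1) = (1 + ‖ζ‖) ^ (d + 1) := by
    rw [← Real.rpow_natCast]; push_cast; rfl
  have h4 : (1 + ‖ζ‖) ^ (d + 1) ≤ (2 * (1 + ‖ζ‖ ^ 2)) ^ (d + 1) := by
    gcongr
    nlinarith [sq_nonneg (‖ζ‖ - 1), sq_nonneg ‖ζ‖]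
  rw [Real.rpow_neg (by positivity), e, ← div_eq_mul_inv, le_div_iff₀ (by positivity)]
  calc _ ≤ (64 * (1 + ‖ζ‖ ^ 2)) ^ m * ‖y ζ‖ * (2 * (1 + ‖ζ‖ ^ 2)) ^ (d + 1) := by gcongr
    _ = 64 ^ m * 2 ^ (d + 1) * ((1 + ‖ζ‖ ^ 2) ^ (m + d + 1) * ‖y ζ‖) := by
        rw [mul_pow, mul_pow]; ring
    _ ≤ _ := by gcongr

/-- The paths for which `besselApply s` is defined by convergent integrals. -/
structure HasCutoffDecay (s : ℝ) (c : 𝓢(Eucl d, ℂ)) {A : Type*} [TopologicalSpace A]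
    (f : A → Eucl d → ℂ) : Prop where
  continuous : Continuous fun q : A × Eucl d => f q.1 q.2
  decay : ∃ C : ℝ, ∀ t ζ, (1 + ‖ζ‖ ^ 2) ^ decayOrder d s * ‖cutoffFourier c (f t) ζ‖ ≤
    C * (1 + ‖ζ‖ ^ 2)

namespace HasCutoffDecay

variable {s : ℝ} {c : 𝓢(Eucl d, ℂ)} {A : Type*} [TopologicalSpace A] {f : A → Eucl d → ℂ}

theorem exists_norm_le (h : HasCutoffDecay s c f) :
    ∃ C : ℝ, ∀ (t : A) (x ζ : Eucl d), ‖besselSymbol d s ζ *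
      Complex.exp (Complex.I * (2 * Real.pi * inner ℝ ζ x : ℝ)) * cutoffFourier c (f t) ζ‖ ≤
        C * (1 + ‖ζ‖) ^ (-((d : ℝ) + 1)) := by
  obtain ⟨C, hC⟩ := h.decay
  obtain ⟨K, hK0, hK⟩ := exists_norm_besselSymbol_mul_le d s
  refine ⟨K * C, fun t x ζ => ?_⟩
  rw [norm_mul, norm_mul, norm_exp_I_mul, mul_one]
  exact hK C _ (hC t) ζ

theorem continuous_slice (h : HasCutoffDecay s c f) (t : A) : Continuous (f t) :=
  h.continuous.comp (by fun_prop : Continuous fun z : Eucl d => (t, z))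

variable [FirstCountableTopology A] [LocallyCompactSpace A] {r : ℝ}

theorem integrable (h : HasCutoffDecay s c f) (hr : ∀ z, r < ‖z‖ → c z = 0) (t : A)
    (x : Eucl d) : Integrable fun ζ => besselSymbol d s ζ *
      Complex.exp (Complex.I * (2 * Real.pi * inner ℝ ζ x : ℝ)) * cutoffFourier c (f t) ζ := by
  obtain ⟨C, hC⟩ := h.exists_norm_le
  refine ((integrable_one_add_norm_eucl d).const_mul C).mono' ?_
    (Eventually.of_forall fun ζ => hC t x ζ)
  have h1 := continuous_besselSymbol d s
  have h0 := continuous_cutoffFourier hr h.continuous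
  have h3 : Continuous fun ζ : Eucl d => (t, ζ) := by fun_prop
  have h2 := h0.comp h3
  simp only [Function.comp_def] at h2
  exact Continuous.aestronglyMeasurable (by fun_prop)

theorem continuous_besselApply (h : HasCutoffDecay s c f) (hr : ∀ z, r < ‖z‖ → c z = 0) :
    Continuous fun q : A × Eucl d => besselApply s c (f q.1) q.2 := by
  obtain ⟨C, hC⟩ := h.exists_norm_le
  refine continuous_of_dominated (fun q => (h.integrable hr q.1 q.2).1)
    (fun q => Eventually.of_forall fun ζ => hC q.1 q.2 ζ)
    ((integrable_one_add_norm_eucl d).const_mul C) (Eventually.of_forall fun ζ => ?_)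
  have h0 := continuous_cutoffFourier hr h.continuous
  have h3 : Continuous fun q : A × Eucl d => (q.1, ζ) := by fun_prop
  have h2 := h0.comp h3
  simp only [Function.comp_def] at h2
  fun_prop

end HasCutoffDecay

theorem ae_hasCutoffDecay (hd : 1 ≤ d) (hH : ∀ i, H i ∈ Set.Ioo (0 : ℝ) 1)
    (hΨ : IsLinearSolution H P Ψ)
    (hc : ∀ n, ∀ᵐ ω ∂P, Continuous fun q : Set.Icc (0 : ℝ≥0) T × Eucl d => Ψ n q.1 q.2 ω)
    {c : 𝓢(Eucl d, ℂ)} {r : ℝ} (hr0 : 0 ≤ r) (hr : ∀ z, r < ‖z‖ → c z = 0) (s : ℝ) :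
    ∀ᵐ ω ∂P, ∀ n, HasCutoffDecay s c fun (t : Set.Icc (0 : ℝ≥0) T) z => Ψ n t z ω := by
  rw [ae_all_iff]
  intro n
  filter_upwards [hc n, ae_exists_cutoffFourier_bound hd hH hΨ hc hr0 hr n (decayOrder d s)]
    with ω h1 ⟨C, _, hC⟩
  exact ⟨h1, C, hC⟩

/-- The truncations |ζ| ≤ N converge along almost every path by the decay of the Fourier transform
at fixed n. Their kernels converge pointwise and stay bounded on D_n, hence converge in L². -/
theorem mem_solSpace_besselApply (hd : 1 ≤ d) (hH : ∀ i, H i ∈ Set.Ioo (0 : ℝ) 1)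
    (hΨ : IsLinearSolution H P Ψ)
    (hc : ∀ n, ∀ᵐ ω ∂P, Continuous fun q : Set.Icc (0 : ℝ≥0) T × Eucl d => Ψ n q.1 q.2 ω)
    {c : 𝓢(Eucl d, ℂ)} {r : ℝ} (hr0 : 0 ≤ r) (hr : ∀ z, r < ‖z‖ → c z = 0) (s : ℝ)
    (n : ℕ) (t : Set.Icc (0 : ℝ≥0) T) (x : Eucl d) :
    ((fun ω => besselApply s c (fun z => Ψ n t z ω) x), shiftKernel (freqDomain d n) t
      fun η => besselKernel s (FourierTransform.fourier c) η x) ∈ solSpace P H Ψ := by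
  set u : 𝓢(Eucl d, ℂ) := FourierTransform.fourier c with hu
  obtain ⟨C, hC0, hC⟩ := exists_norm_besselKernel_integrand_le s u
  set J : ℝ := ∫ ζ : Eucl d, (1 + ‖ζ‖) ^ (-((d : ℝ) + 1)) with hJ
  have hmem : ∀ N : ℕ, ((fun ω => ∫ z, truncatedKernel s c N x z * Ψ n t z ω),
      intKernel n t (truncatedKernel s c N x)) ∈ limClosure P (spectralMeasure H) (solSpan Ψ) :=
    fun N => mem_limClosure_integral hd hH (ae_continuous_slice hc n t)
      ((continuous_truncatedKernel s c N x).integrable_of_hasCompactSupport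
        (HasCompactSupport.of_support_subset_isCompact (isCompact_closedBall 0 r) fun z hz => by
          by_contra h
          exact hz (truncatedKernel_eq_zero hr (by simpa using h)))) hr0
      fun z hz => truncatedKernel_eq_zero hr hz
  have hker : ∀ (N : ℕ) (η : Eucl d), ∫ z, truncatedKernel s c N x z *
      Complex.exp (Complex.I * (inner ℝ η z : ℝ)) = ∫ ζ in Metric.closedBall 0 (N : ℝ),
        besselSymbol d s ζ * Complex.exp (Complex.I * (2 * Real.pi * inner ℝ ζ x : ℝ)) *
          u (ζ - (2 * Real.pi)⁻¹ • η) := fun N η => by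
    rw [integral_truncatedKernel_mul hr (by fun_prop)]
    simp only [cutoffFourier_exp]
    rfl
  have hlim : ∀ q, Tendsto (fun N : ℕ => intKernel n t (truncatedKernel s c N x) q) atTop
      (𝓝 (shiftKernel (freqDomain d n) t (fun η => besselKernel s u η x) q)) := fun q => by
    simp only [intKernel, shiftKernel]
    by_cases hq : q ∈ freqDomain d n
    · simp only [Set.indicator_of_mem hq, hker]
      refine tendsto_const_nhds.mul ?_
      exact (aecover_closedBall tendsto_natCast_atTop_atTop).integral_tendsto_of_countably_generated
        (integrable_besselKernel_integrand s u q.2 x)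
    · simp only [Set.indicator_of_notMem hq]
      exact tendsto_const_nhds
  have hbd : ∀ (N : ℕ), ∀ q ∈ freqDomain d n, ‖intKernel n t (truncatedKernel s c N x) q‖ ≤
      T * (C * (2 * 4 ^ n) ^ |s / 2| * J) := fun N q hq => by
    rw [intKernel, Set.indicator_of_mem hq, norm_mul, hker]
    gcongr
    · exact (norm_gammaKernel_le t.1.coe_nonneg _ _).trans (NNReal.coe_le_coe.mpr t.2.2)
    · refine (norm_integral_le_integral_norm _).trans ?_
      refine (setIntegral_le_integral (integrable_besselKernel_integrand s u q.2 x).norm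
        (Eventually.of_forall fun _ => norm_nonneg _)).trans ?_
      have hle : ∀ ζ, ‖besselSymbol d s ζ *
          Complex.exp (Complex.I * (2 * Real.pi * inner ℝ ζ x : ℝ)) *
          u (ζ - (2 * Real.pi)⁻¹ • q.2)‖ ≤ C * (1 + ‖q.2‖ ^ 2) ^ (s / 2) *
          (1 + ‖ζ - (2 * Real.pi)⁻¹ • q.2‖) ^ (-((d : ℝ) + 1)) := fun ζ => by
        have := hC q.2 ζ
        rw [norm_mul] at this
        rwa [norm_mul, norm_mul, norm_exp_I_mul, mul_one]
      refine (integral_mono (integrable_besselKernel_integrand s u q.2 x).norm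
        (((integrable_one_add_norm_eucl d).comp_sub_right _).const_mul _) hle).trans ?_
      rw [integral_const_mul, integral_sub_right_eq_self
        (fun ζ : Eucl d => (1 + ‖ζ‖) ^ (-((d : ℝ) + 1))), ← hJ]
      have hJ0 : 0 ≤ J := integral_nonneg fun ζ => by positivity
      gcongr
      refine (Real.rpow_le_rpow_of_exponent_le (by nlinarith [sq_nonneg ‖q.2‖])
        (le_abs_self _)).trans ?_
      exact Real.rpow_le_rpow (by positivity) (one_add_norm_sq_le_of_mem_freqDomain hq)
        (abs_nonneg _)
  have hsm := fun N => (hmem N).1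
  have hvm : AEStronglyMeasurable
      (shiftKernel (freqDomain d n) t fun η => besselKernel s u η x) (spectralMeasure H) :=
    aestronglyMeasurable_of_tendsto_ae atTop hsm (Eventually.of_forall hlim)
  refine ⟨hvm, _, hmem, hsm, ?_, ?_⟩
  · filter_upwards [ae_hasCutoffDecay hd hH hΨ hc hr0 hr s] with ω hω
    exact tendsto_integral_truncatedKernel_mul hr x ((hω n).continuous_slice t)
      ((hω n).integrable hr t x)
  · exact tendsto_eLpNorm_two_of_bounded (measurableSet_freqDomain d n)
      (spectralMeasure_freqDomain_lt_top hd hH n) hsm hvm hbd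
      (fun N q hq => by dsimp only; rw [intKernel, Set.indicator_of_notMem hq]) hlim

end Localised

/-! ### Decay of the increments of the localised solutions -/

/-- The increments of a sequence, starting from `0`. -/
def increment {E : Type*} [AddCommGroup E] (g : ℕ → E) : ℕ → E
  | 0 => g 0
  | n + 1 => g (n + 1) - g n

theorem sum_range_increment {E : Type*} [AddCommGroup E] (g : ℕ → E) (n : ℕ) :
    ∑ k ∈ Finset.range (n + 1), increment g k = g n := by
  induction n with
  | zero => simp [increment]
  | succ n ih => rw [Finset.sum_range_succ, ih, increment]; abel

section Increments

variable {d : ℕ} {H : Fin (d + 1) → ℝ} {Ω : Type*} [MeasurableSpace Ω] {P : Measure Ω}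
  {Ψ : ℕ → ℝ≥0 → Eucl d → Ω → ℂ} {T : ℝ≥0}

/-- The increments of the Bessel potentials of the localised solutions. -/
def besselIncrement (s : ℝ) (c : 𝓢(Eucl d, ℂ)) (Ψ : ℕ → ℝ≥0 → Eucl d → Ω → ℂ) (n : ℕ) (t : ℝ≥0)
    (x : Eucl d) (ω : Ω) : ℂ :=
  increment (fun n => besselApply s c (fun z => Ψ n t z ω) x) n

theorem mem_solSpace_besselIncrement (hd : 1 ≤ d) (hH : ∀ i, H i ∈ Set.Ioo (0 : ℝ) 1)
    (hΨ : IsLinearSolution H P Ψ)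
    (hc : ∀ n, ∀ᵐ ω ∂P, Continuous fun q : Set.Icc (0 : ℝ≥0) T × Eucl d => Ψ n q.1 q.2 ω)
    {c : 𝓢(Eucl d, ℂ)} {r : ℝ} (hr0 : 0 ≤ r) (hr : ∀ z, r < ‖z‖ → c z = 0) (s : ℝ)
    (n : ℕ) (t : Set.Icc (0 : ℝ≥0) T) (x : Eucl d) :
    (besselIncrement s c Ψ n t x, shiftKernel (freqShell d n) t
      fun η => besselKernel s (FourierTransform.fourier c) η x) ∈ solSpace P H Ψ := by
  have h := fun n => mem_solSpace_besselApply hd hH hΨ hc hr0 hr s n t x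
  cases n with
  | zero =>
    have h0 := h 0
    -- Both sets are empty: D_0 is, and n - 1 is truncated to 0.
    have e : freqShell d 0 = freqDomain d 0 := by simp [freqShell, freqDomain_zero]
    rw [e]
    exact h0
  | succ n =>
    have h1 := Submodule.sub_mem _ (h (n + 1)) (h n)
    convert! h1 using 1
    refine Prod.ext rfl ?_
    funext q
    simp only [Prod.snd_sub, Pi.sub_apply, shiftKernel, freqShell, Nat.add_sub_cancel]
    by_cases hq : q ∈ freqDomain d n
    · have hq' := freqDomain_mono d (Nat.le_succ n) hq
      simp only [Nat.succ_eq_add_one] at hq'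
      rw [Set.indicator_of_mem hq, Set.indicator_of_mem hq',
        Set.indicator_of_notMem fun h => h.2 hq, sub_self]
    · rw [Set.indicator_of_notMem hq, sub_zero]
      by_cases hq' : q ∈ freqDomain d (n + 1)
      · rw [Set.indicator_of_mem hq', Set.indicator_of_mem (Set.mem_sdiff_of_mem hq' hq)]
      · rw [Set.indicator_of_notMem hq', Set.indicator_of_notMem fun h => hq' h.1]

/-- The increments of the Bessel potentials of the localised solutions are geometrically small,
uniformly in time and with a polynomial weight in space. -/
theorem ae_exists_besselIncrement_bound (hd : 1 ≤ d) (hH : ∀ i, H i ∈ Set.Ioo (0 : ℝ) 1)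
    (hΨ : IsLinearSolution H P Ψ)
    (hc : ∀ n, ∀ᵐ ω ∂P, Continuous fun q : Set.Icc (0 : ℝ≥0) T × Eucl d => Ψ n q.1 q.2 ω)
    {c : 𝓢(Eucl d, ℂ)} {r : ℝ} (hr0 : 0 ≤ r) (hr : ∀ z, r < ‖z‖ → c z = 0) {α : ℝ}
    (hα : α > d + 1 - (2 * H 0 + ∑ i : Fin d, H i.succ)) (N : ℕ) :
    ∃ θ : ℝ, 0 < θ ∧ θ < 1 ∧ ∀ᵐ ω ∂P, ∃ C : ℝ, 0 ≤ C ∧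
      ∀ (n : ℕ) (t : Set.Icc (0 : ℝ≥0) T) (x : Eucl d),
        (1 + ‖x‖ ^ 2) ^ N * ‖besselIncrement (-α) c Ψ n t x ω‖ ≤
          C * θ ^ n * (1 + ‖x‖ ^ 2) := by
  set u : 𝓢(Eucl d, ℂ) := FourierTransform.fourier c with hu
  obtain ⟨I, κ, hI0, hκ0, hI⟩ := exists_setLIntegral_freqShell_le hd hH hα
  obtain ⟨B, hB0, hB⟩ := exists_weight_mul_norm_besselKernel_le (-α) u N
  obtain ⟨B₁, hB₁0, hB₁⟩ := exists_weight_mul_norm_besselKernel_le (-α) u 0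
  obtain ⟨B₂, hB₂0, hB₂⟩ := exists_norm_besselKernel_sub_le (-α) u
  obtain ⟨D, L, hD0, hD⟩ := exists_sqrt_spectralMeasure_freqDomain_le hd hH
  -- One integer bounding the exponents of 1 + |η|² in both the size and the Lipschitz estimate of
  -- the kernel.
  obtain ⟨m, hm⟩ := exists_nat_ge (max |(-α) / 2| |((-α) + 1) / 2|)
  have hm1 := (le_max_left _ _).trans hm
  have hm2 := (le_max_right _ _).trans hm
  have hpow : ∀ {a : ℝ}, |a| ≤ m → ∀ n, ∀ q ∈ freqDomain d n,
      (1 + ‖q.2‖ ^ 2) ^ a ≤ 2 ^ m * (4 ^ m) ^ n := fun {a} ha n q hq => by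
    calc (1 + ‖q.2‖ ^ 2) ^ a ≤ (1 + ‖q.2‖ ^ 2) ^ (m : ℝ) :=
          Real.rpow_le_rpow_of_exponent_le (by nlinarith [sq_nonneg ‖q.2‖])
            ((le_abs_self _).trans ha)
      _ = (1 + ‖q.2‖ ^ 2) ^ m := Real.rpow_natCast _ _
      _ ≤ (2 * 4 ^ n) ^ m := by gcongr; exact one_add_norm_sq_le_of_mem_freqDomain hq
      _ = _ := by rw [mul_pow, ← pow_mul, ← pow_mul, mul_comm n m]
  set C₁ : ℝ := (T + 2) * B * Real.sqrt I with hC₁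
  set C₂ : ℝ := (1 + T) * ((B₁ + B₂) * 2 ^ m) * D with hC₂
  have hT := T.coe_nonneg
  have hC₁0 : 0 ≤ C₁ := by positivity
  have hC₂0 : 0 ≤ C₂ := by positivity
  -- Growth in 2^n of the Lipschitz constant: 2 from the time regularity of γ, 2m from the kernel in
  -- η, and L from the mass of D_n.
  set K : ℕ := 2 + 2 * m + L with hK
  have hmem := fun n t x => mem_solSpace_besselIncrement (T := T) hd hH hΨ hc hr0 hr (-α) n t x
  rw [← hu] at hmem
  have hsub : ∀ n, freqShell d n ⊆ freqDomain d n := fun n => Set.sdiff_subset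
  have hrpow : ∀ (n : ℕ) (a : ℝ), ((2 : ℝ) ^ n) ^ a = 2 ^ (n * a) := fun n a => by
    rw [← Real.rpow_natCast, ← Real.rpow_mul two_pos.le]
  have hcont : ∀ n, ∀ᵐ ω ∂P, Continuous fun q : Set.Icc (0 : ℝ≥0) T × Eucl d =>
      besselIncrement (-α) c Ψ n q.1 q.2 ω := by
    intro n
    filter_upwards [ae_hasCutoffDecay (T := T) hd hH hΨ hc hr0 hr (-α)] with ω hω
    cases n with
    | zero => exact (hω 0).continuous_besselApply hr
    | succ n =>
      exact ((hω (n + 1)).continuous_besselApply hr).sub ((hω n).continuous_besselApply hr)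
  have key := ae_exists_weighted_bound (P := P) (ι := ℕ) (T := T)
    (X := fun n t x ω => besselIncrement (-α) c Ψ n t x ω) hcont
    (ρ := fun n => 2 ^ n) (fun n => one_le_pow₀ one_le_two) (Q := 1) ?_ (C := C₁ + C₂) (κ := κ)
    (K := K) (by positivity) hκ0 (by positivity) N (fun n t x => ?_) (fun n t t' x x' => ?_)
  · refine ⟨2 ^ (-(κ / 2)), by positivity,
      Real.rpow_lt_one_of_one_lt_of_neg one_lt_two (by linarith), ?_⟩
    filter_upwards [key] with ω ⟨C, hC0, hC⟩
    refine ⟨C, hC0, fun n t x => (hC n t x).trans_eq ?_⟩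
    rw [hrpow, ← Real.rpow_natCast (2 ^ (-(κ / 2))) n, ← Real.rpow_mul two_pos.le,
      mul_comm (n : ℝ)]
  · have e : ∀ n : ℕ, ENNReal.ofReal (((2 : ℝ) ^ n) ^ (-((1 : ℕ) : ℝ))) =
        (2⁻¹ : ℝ≥0∞) ^ n := fun n => by
      rw [Nat.cast_one, Real.rpow_neg_one, ← inv_pow, ENNReal.ofReal_pow (by norm_num),
        ENNReal.ofReal_inv_of_pos two_pos, ENNReal.ofReal_ofNat]
    simp only [e]
    rw [ENNReal.tsum_geometric]
    simp
  · refine (momentBound_of_mem_solSpace hd hH hΨ (hmem n t x)).mono ?_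
    refine (eLpNorm_shiftKernel_le (T := T) t.2.2 (B := B * ((1 + ‖x‖ ^ 2) ^ N)⁻¹)
      (α := α) (by positivity) (fun η => ?_) (I := Real.sqrt I * 2 ^ (-(κ * n))) ?_
      (by positivity)).trans ?_
    · have := hB η x
      rw [mul_right_comm, ← div_eq_mul_inv, le_div_iff₀ (by positivity)]
      linarith
    · refine (hI n).trans_eq ?_
      rw [mul_pow, Real.sq_sqrt hI0, ← Real.rpow_natCast (_ ^ _), ← Real.rpow_mul two_pos.le]
      congr 3
      push_cast
      ring
    · apply ENNReal.ofReal_le_ofReal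
      rw [hrpow]
      calc _ = C₁ * 2 ^ (-(κ * n)) * ((1 + ‖x‖ ^ 2) ^ N)⁻¹ := by rw [hC₁]; ring
        _ ≤ (C₁ + C₂) * 2 ^ (-(κ * n)) * ((1 + ‖x‖ ^ 2) ^ N)⁻¹ := by gcongr; linarith
        _ = _ := by rw [mul_neg, mul_comm κ]
  · have h := momentBound_of_mem_solSpace hd hH hΨ
      (Submodule.sub_mem _ (hmem n t x) (hmem n t' x'))
    refine (h.congr (Eventually.of_forall fun ω => rfl)).mono ?_
    refine (eLpNorm_shiftKernel_sub_le (measurableSet_freqShell d n) (hsub n) (T := T)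
      t.2.2 t'.2.2 (B := (B₁ + B₂) * (2 ^ m * (4 ^ m) ^ n)) (δ := ‖x - x'‖)
      (fun q hq => ?_) (fun q hq => ?_)).trans ?_
    · have h1 := hB₁ q.2 x
      rw [pow_zero, one_mul] at h1
      refine h1.trans ?_
      have h2 := hpow hm1 n q (hsub n hq)
      gcongr
      linarith
    · refine (hB₂ q.2 x x').trans ?_
      have h2 := hpow hm2 n q (hsub n hq)
      gcongr
      linarith
    · refine (mul_le_mul_right (hD n) _).trans ?_
      rw [← ENNReal.ofReal_mul (by positivity)]
      apply ENNReal.ofReal_le_ofReal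
      have e : ((2 : ℝ) ^ n) ^ (K : ℝ) = 4 ^ n * (4 ^ m) ^ n * (2 ^ L) ^ n := by
        rw [Real.rpow_natCast, hK, ← mul_pow, ← mul_pow, ← pow_mul, mul_comm n, pow_mul]
        congr 1
        rw [pow_add, pow_add, pow_mul]
        norm_num
      rw [e, Subtype.dist_eq]
      calc _ = C₂ * (4 ^ n * (4 ^ m) ^ n * (2 ^ L) ^ n) *
            (dist (t : ℝ≥0) t' + ‖x - x'‖) := by rw [hC₂]; ring
        _ ≤ _ := by gcongr; linarith

end Increments

/-! ### Functions with polynomial decay in `L^p` -/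

section WeightedLp

variable {d : ℕ}

/-- A polynomially decaying weight that belongs to all `L^p`. -/
def decayWeight (d : ℕ) (x : Eucl d) : ℝ := ((1 + ‖x‖ ^ 2) ^ (d + 1))⁻¹

theorem decayWeight_pos (x : Eucl d) : 0 < decayWeight d x := by
  rw [decayWeight]; positivity

theorem decayWeight_le_one (x : Eucl d) : decayWeight d x ≤ 1 :=
  inv_le_one_of_one_le₀ (one_le_pow₀ (by nlinarith [sq_nonneg ‖x‖]))

theorem continuous_decayWeight (d : ℕ) : Continuous (decayWeight d) := by
  have : ∀ x : Eucl d, (1 + ‖x‖ ^ 2) ^ (d + 1) ≠ 0 := fun x => by positivity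
  exact Continuous.inv₀ (by fun_prop) this

theorem integrable_decayWeight (d : ℕ) : Integrable (decayWeight d) := by
  refine ((integrable_one_add_norm_eucl d).const_mul (2 ^ (d + 1))).mono'
    (continuous_decayWeight d).aestronglyMeasurable (Eventually.of_forall fun x => ?_)
  have e : (1 + ‖x‖) ^ ((d : ℝ) + 1) = (1 + ‖x‖) ^ (d + 1) := by
    rw [← Real.rpow_natCast]; push_cast; rfl
  rw [Real.norm_of_nonneg (decayWeight_pos x).le, Real.rpow_neg (by positivity), e, decayWeight,
    ← div_eq_mul_inv, inv_le_comm₀ (by positivity) (by positivity), inv_div,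
    div_le_iff₀ (by positivity), ← mul_pow]
  gcongr
  nlinarith [sq_nonneg (‖x‖ - 1), sq_nonneg ‖x‖]

theorem memLp_decayWeight (d : ℕ) {p : ℝ≥0∞} (hp : 1 ≤ p) : MemLp (decayWeight d) p volume := by
  have hm := (continuous_decayWeight d).aestronglyMeasurable (μ := volume)
  by_cases htop : p = ⊤
  · rw [htop]
    refine memLp_top_of_bound hm 1 (Eventually.of_forall fun x => ?_)
    rw [Real.norm_of_nonneg (decayWeight_pos x).le]
    exact decayWeight_le_one x
  · rw [← integrable_norm_rpow_iff hm (by positivity) htop]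
    refine (integrable_decayWeight d).mono' ?_ (Eventually.of_forall fun x => ?_)
    · exact (hm.norm.aemeasurable.pow_const _).aestronglyMeasurable
    · rw [Real.norm_of_nonneg (decayWeight_pos x).le,
        Real.norm_of_nonneg (Real.rpow_nonneg (decayWeight_pos x).le _)]
      refine (Real.rpow_le_rpow_of_exponent_ge (decayWeight_pos x) (decayWeight_le_one x)
        (z := 1) ?_).trans_eq (Real.rpow_one _)
      simpa using ENNReal.toReal_mono htop hp

theorem norm_le_mul_decayWeight {f : Eucl d → ℂ} {C : ℝ} {x : Eucl d}
    (h : (1 + ‖x‖ ^ 2) ^ (d + 1) * ‖f x‖ ≤ C) : ‖f x‖ ≤ C * decayWeight d x := by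
  rw [decayWeight, ← div_eq_mul_inv, le_div_iff₀ (by positivity)]
  linarith

theorem memLp_of_weighted_bound {f : Eucl d → ℂ} (hf : Continuous f) {C : ℝ}
    (hC : ∀ x, (1 + ‖x‖ ^ 2) ^ (d + 1) * ‖f x‖ ≤ C) {p : ℝ≥0∞} (hp : 1 ≤ p) :
    MemLp f p volume :=
  ((memLp_decayWeight d hp).const_mul C).mono' hf.aestronglyMeasurable
    (Eventually.of_forall fun x => norm_le_mul_decayWeight (hC x))

theorem norm_toLp_sub_le {f g : Eucl d → ℂ} {p : ℝ≥0∞} [hp : Fact (1 ≤ p)]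
    (hf : MemLp f p volume) (hg : MemLp g p volume) {C : ℝ}
    (hC : ∀ x, (1 + ‖x‖ ^ 2) ^ (d + 1) * ‖f x - g x‖ ≤ C) :
    ‖hf.toLp f - hg.toLp g‖ ≤ C * ‖(memLp_decayWeight d hp.out).toLp‖ := by
  refine Lp.norm_le_mul_norm_of_ae_le_mul ?_
  rw [← MemLp.toLp_sub]
  filter_upwards [(hf.sub hg).coeFn_toLp, (memLp_decayWeight d hp.out).coeFn_toLp] with x h1 h2
  rw [h1, h2, Real.norm_of_nonneg (decayWeight_pos x).le, Pi.sub_apply]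
  exact norm_le_mul_decayWeight (f := fun x => f x - g x) (hC x)

theorem weight_mul_norm_le_of_succ {f : Eucl d → ℂ} {C : ℝ} {x : Eucl d}
    (h : (1 + ‖x‖ ^ 2) ^ (d + 2) * ‖f x‖ ≤ C) : (1 + ‖x‖ ^ 2) ^ (d + 1) * ‖f x‖ ≤ C := by
  refine le_trans ?_ h
  gcongr
  · nlinarith [sq_nonneg ‖x‖]
  · omega

/-- A jointly continuous function with uniform polynomial decay in space is a continuous curve in
`L^p`. -/
theorem continuous_toLp_of_weighted_bound {A : Type*} [TopologicalSpace A] {f : A → Eucl d → ℂ}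
    (hf : Continuous fun q : A × Eucl d => f q.1 q.2) {C : ℝ}
    (hC : ∀ t x, (1 + ‖x‖ ^ 2) ^ (d + 2) * ‖f t x‖ ≤ C) {p : ℝ≥0∞} [hp : Fact (1 ≤ p)]
    (hm : ∀ t, MemLp (f t) p volume) : Continuous fun t => (hm t).toLp (f t) := by
  rw [continuous_iff_continuousAt]
  intro t₀
  rw [ContinuousAt, Metric.tendsto_nhds]
  intro ε hε
  set w := ‖(memLp_decayWeight d hp.out).toLp‖ with hw
  have hw0 : 0 ≤ w := norm_nonneg _
  set δ : ℝ := ε / (w + 1) with hδ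
  have hδ0 : 0 < δ := by positivity
  have hC0 : 0 ≤ C := le_trans (by positivity) (hC t₀ 0)
  -- Outside the ball of radius R the spare weight 1 + |x|² is at least 2C/δ, which makes the
  -- difference small without using continuity. Inside, compactness makes the continuity in t
  -- uniform in x.
  set R : ℝ := 1 + 2 * C / δ with hR
  have hR1 : 1 ≤ R := by rw [hR]; linarith [div_nonneg (by positivity : 0 ≤ 2 * C) hδ0.le]
  have hK : ∀ᶠ t in 𝓝 t₀, ∀ x ∈ Metric.closedBall (0 : Eucl d) R,
      (1 + ‖x‖ ^ 2) ^ (d + 1) * ‖f t x - f t₀ x‖ < δ := by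
    refine (isCompact_closedBall _ _).eventually_forall_of_forall_eventually fun y _ => ?_
    have h3 : Continuous fun z : A × Eucl d => (t₀, z.2) := by fun_prop
    have h4 := hf.comp h3
    simp only [Function.comp_def] at h4
    have hc : Continuous fun z : A × Eucl d =>
        (1 + ‖z.2‖ ^ 2) ^ (d + 1) * ‖f z.1 z.2 - f t₀ z.2‖ := by fun_prop
    have h0 : (1 + ‖y‖ ^ 2) ^ (d + 1) * ‖f t₀ y - f t₀ y‖ < δ := by simpa using hδ0
    exact hc.continuousAt.eventually_lt (continuousAt_const (y := δ)) h0
  filter_upwards [hK] with t ht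
  have hle : ∀ x, (1 + ‖x‖ ^ 2) ^ (d + 1) * ‖f t x - f t₀ x‖ ≤ δ := fun x => by
    by_cases hx : x ∈ Metric.closedBall (0 : Eucl d) R
    · exact (ht x hx).le
    · have hx' : R < ‖x‖ := by simpa using hx
      have h1 : 2 * C ≤ δ * (1 + ‖x‖ ^ 2) := by
        have : 2 * C / δ ≤ 1 + ‖x‖ ^ 2 := by nlinarith
        rwa [div_le_iff₀' hδ0] at this
      have h2 := hC t x
      have h3 := hC t₀ x
      have h4 : (1 + ‖x‖ ^ 2) ^ (d + 1) * ‖f t x - f t₀ x‖ * (1 + ‖x‖ ^ 2) ≤ 2 * C := by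
        calc _ = (1 + ‖x‖ ^ 2) ^ (d + 2) * ‖f t x - f t₀ x‖ := by ring
          _ ≤ (1 + ‖x‖ ^ 2) ^ (d + 2) * (‖f t x‖ + ‖f t₀ x‖) := by gcongr; exact norm_sub_le _ _
          _ ≤ 2 * C := by linarith
      exact le_of_mul_le_mul_right (h4.trans h1) (by positivity)
  rw [dist_eq_norm]
  calc _ ≤ δ * w := norm_toLp_sub_le (hm t) (hm t₀) hle
    _ < δ * (w + 1) := by gcongr; linarith
    _ = ε := by rw [hδ]; field_simp

end WeightedLp

/-! ### Elements of Sobolev spaces -/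

section Sobolev

variable {d : ℕ}

/-- The element `(Id - Δ)^{-s/2} f` of `W^{s,p}`. -/
def SobolevSpace.ofLp (s : ℝ) {p : ℝ≥0∞} [Fact (1 ≤ p)] (f : Lp ℂ p (volume : Measure (Eucl d))) :
    SobolevSpace d s p :=
  ⟨besselOp d (-s) (Lp.toTemperedDistributionCLM ℂ volume p f), f, by
    have h := besselOp_neg_besselOp d (-s) (Lp.toTemperedDistributionCLM ℂ volume p f)
    rw [neg_neg] at h
    exact h.symm⟩

theorem SobolevSpace.toDistribution_ofLp (s : ℝ) {p : ℝ≥0∞} [Fact (1 ≤ p)]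
    (f : Lp ℂ p (volume : Measure (Eucl d))) :
    (SobolevSpace.ofLp s f).toDistribution =
      besselOp d (-s) (Lp.toTemperedDistributionCLM ℂ volume p f) := rfl

theorem SobolevSpace.toLp_ofLp (s : ℝ) {p : ℝ≥0∞} [Fact (1 ≤ p)]
    (f : Lp ℂ p (volume : Measure (Eucl d))) : toLp (SobolevSpace.ofLp s f) = f := by
  apply toTemperedDistributionCLM_injective
  rw [toLp_spec, toDistribution_ofLp]
  have h := besselOp_neg_besselOp d (-s) (Lp.toTemperedDistributionCLM ℂ volume p f)
  rwa [neg_neg] at h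

theorem SobolevSpace.isometry_ofLp (s : ℝ) {p : ℝ≥0∞} [Fact (1 ≤ p)] :
    Isometry (SobolevSpace.ofLp s : Lp ℂ p (volume : Measure (Eucl d)) → SobolevSpace d s p) :=
  Isometry.of_dist_eq fun f g => by
    rw [dist_eq_norm, dist_eq_norm, norm_eq, map_sub, toLp_ofLp, toLp_ofLp]

/-- Norm limits can thus be tested against Schwartz functions, which identifies the limits found for
different p and α with one another. -/
theorem SobolevSpace.continuous_toDistribution_ofLp_apply (s : ℝ) {p : ℝ≥0∞} [Fact (1 ≤ p)]
    (φ : 𝓢(Eucl d, ℂ)) :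
    Continuous fun f : Lp ℂ p (volume : Measure (Eucl d)) =>
      (SobolevSpace.ofLp s f).toDistribution φ := by
  have h : Continuous fun D : 𝓢'(Eucl d, ℂ) => D φ := continuous_eval_const φ
  exact h.comp ((besselOp d (-s)).continuous.comp
    (Lp.toTemperedDistributionCLM ℂ (volume : Measure (Eucl d)) p).continuous)

theorem integral_fourier_mul_eq_flip {f g : Eucl d → ℂ} (hf : Integrable f) (hg : Integrable g) :
    ∫ x, FourierTransform.fourier f x * g x = ∫ x, f x * FourierTransform.fourier g x := by
  simpa using! VectorFourier.integral_fourierIntegral_smul_eq_flip (L := innerₗ (Eucl d))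
    Real.continuous_fourierChar continuous_inner hf hg

/-- Reflecting x moves the inversion from `v` to the Schwartz function. The Fourier transform is
then flipped and inverted on the Schwartz side, so integrability of `v` suffices. -/
theorem integral_fourier_mul_fourierInv (ψ : 𝓢(Eucl d, ℂ)) {v : Eucl d → ℂ} (hv : Integrable v) :
    ∫ x, (FourierTransform.fourier ψ : 𝓢(Eucl d, ℂ)) x * FourierTransformInv.fourierInv v x =
      ∫ x, ψ x * v x := by
  have h1 : ∫ x, (FourierTransform.fourier ψ : 𝓢(Eucl d, ℂ)) x *
      FourierTransformInv.fourierInv v x =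
      ∫ x, (FourierTransformInv.fourierInv ψ : 𝓢(Eucl d, ℂ)) x * FourierTransform.fourier v x := by
    rw [← integral_neg_eq_self]
    refine integral_congr_ae (Eventually.of_forall fun x => ?_)
    simp only [Real.fourierInv_eq_fourier_neg, neg_neg, SchwartzMap.fourierInv_coe,
      SchwartzMap.fourier_coe]
  rw [h1, ← integral_fourier_mul_eq_flip (FourierTransformInv.fourierInv ψ).integrable hv,
    ← SchwartzMap.fourier_coe, FourierTransform.fourier_fourierInv_eq]

theorem cutoffFourier_eq_fourier (c : 𝓢(Eucl d, ℂ)) (f : Eucl d → ℂ) :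
    cutoffFourier c f = FourierTransform.fourier fun z => c z * f z := by
  funext ζ
  rw [Real.fourier_eq', cutoffFourier]
  refine integral_congr_ae (Eventually.of_forall fun z => ?_)
  simp only [smul_eq_mul]
  rw [real_inner_comm, mul_right_comm, mul_comm (c z * f z)]
  congr 2
  push_cast
  ring

theorem besselApply_eq_fourierInv (s : ℝ) (c : 𝓢(Eucl d, ℂ)) (f : Eucl d → ℂ) :
    besselApply s c f =
      FourierTransformInv.fourierInv fun ζ => besselSymbol d s ζ * cutoffFourier c f ζ := by
  funext x
  rw [Real.fourierInv_eq', besselApply]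
  refine integral_congr_ae (Eventually.of_forall fun ζ => ?_)
  simp only [smul_eq_mul]
  rw [mul_right_comm, mul_comm, mul_comm Complex.I]

theorem besselSymbol_neg_mul (d : ℕ) (s : ℝ) (ζ : Eucl d) :
    besselSymbol d (-s) ζ * besselSymbol d s ζ = 1 := by
  have hx : 0 < 1 + ‖(2 * Real.pi) • ζ‖ ^ 2 := by positivity
  rw [besselSymbol, besselSymbol, ← Complex.ofReal_mul, ← Real.rpow_add hx]
  ring_nf
  simp

/-- `besselApply` computes `(Id - Δ)^{s/2}` in the sense of distributions. -/
theorem HasCutoffDecay.isGivenBy_ofLp {s : ℝ} {c : 𝓢(Eucl d, ℂ)} {A : Type*} [TopologicalSpace A]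
    [FirstCountableTopology A] [LocallyCompactSpace A] {f : A → Eucl d → ℂ}
    (h : HasCutoffDecay s c f) {r : ℝ} (hr : ∀ z, r < ‖z‖ → c z = 0) (t : A) {p : ℝ≥0∞}
    [Fact (1 ≤ p)] (hm : MemLp (besselApply s c (f t)) p volume) :
    IsGivenBy (SobolevSpace.ofLp s (hm.toLp _)).toDistribution fun x => c x * f t x := by
  intro φ
  -- By duality the multiplier of order -s acts on the test function; its product with the symbol of
  -- order s inside `besselApply` is 1.
  set ψ : 𝓢(Eucl d, ℂ) := SchwartzMap.smulLeftCLM ℂ (besselSymbol d (-s))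
    (FourierTransformInv.fourierInv φ) with hψ
  have hY : Integrable fun ζ => besselSymbol d s ζ * cutoffFourier c (f t) ζ := by
    simpa using h.integrable hr t 0
  have hcf : Integrable fun z => c z * f t z := by
    refine (c.continuous.mul (h.continuous_slice t)).integrable_of_hasCompactSupport
      (HasCompactSupport.of_support_subset_isCompact (isCompact_closedBall 0 r) fun z hz => ?_)
    by_contra hz'
    exact hz (by simp [hr z (by simpa using hz')])
  have h1 : (SobolevSpace.ofLp s (hm.toLp _)).toDistribution φ =
      ∫ x, (FourierTransform.fourier ψ : 𝓢(Eucl d, ℂ)) x * besselApply s c (f t) x := by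
    rw [SobolevSpace.toDistribution_ofLp, besselOp,
      TemperedDistribution.fourierMultiplierCLM_apply_apply, ← hψ,
      Lp.toTemperedDistributionCLM_apply, Lp.toTemperedDistribution_apply]
    refine integral_congr_ae ?_
    filter_upwards [hm.coeFn_toLp] with x hx
    rw [hx, smul_eq_mul]
  rw [h1, besselApply_eq_fourierInv, integral_fourier_mul_fourierInv ψ hY]
  have h2 : ∀ ζ, ψ ζ * (besselSymbol d s ζ * cutoffFourier c (f t) ζ) =
      (FourierTransformInv.fourierInv φ : 𝓢(Eucl d, ℂ)) ζ * cutoffFourier c (f t) ζ := fun ζ => by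
    rw [hψ, SchwartzMap.smulLeftCLM_apply_apply (besselSymbol_hasTemperateGrowth d _), smul_eq_mul,
      mul_mul_mul_comm, besselSymbol_neg_mul, one_mul]
  simp only [h2]
  rw [cutoffFourier_eq_fourier, ← integral_fourier_mul_eq_flip
    (FourierTransformInv.fourierInv φ).integrable hcf, ← SchwartzMap.fourier_coe,
    FourierTransform.fourier_fourierInv_eq]

end Sobolev

/-! ### Convergence in Sobolev spaces -/

/-- The pointwise limit of a sequence of functionals, if it is a tempered distribution, and `0`
otherwise. -/
def weakLimit {d : ℕ} (D : ℕ → 𝓢(Eucl d, ℂ) → ℂ) : 𝓢'(Eucl d, ℂ) :=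
  open Classical in
  if h : ∃ L : 𝓢'(Eucl d, ℂ), ∀ φ, Tendsto (fun n => D n φ) atTop (𝓝 (L φ)) then h.choose else 0

theorem weakLimit_eq {d : ℕ} {D : ℕ → 𝓢(Eucl d, ℂ) → ℂ} {L : 𝓢'(Eucl d, ℂ)}
    (h : ∀ φ, Tendsto (fun n => D n φ) atTop (𝓝 (L φ))) : weakLimit D = L := by
  have hex : ∃ L : 𝓢'(Eucl d, ℂ), ∀ φ, Tendsto (fun n => D n φ) atTop (𝓝 (L φ)) := ⟨L, h⟩
  rw [weakLimit, dif_pos hex]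
  exact DFunLike.ext _ _ fun φ => tendsto_nhds_unique (hex.choose_spec φ) (h φ)

/-- A sequence of functions whose Bessel potentials have geometrically small increments converges
in the space of continuous curves in `W^{s,p}`. -/
theorem exists_tendsto_sobolev {d : ℕ} {s : ℝ} {c : 𝓢(Eucl d, ℂ)} {r : ℝ}
    (hr : ∀ z, r < ‖z‖ → c z = 0) {A : Type*} [TopologicalSpace A] [FirstCountableTopology A]
    [CompactSpace A] [LocallyCompactSpace A] {f : ℕ → A → Eucl d → ℂ}
    (hf : ∀ n, HasCutoffDecay s c (f n)) {C θ : ℝ} (hC : 0 ≤ C) (hθ0 : 0 ≤ θ) (hθ : θ < 1)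
    (hinc : ∀ n t x, (1 + ‖x‖ ^ 2) ^ (d + 2) *
      ‖increment (fun n => besselApply s c (f n t) x) n‖ ≤ C * θ ^ n)
    (p : ℝ≥0∞) [hp : Fact (1 ≤ p)] :
    ∃ (F : ℕ → C(A, SobolevSpace d s p)) (G : C(A, SobolevSpace d s p)),
      (∀ n t, IsGivenBy (F n t).toDistribution fun x => c x * f n t x) ∧
      (∀ t φ, Tendsto (fun n => (F n t).toDistribution φ) atTop (𝓝 ((G t).toDistribution φ))) ∧
      Tendsto F atTop (𝓝 G) := by
  have hbd : ∀ n t x, (1 + ‖x‖ ^ 2) ^ (d + 2) * ‖besselApply s c (f n t) x‖ ≤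
      C * ∑ k ∈ Finset.range (n + 1), θ ^ k := fun n t x => by
    rw [← sum_range_increment (fun n => besselApply s c (f n t) x) n, Finset.mul_sum]
    calc _ ≤ (1 + ‖x‖ ^ 2) ^ (d + 2) * ∑ k ∈ Finset.range (n + 1),
          ‖increment (fun n => besselApply s c (f n t) x) k‖ := by gcongr; exact norm_sum_le _ _
      _ ≤ _ := by
          rw [Finset.mul_sum]
          exact Finset.sum_le_sum fun k _ => hinc k t x
  have hcont := fun n => (hf n).continuous_besselApply hr
  have hslice : ∀ n t, Continuous (besselApply s c (f n t)) := fun n t => by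
    have h3 : Continuous fun x : Eucl d => (t, x) := by fun_prop
    have h4 := (hcont n).comp h3
    simp only [Function.comp_def] at h4
    exact h4
  have hm : ∀ n t, MemLp (besselApply s c (f n t)) p volume := fun n t =>
    memLp_of_weighted_bound (hslice n t) (fun x => weight_mul_norm_le_of_succ (hbd n t x)) hp.out
  set g : ℕ → C(A, Lp ℂ p (volume : Measure (Eucl d))) := fun n =>
    ⟨fun t => (hm n t).toLp _, continuous_toLp_of_weighted_bound (hcont n) (hbd n) (hm n)⟩ with hg
  set w := ‖(memLp_decayWeight d hp.out).toLp‖ with hw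
  have hw0 : 0 ≤ w := norm_nonneg _
  have hdist : ∀ n, dist (g n) (g (n + 1)) ≤ (C * θ * w) * θ ^ n := fun n => by
    rw [dist_comm, ContinuousMap.dist_le (by positivity)]
    intro t
    rw [dist_eq_norm]
    refine (norm_toLp_sub_le (hm (n + 1) t) (hm n t) (C := C * θ ^ (n + 1)) fun x =>
      weight_mul_norm_le_of_succ (f := fun x => besselApply s c (f (n + 1) t) x -
        besselApply s c (f n t) x) (hinc (n + 1) t x)).trans_eq ?_
    rw [pow_succ, ← hw]
    ring
  obtain ⟨g', hg'⟩ := cauchySeq_tendsto_of_complete (cauchySeq_of_le_geometric θ _ hθ hdist)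
  set J : C(Lp ℂ p (volume : Measure (Eucl d)), SobolevSpace d s p) :=
    ⟨SobolevSpace.ofLp s, (SobolevSpace.isometry_ofLp s).continuous⟩ with hJ
  refine ⟨fun n => J.comp (g n), J.comp g', fun n t => (hf n).isGivenBy_ofLp hr t (hm n t),
    fun t φ => ?_, ((ContinuousMap.continuous_postcomp J).tendsto g').comp hg'⟩
  exact ((SobolevSpace.continuous_toDistribution_ofLp_apply s φ).tendsto (g' t)).comp
    (((continuous_eval_const t).tendsto g').comp hg')

/-! ### Smooth cut-offs and the convergence theorem -/

theorem exists_schwartzMap_eq_ofReal {d : ℕ} {χ : Eucl d → ℝ} (hχ : ContDiff ℝ (⊤ : ℕ∞) χ)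
    (hχc : HasCompactSupport χ) : ∃ c : 𝓢(Eucl d, ℂ), ∀ z, c z = (χ z : ℂ) := by
  have h1 : ContDiff ℝ (⊤ : ℕ∞) fun z => (χ z : ℂ) := Complex.ofRealCLM.contDiff.comp hχ
  have h2 : HasCompactSupport fun z => (χ z : ℂ) :=
    hχc.comp_left (g := fun x : ℝ => (x : ℂ)) Complex.ofReal_zero
  exact ⟨h2.toSchwartzMap h1, fun z => rfl⟩

theorem exists_forall_eq_zero_of_hasCompactSupport {d : ℕ} {χ : Eucl d → ℝ}
    (hχ : HasCompactSupport χ) : ∃ r : ℝ, 0 ≤ r ∧ ∀ z, r < ‖z‖ → χ z = 0 := by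
  obtain ⟨r, hr⟩ := hχ.isCompact.isBounded.subset_closedBall 0
  refine ⟨max r 0, le_max_right _ _, fun z hz => image_eq_zero_of_notMem_tsupport fun h => ?_⟩
  have := hr h
  rw [mem_closedBall_zero_iff] at this
  exact absurd ((le_max_left r 0).trans_lt hz) (not_lt.mpr this)

theorem proposition1p2 {d : ℕ} (hd : 1 ≤ d) (H : Fin (d + 1) → ℝ)
    (hH : ∀ i, H i ∈ Set.Ioo (0 : ℝ) 1) (T : ℝ≥0)
    {Ω : Type*} [MeasurableSpace Ω] (P : Measure Ω) [IsProbabilityMeasure P]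
    (Ψ : ℕ → ℝ≥0 → Eucl d → Ω → ℂ) (hΨ : IsLinearSolution H P Ψ)
    (hcont : ∀ n, ∀ᵐ ω ∂P, ContinuousOn (fun q : ℝ≥0 × Eucl d => Ψ n q.1 q.2 ω)
      (Set.Icc 0 T ×ˢ Set.univ))
    (χ : Eucl d → ℝ) (hχ : ContDiff ℝ (⊤ : ℕ∞) χ) (hχc : HasCompactSupport χ) :
    ∃ χΨ : Ω → Set.Icc (0 : ℝ≥0) T → 𝓢'(Eucl d, ℂ),
      ∀ (p : ℝ≥0∞) [Fact (1 ≤ p)] (α : ℝ), 2 ≤ p →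
        α > d + 1 - (2 * H 0 + ∑ i : Fin d, H i.succ) →
        ∀ᵐ ω ∂P, ∃ (F : ℕ → C(Set.Icc (0 : ℝ≥0) T, SobolevSpace d (-α) p))
          (G : C(Set.Icc (0 : ℝ≥0) T, SobolevSpace d (-α) p)),
          (∀ n t, IsGivenBy (F n t).toDistribution (fun x => (χ x : ℂ) * Ψ n t x ω)) ∧
          (∀ t, (G t).toDistribution = χΨ ω t) ∧
          Tendsto F atTop (𝓝 G) := by
  have hc : ∀ n, ∀ᵐ ω ∂P, Continuous fun q : Set.Icc (0 : ℝ≥0) T × Eucl d => Ψ n q.1 q.2 ω := by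
    intro n
    filter_upwards [hcont n] with ω hω
    exact hω.comp_continuous (f := fun q : Set.Icc (0 : ℝ≥0) T × Eucl d => ((q.1 : ℝ≥0), q.2))
      (by fun_prop) fun q => ⟨q.1.2, Set.mem_univ _⟩
  obtain ⟨c, hcχ⟩ := exists_schwartzMap_eq_ofReal hχ hχc
  obtain ⟨r, hr0, hr⟩ : ∃ r : ℝ, 0 ≤ r ∧ ∀ z, r < ‖z‖ → c z = 0 := by
    obtain ⟨r, hr0, hr⟩ := exists_forall_eq_zero_of_hasCompactSupport hχc
    exact ⟨r, hr0, fun z hz => by rw [hcχ, hr z hz, Complex.ofReal_zero]⟩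
  -- The weak limit of the functions χΨ_n(t) is fixed before p and α are introduced; outside the
  -- convergence event the default value 0 is harmless.
  refine ⟨fun ω t => weakLimit fun n φ => ∫ x, φ x * ((χ x : ℂ) * Ψ n t x ω),
    fun p _ α _ hα => ?_⟩
  -- Of the d + 3 weights one is cancelled by the factor 1 + |x|² of the chaining bound, one serves
  -- the continuity in time, and d + 1 give membership in L^p.
  obtain ⟨θ, hθ0, hθ1, hθ⟩ := ae_exists_besselIncrement_bound (T := T) hd hH hΨ hc hr0 hr hα (d + 3)
  filter_upwards [hθ, ae_hasCutoffDecay (T := T) hd hH hΨ hc hr0 hr (-α)] with ω ⟨C, hC0, hC⟩ hω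
  have hinc : ∀ (n : ℕ) (t : Set.Icc (0 : ℝ≥0) T) (x : Eucl d), (1 + ‖x‖ ^ 2) ^ (d + 2) *
      ‖besselIncrement (-α) c Ψ n t x ω‖ ≤ C * θ ^ n := fun n t x => by
    have h := hC n t x
    rw [show d + 3 = d + 2 + 1 by ring, pow_succ, mul_right_comm] at h
    exact le_of_mul_le_mul_right h (by positivity)
  simp only [besselIncrement] at hinc
  obtain ⟨F, G, h1, h2, h3⟩ := exists_tendsto_sobolev
    (f := fun n (t : Set.Icc (0 : ℝ≥0) T) z => Ψ n t z ω) hr hω hC0 hθ0.le hθ1 hinc p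
  simp only [hcχ] at h1
  refine ⟨F, G, h1, fun t => (weakLimit_eq fun φ => ?_).symm, h3⟩
  exact (h2 t φ).congr fun n => h1 n t φ

end
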